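/- Throughout, a CNF formula $F=(V,C)$ consists of a finite set $V$ of variables and a finite multiset $C$ of non-empty clauses over $V$ (a clause is a finite set of literals $x$, $\bar x$ with $x\in V$). Write $m=|C|$ for the number of clauses, counted with multiplicity, and ${\rm sat}(F)$ for the maximum number of clauses (with multiplicity) satisfied by a truth assignment $V\to\{\textsc{true},\textsc{false}\}$. The formula is unit-conflict free (UCF) if there is no $x\in V$ for which both unit clauses $(x)$ and $(\bar x)$ are in $C$. Let $\varphi=(\sqrt5-1)/2$. Formulas are encoded as strings over a finite alphabet $\Sigma$ in the usual way, variables being named by bit strings and each clause being written as often as it occurs. A parameterized problem is a set $L\subseteq\Sigma^*\times\mathbb N$. It is fixed-parameter tractable if some algorithm decides whether $(x,k)\in L$ in time $f(k)\,|x|^{O(1)}$ for some function $f$. A kernelization of $L$ yielding proper kernels is an algorithm that maps every $(x,k)\in\Sigma^*\times\mathbb N$, in time polynomial in $|x|+k$, to a pair $(x',k')\in\Sigma^*\times\mathbb N$ (the kernel) such that (i) $(x,k)\in L$ if and only if $(x',k')\in L$, (ii) $k'\le k$, and (iii) $|x'|\le g(k)$ for some function $g$. Let SAT-A($\varphi m$)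 be the set of all pairs $(x,k)$ such that $x$ encodes a UCF CNF formula $F$ with $m$ clauses and ${\rm sat}(F)\ge\varphi m+k$. **Theorem.** SAT-A($\varphi m$) has a proper kernel with at most $\lfloor(7+3\sqrt5)k\rfloor$ variables; that is, it has a kernelization yielding proper kernels which, whenever $x$ encodes a UCF CNF formula, outputs a pair $(x',k')$ in which $x'$ encodes a UCF CNF formula with at most $\lfloor(7+3\sqrt5)k\rfloor$ variables. Hence SAT-A($\varphi m$) is fixed-parameter tractable. -/

import Mathlib

namespace SatKernel

/-! ### A machine model with a time count

Programs of a variable-free WHILE language over binary trees. Every instruction is charged at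
least the size of the data it reads and of the data it writes, so that time in this model and
time on a Turing machine bound each other polynomially. -/

/-- Data of the machine: binary trees. -/
inductive Data where
  | nil : Data
  | pair : Data → Data → Data

/-- The number of nodes of a tree. -/
def Data.size : Data → ℕ
  | .nil => 1
  | .pair a b => a.size + b.size + 1

/-- Programs. Each one acts on a single tree (the whole memory); `nil` counts as "false" in
tests and every other tree as "true". -/
inductive Prog where
  /-- return the input -/
  | id : Prog
  /-- return `nil` -/
  | nil : Prog
  /-- return the left subtree of the input (`nil` if there is none) -/
  | fst : Prog
  /-- return the right subtree of the input (`nil` if there is none) -/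
  | snd : Prog
  /-- run both programs on the input and pair the results -/
  | pair : Prog → Prog → Prog
  /-- `seq f g` runs `f`, then `g` on its result -/
  | seq : Prog → Prog → Prog
  /-- `ite c f g` runs `f` if the test `c` is true of the input, and `g` otherwise -/
  | ite : Prog → Prog → Prog → Prog
  /-- `loop c f` replaces the memory by the result of `f` as long as the test `c` is true of it -/
  | loop : Prog → Prog → Prog

/-- `Eval P d e t`: the program `P`, started on the tree `d`, halts with output `e` after
exactly `t` time units. -/
inductive Eval : Prog → Data → Data → ℕ → Prop where
  | id (d : Data) : Eval .id d d d.size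
  | nil (d : Data) : Eval .nil d .nil d.size
  | fst_nil : Eval .fst .nil .nil 1
  | fst_pair (a b : Data) : Eval .fst (.pair a b) a (Data.pair a b).size
  | snd_nil : Eval .snd .nil .nil 1
  | snd_pair (a b : Data) : Eval .snd (.pair a b) b (Data.pair a b).size
  | pair {f g : Prog} {d a b : Data} {s t : ℕ} :
      Eval f d a s → Eval g d b t → Eval (.pair f g) d (.pair a b) (s + t + 1)
  | seq {f g : Prog} {d e r : Data} {s t : ℕ} :
      Eval f d e s → Eval g e r t → Eval (.seq f g) d r (s + t + 1)
  | ite_true {c f g : Prog} {d a b r : Data} {s t : ℕ} :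
      Eval c d (.pair a b) s → Eval f d r t → Eval (.ite c f g) d r (s + t + 1)
  | ite_false {c f g : Prog} {d r : Data} {s t : ℕ} :
      Eval c d .nil s → Eval g d r t → Eval (.ite c f g) d r (s + t + 1)
  | loop_done {c f : Prog} {d : Data} {s : ℕ} :
      Eval c d .nil s → Eval (.loop c f) d d (s + 1)
  | loop_step {c f : Prog} {d a b e r : Data} {s t u : ℕ} :
      Eval c d (.pair a b) s → Eval f d e t → Eval (.loop c f) e r u →
        Eval (.loop c f) d r (s + t + u + 1)

/-- The machine is deterministic: output and running time are determined by the input. -/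
theorem Eval.det {P : Prog} {d e e' : Data} {t t' : ℕ}
    (h : Eval P d e t) (h' : Eval P d e' t') : e = e' ∧ t = t' := by
  induction h generalizing e' t' with
  | id | nil | fst_nil | fst_pair | snd_nil | snd_pair => cases h'; exact ⟨rfl, rfl⟩
  | pair _ _ ih₁ ih₂ =>
    cases h' with
    | pair k₁ k₂ =>
      obtain ⟨rfl, rfl⟩ := ih₁ k₁
      obtain ⟨rfl, rfl⟩ := ih₂ k₂
      exact ⟨rfl, rfl⟩
  | seq _ _ ih₁ ih₂ =>
    cases h' with
    | seq k₁ k₂ =>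
      obtain ⟨rfl, rfl⟩ := ih₁ k₁
      obtain ⟨rfl, rfl⟩ := ih₂ k₂
      exact ⟨rfl, rfl⟩
  | ite_true _ _ ih₁ ih₂ =>
    cases h' with
    | ite_true k₁ k₂ =>
      obtain ⟨_, rfl⟩ := ih₁ k₁
      obtain ⟨rfl, rfl⟩ := ih₂ k₂
      exact ⟨rfl, rfl⟩
    | ite_false k₁ k₂ => exact absurd (ih₁ k₁).1 (by simp)
  | ite_false _ _ ih₁ ih₂ =>
    cases h' with
    | ite_true k₁ k₂ => exact absurd (ih₁ k₁).1 (by simp)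
    | ite_false k₁ k₂ =>
      obtain ⟨_, rfl⟩ := ih₁ k₁
      obtain ⟨rfl, rfl⟩ := ih₂ k₂
      exact ⟨rfl, rfl⟩
  | loop_done _ ih₁ =>
    cases h' with
    | loop_done k₁ =>
      obtain ⟨_, rfl⟩ := ih₁ k₁
      exact ⟨rfl, rfl⟩
    | loop_step k₁ k₂ k₃ => exact absurd (ih₁ k₁).1 (by simp)
  | loop_step _ _ _ ih₁ ih₂ ih₃ =>
    cases h' with
    | loop_done k₁ => exact absurd (ih₁ k₁).1 (by simp)
    | loop_step k₁ k₂ k₃ =>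
      obtain ⟨_, rfl⟩ := ih₁ k₁
      obtain ⟨rfl, rfl⟩ := ih₂ k₂
      obtain ⟨rfl, rfl⟩ := ih₃ k₃
      exact ⟨rfl, rfl⟩

/-- The running time is at least the size of the input and the size of the output, so large
trees cannot be built cheaply. -/
theorem Eval.size_le {P : Prog} {d e : Data} {t : ℕ} (h : Eval P d e t) :
    d.size ≤ t ∧ e.size ≤ t := by
  induction h with
  | nil d => cases d <;> simp [Data.size]
  | id | fst_nil | fst_pair | snd_nil | snd_pair | pair | seq | ite_true | ite_false
  | loop_done | loop_step =>
    (try simp only [Data.size] at *)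
    constructor <;> omega

/-! ### Strings and numbers as machine data -/

/-- A list of trees as one tree. -/
def Data.ofList : List Data → Data
  | [] => .nil
  | a :: l => .pair a (Data.ofList l)

/-- A natural number, in unary. -/
def Data.ofNat (n : ℕ) : Data := Data.ofList (List.replicate n .nil)

/-- A truth value. -/
def Data.ofBool : Bool → Data
  | false => .nil
  | true => .pair .nil .nil

/-- The input `(x, k)` of a parameterized problem, where `x` is a string over the alphabet
`{0, …, s - 1}` and `k` is the parameter. -/
def Data.ofInstance {s : ℕ} (i : List (Fin s) × ℕ) : Data :=
  .pair (Data.ofList (i.1.map fun a => Data.ofNat a)) (Data.ofNat i.2)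

/-! ### Parameterized problems -/

/-- A parameterized problem over the finite alphabet `{0, …, s - 1}`. -/
abbrev ParamProblem (s : ℕ) : Type := Set (List (Fin s) × ℕ)

/-- The map `K` on instances is computed by a program within a time that is polynomial in
`|x| + k`. -/
def PolyTimeComputable {s : ℕ} (K : List (Fin s) × ℕ → List (Fin s) × ℕ) : Prop :=
  ∃ (P : Prog) (p : Polynomial ℕ), ∀ (x : List (Fin s)) (k : ℕ),
    ∃ t ≤ p.eval (x.length + k), Eval P (Data.ofInstance (x, k)) (Data.ofInstance (K (x, k))) t

/-- `K` is a kernelization of `L` that produces proper kernels: polynomial time, equivalent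
instances, parameter not increased, size bounded by a function of the parameter. -/
structure IsProperKernelization {s : ℕ} (L : ParamProblem s)
    (K : List (Fin s) × ℕ → List (Fin s) × ℕ) : Prop where
  polyTime : PolyTimeComputable K
  equivalent : ∀ i, i ∈ L ↔ K i ∈ L
  parameter_le : ∀ i, (K i).2 ≤ i.2
  size_le : ∃ g : ℕ → ℕ, ∀ i, (K i).1.length ≤ g i.2

open Classical in
/-- `L` is fixed-parameter tractable: membership of `(x, k)` is decided by a program in time
`f(k) · |x|^O(1)`. (The `+ 1` only serves the empty string.) -/
def IsFPT {s : ℕ} (L : ParamProblem s) : Prop :=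
  ∃ (P : Prog) (f : ℕ → ℕ) (c : ℕ), ∀ (x : List (Fin s)) (k : ℕ),
    ∃ t ≤ f k * (x.length + 1) ^ c,
      Eval P (Data.ofInstance (x, k)) (Data.ofBool (decide ((x, k) ∈ L))) t

/-! ### CNF formulas -/

/-- Names of variables are bit strings. -/
abbrev Name : Type := List Bool

/-- A literal: `(x, true)` is the variable `x` and `(x, false)` is its negation. -/
abbrev Literal : Type := Name × Bool

/-- A CNF formula: a finite set of variables and a multiset of non-empty clauses over them. -/
structure CNF where
  vars : Finset Name
  clauses : Multiset (Finset Literal)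
  clauses_nonempty : ∀ c ∈ clauses, c.Nonempty
  mem_vars : ∀ c ∈ clauses, ∀ l ∈ c, l.1 ∈ vars

/-- A truth assignment satisfies a clause if it makes one of the literals true. -/
abbrev CNF.Satisfies (F : CNF) (α : F.vars → Bool) (c : Finset Literal) : Prop :=
  ∃ x : F.vars, (x.1, α x) ∈ c

/-- The number of clauses, with multiplicity, that a truth assignment satisfies. -/
def CNF.weight (F : CNF) (α : F.vars → Bool) : ℕ := F.clauses.countP (F.Satisfies α)

/-- The maximum number of clauses that a truth assignment satisfies. -/
def CNF.sat (F : CNF) : ℕ := Finset.univ.sup F.weight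

/-- Unit-conflict free: no variable `x` has both `(x)` and its negation as unit clauses. -/
def CNF.UCF (F : CNF) : Prop :=
  ∀ x : Name, ¬ ({(x, true)} ∈ F.clauses ∧ {(x, false)} ∈ F.clauses)

/-! ### Formulas as strings

The alphabet has six symbols: the bits `0` and `1`, the symbol `2` before each variable in the
list of variables, the symbol `3` at the start of each clause, and the symbols `4` and `5`
before the variable of a positive and of a negative literal. -/

/-- A bit string over the alphabet of formulas. -/
def writeName (x : Name) : List (Fin 6) := x.map fun b => if b then 1 else 0

/-- A literal over the alphabet of formulas. -/
def writeLiteral (l : Literal) : List (Fin 6) := (if l.2 then 4 else 5) :: writeName l.1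

/-- A clause over the alphabet of formulas. -/
def writeClause (c : List Literal) : List (Fin 6) := 3 :: c.flatMap writeLiteral

/-- A list of variables, followed by a list of clauses. -/
def writeFormula (V : List Name) (C : List (List Literal)) : List (Fin 6) :=
  V.flatMap (fun x => 2 :: writeName x) ++ C.flatMap writeClause

/-- The string `w` is an encoding of the formula `F`; clauses are written as often as they
occur, and the orders in which variables, clauses and literals are listed do not matter. -/
def Encodes (w : List (Fin 6)) (F : CNF) : Prop :=
  ∃ (V : List Name) (C : List (List Literal)), w = writeFormula V C ∧
    V.toFinset = F.vars ∧ (C.map List.toFinset : Multiset (Finset Literal)) = F.clauses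

/-- The problem: given a UCF CNF formula `F` with `m` clauses and the parameter `k`, decide
whether `sat(F) ≥ φ m + k`, where `φ = (√5 - 1) / 2`. -/
def SatAbovePhi : ParamProblem 6 :=
  {i | ∃ F : CNF, Encodes i.1 F ∧ F.UCF ∧
    (F.sat : ℝ) ≥ (Real.sqrt 5 - 1) / 2 * (F.clauses.card : ℝ) + (i.2 : ℝ)}

end SatKernel

set_option linter.unusedSectionVars false

/-! Write m and n for the numbers of clauses and variables. The core is the bound sat(F) ≥ φm + (2 -
3φ)/2 · n for UCF formulas whose variables can be matched to distinct clauses in which they occur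
(`exists_count_ge_of_matching`). As (2 - 3φ)/2 = (7 - 3√5)/4 is the reciprocal of 7 + 3√5, such a
formula is a yes-instance as soon as n ≥ (7 + 3√5)k.

For the bound, signs are flipped so that all unit clauses are positive and every variable without a
unit clause occurs positively in its matched clause. Making all variables true independently with
probability φ satisfies each clause with probability at least φ, because φ² = 1 - φ. The surplus
comes from correlating variables with unit clauses: two ends of a pair are never both false and are
both true with probability only 2φ - 1, and a leaf is both independent enough of the rest and
negatively correlated with its end. A clause that witnesses a pair or a leaf gains 2 - 3φ, which
pays for two variables. The pairs are chosen greedily (`exists_roleSystem`), and maximality protects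
the clauses that are not used. For the uncorrelated variables three choices of probabilities are
compared in `exists_count_ge_of_positive`; if all three fell short, a linear combination of the
inequalities would be contradictory.

A general formula is brought into matched form by augmenting paths. If a variable cannot be matched,
all clauses that meet the variables reached from it are matched among these variables, so they can
be satisfied simultaneously whatever the other variables do. Replacing all such clauses by copies of
one positive unit clause keeps m, the optimum and unit-conflict freeness, and makes the formula
matched (`matchVars_spec`, `exists_satCount_reduceClauses_iff`, `exists_satCount_reduceClauses_ge`).

Few variables do not bound the number of clauses. But if 2^n is at most the length of the string,
exhaustive search is polynomial, and otherwise the string is shorter than 2^n (`solveOrKeep_spec`).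
Running times are handled by the predicate `PT`, closed under composition and under folds with
bounded states. Tractability follows by running a decider on the kernel. -/

namespace SatKernel

/-! ### Finite product distributions -/

section ProductDistribution

variable {V : Type*} [Fintype V] [DecidableEq V]

/-- The expectation of `F` when the coordinates `ω x` are independent with distributions `π x`. -/
def expect (π : V → Fin 3 → ℝ) (F : (V → Fin 3) → ℝ) : ℝ := ∑ ω, (∏ x, π x (ω x)) * F ω

/-- The function `F` depends only on the coordinates in `S`. -/
def DependsOnCoords (F : (V → Fin 3) → ℝ) (S : Finset V) : Prop :=
  ∀ ω ω' : V → Fin 3, (∀ x ∈ S, ω x = ω' x) → F ω = F ω'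

theorem expect_add (π : V → Fin 3 → ℝ) (F G : (V → Fin 3) → ℝ) :
    expect π (fun ω => F ω + G ω) = expect π F + expect π G := by
  simp [expect, mul_add, Finset.sum_add_distrib]

theorem expect_sub (π : V → Fin 3 → ℝ) (F G : (V → Fin 3) → ℝ) :
    expect π (fun ω => F ω - G ω) = expect π F - expect π G := by
  simp [expect, mul_sub, Finset.sum_sub_distrib]

theorem expect_sum {ι : Type*} (π : V → Fin 3 → ℝ) (s : Finset ι) (F : ι → (V → Fin 3) → ℝ) :
    expect π (fun ω => ∑ i ∈ s, F i ω) = ∑ i ∈ s, expect π (F i) := by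
  simp only [expect, Finset.mul_sum]
  exact Finset.sum_comm

theorem expect_mono {π : V → Fin 3 → ℝ} (hπ : ∀ x s, 0 ≤ π x s) {F G : (V → Fin 3) → ℝ}
    (h : ∀ ω, F ω ≤ G ω) : expect π F ≤ expect π G :=
  Finset.sum_le_sum fun ω _ =>
    mul_le_mul_of_nonneg_left (h ω) (Finset.prod_nonneg fun x _ => hπ x _)

theorem expect_prod (π : V → Fin 3 → ℝ) (f : V → Fin 3 → ℝ) :
    expect π (fun ω => ∏ x, f x (ω x)) = ∏ x, ∑ s, π x s * f x s := by
  rw [Finset.prod_univ_sum]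
  simp [expect, ← Finset.prod_mul_distrib]

theorem expect_const {π : V → Fin 3 → ℝ} (h1 : ∀ x, ∑ s, π x s = 1) (r : ℝ) :
    expect π (fun _ => r) = r := by
  have := expect_prod π (fun _ _ => 1)
  simp only [Finset.prod_const_one, mul_one, h1] at this
  simp only [expect, mul_one] at this ⊢
  rw [← Finset.sum_mul, this, one_mul]

theorem expect_coord {π : V → Fin 3 → ℝ} (h1 : ∀ x, ∑ s, π x s = 1) (y : V) (f : Fin 3 → ℝ) :
    expect π (fun ω => f (ω y)) = ∑ s, π y s * f s := by
  have := expect_prod π (fun x s => if x = y then f s else 1)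
  simp only [Finset.prod_ite_eq', Finset.mem_univ, if_true] at this
  rw [this, Finset.prod_eq_single y]
  · simp
  · intro b _ hb
    simp [hb, h1]
  · simp

/-- Functions of disjoint sets of coordinates are independent. -/
theorem expect_mul {π : V → Fin 3 → ℝ} (h1 : ∀ x, ∑ s, π x s = 1) {F G : (V → Fin 3) → ℝ}
    {S T : Finset V} (hF : DependsOnCoords F S) (hG : DependsOnCoords G T) (hST : Disjoint S T) :
    expect π (fun ω => F ω * G ω) = expect π F * expect π G := by
  classical
  let e := Equiv.piEquivPiSubtypeProd (fun x => x ∈ S) (fun _ : V => Fin 3)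
  -- The value 0 fills coordinates on which the function does not depend.
  let F' : ({x // x ∈ S} → Fin 3) → ℝ := fun a => F (e.symm (a, fun _ => 0))
  let G' : ({x // x ∉ S} → Fin 3) → ℝ := fun b => G (e.symm (fun _ => 0, b))
  let p : ({x // x ∈ S} → Fin 3) → ℝ := fun a => ∏ x, π x.1 (a x)
  let q : ({x // x ∉ S} → Fin 3) → ℝ := fun b => ∏ x, π x.1 (b x)
  have hFe : ∀ a b, F (e.symm (a, b)) = F' a := fun a b => hF _ _ fun x hx => by
    simp [e, Equiv.piEquivPiSubtypeProd, hx]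
  have hGe : ∀ a b, G (e.symm (a, b)) = G' b := fun a b => hG _ _ fun x hx => by
    have : x ∉ S := fun h => Finset.disjoint_left.mp hST h hx
    simp [e, Equiv.piEquivPiSubtypeProd, this]
  have hπe : ∀ a b, ∏ x, π x (e.symm (a, b) x) = p a * q b := fun a b => by
    rw [← Fintype.prod_subtype_mul_prod_subtype (fun x => x ∈ S)]
    congr 1
    · exact Finset.prod_congr (by ext; simp) fun x _ => by simp [e, Equiv.piEquivPiSubtypeProd, x.2]
    · exact Finset.prod_congr (by ext; simp) fun x _ => by simp [e, Equiv.piEquivPiSubtypeProd, x.2]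
  have key : ∀ H : (V → Fin 3) → ℝ,
      expect π H = ∑ a, ∑ b, p a * q b * H (e.symm (a, b)) := fun H => by
    rw [expect, ← e.symm.sum_comp, Fintype.sum_prod_type]
    exact Finset.sum_congr rfl fun a _ => Finset.sum_congr rfl fun b _ => by rw [hπe]
  have hp : (∑ a, p a) * ∑ b, q b = 1 := by
    have := key (fun _ => 1)
    rw [expect_const h1] at this
    simp only [mul_one] at this
    rw [Finset.sum_mul_sum, ← this]
  have e1 : expect π F = (∑ a, p a * F' a) * ∑ b, q b := by
    rw [key, Finset.sum_mul_sum]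
    exact Finset.sum_congr rfl fun a _ => Finset.sum_congr rfl fun b _ => by rw [hFe]; ring
  have e2 : expect π G = (∑ a, p a) * ∑ b, q b * G' b := by
    rw [key, Finset.sum_mul_sum]
    exact Finset.sum_congr rfl fun a _ => Finset.sum_congr rfl fun b _ => by rw [hGe]; ring
  have e3 : expect π (fun ω => F ω * G ω) = (∑ a, p a * F' a) * ∑ b, q b * G' b := by
    rw [key, Finset.sum_mul_sum]
    exact Finset.sum_congr rfl fun a _ => Finset.sum_congr rfl fun b _ => by
      rw [hFe, hGe]; ring
  rw [e1, e2, e3]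
  -- The right-hand side carries the additional factor of the total mass, which is 1 by `hp`.
  linear_combination (-(∑ a, p a * F' a) * ∑ b, q b * G' b) * hp

/-- Some outcome is at least as large as the expectation. -/
theorem exists_expect_le {π : V → Fin 3 → ℝ} (hπ : ∀ x s, 0 ≤ π x s) (h1 : ∀ x, ∑ s, π x s = 1)
    (F : (V → Fin 3) → ℝ) : ∃ ω, expect π F ≤ F ω := by
  obtain ⟨ω, -, h⟩ := Finset.exists_max_image Finset.univ F Finset.univ_nonempty
  refine ⟨ω, ?_⟩
  calc expect π F ≤ expect π (fun _ => F ω) := expect_mono hπ fun ω' => h ω' (Finset.mem_univ _)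
    _ = F ω := expect_const h1 _

end ProductDistribution

/-! ### Correlated truth values

Variables are grouped in pairs with leaves attached to the two ends; the two ends of a pair are
negatively correlated, and so are a leaf and its end. -/

/-- The role of a variable: independent of the others, an end of a pair, or a leaf attached to
an end of a pair. A pair is named by its first end (the one with the flag `true`). -/
inductive Role (V : Type*) where
  | single : Role V
  | pair : V → Bool → Role V
  | leaf : V → Bool → Role V

/-- The outcome of the coordinate of a pair in which only the given end is true. -/
def onlyEnd (b : Bool) : Fin 3 := if b then 0 else 1

section Truth

variable {V : Type*} [Fintype V] [DecidableEq V]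

/-- The truth value of a variable under an outcome. -/
def truth (role : V → Role V) (ω : V → Fin 3) (x : V) : Bool :=
  match role x with
  | .single => ω x = 0
  | .pair y b => ω y ≠ onlyEnd !b
  | .leaf y b => ω y = onlyEnd (!b) || (ω y = onlyEnd b && ω x = 0)

/-- The distributions of the coordinates, with probability `φ` for all variables except the
single ones, where it is given by `p`. -/
def coordDist (φ : ℝ) (p : V → ℝ) (role : V → Role V) (x : V) : Fin 3 → ℝ :=
  match role x with
  | .single => ![p x, 1 - p x, 0]
  | .pair _ _ => ![1 - φ, 1 - φ, 2 * φ - 1]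
  | .leaf _ _ => ![φ, 1 - φ, 0]

/-- Names of pairs are first ends, and an end of a pair is determined by its pair and flag. -/
structure ValidRoles (role : V → Role V) : Prop where
  root_pair : ∀ {x y b}, role x = .pair y b → role y = .pair y true
  root_leaf : ∀ {x y b}, role x = .leaf y b → role y = .pair y true
  pair_inj : ∀ {x x' y b}, role x = .pair y b → role x' = .pair y b → x = x'

/-- The coordinates on which the truth value of a variable depends. -/
def coords (role : V → Role V) (x : V) : Finset V :=
  match role x with
  | .single => {x}
  | .pair y _ => {y}
  | .leaf y _ => {y, x}

/-- The indicator of the event that `x` has the truth value `b`. -/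
def ind (role : V → Role V) (x : V) (b : Bool) (ω : V → Fin 3) : ℝ :=
  if truth role ω x = b then 1 else 0

theorem ind_nonneg (role : V → Role V) (x : V) (b : Bool) (ω : V → Fin 3) :
    0 ≤ ind role x b ω := by
  unfold ind; split_ifs <;> norm_num

theorem dependsOnCoords_ind (role : V → Role V) (x : V) (b : Bool) :
    DependsOnCoords (ind role x b) (coords role x) := by
  intro ω ω' h
  have : truth role ω x = truth role ω' x := by
    unfold truth
    unfold coords at h
    cases hx : role x with
    | single => simp only [hx] at h ⊢; rw [h x (by simp)]
    | pair y c => simp only [hx] at h ⊢; rw [h y (by simp)]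
    | leaf y c => simp only [hx] at h ⊢; rw [h y (by simp), h x (by simp)]
  simp [ind, this]

theorem DependsOnCoords.mul {F G : (V → Fin 3) → ℝ} {S T : Finset V} (hF : DependsOnCoords F S)
    (hG : DependsOnCoords G T) : DependsOnCoords (fun ω => F ω * G ω) (S ∪ T) := fun ω ω' h => by
  simp only
  rw [hF ω ω' fun x hx => h x (Finset.mem_union_left _ hx),
    hG ω ω' fun x hx => h x (Finset.mem_union_right _ hx)]

variable {φ : ℝ} {p : V → ℝ} {role : V → Role V}

theorem sum_coordDist (x : V) : ∑ s, coordDist φ p role x s = 1 := by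
  unfold coordDist
  cases role x <;> simp [Fin.sum_univ_three]; ring

theorem coordDist_nonneg (h1 : 1 / 2 ≤ φ) (h2 : φ ≤ 1) (hp : ∀ x, 0 ≤ p x ∧ p x ≤ 1) (x : V)
    (s : Fin 3) : 0 ≤ coordDist φ p role x s := by
  unfold coordDist
  have := hp x
  cases role x <;> fin_cases s <;> simp <;> linarith

theorem expect_ind_not (x : V) (b : Bool) :
    expect (coordDist φ p role) (ind role x (!b)) = 1 - expect (coordDist φ p role) (ind role x b) := by
  rw [← expect_const (sum_coordDist (φ := φ) (p := p) (role := role)) 1, ← expect_sub]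
  congr 1
  ext ω
  unfold ind
  cases truth role ω x <;> cases b <;> simp

theorem expect_ind_single {x : V} (h : role x = .single) :
    expect (coordDist φ p role) (ind role x true) = p x := by
  have e : ind role x true = fun ω => if ω x = 0 then (1 : ℝ) else 0 := by
    ext ω; simp [ind, truth, h]
  rw [e, expect_coord sum_coordDist x (fun s => if s = 0 then 1 else 0)]
  simp [coordDist, h]

/-- The end is true in the outcomes "only this end" and "both ends", of total mass (1 - φ) + (2φ -
1). There is no outcome in which both ends are false. -/
theorem expect_ind_pair (hr : ValidRoles role) {x y : V} {b : Bool} (h : role x = .pair y b) :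
    expect (coordDist φ p role) (ind role x true) = φ := by
  have e : ind role x true = fun ω => if ω y ≠ onlyEnd !b then (1 : ℝ) else 0 := by
    ext ω; simp [ind, truth, h]
  rw [e, expect_coord sum_coordDist y (fun s => if s ≠ onlyEnd !b then 1 else 0)]
  cases b <;> simp [Fin.sum_univ_three, coordDist, hr.root_pair h, onlyEnd] <;> ring

theorem expect_two_coords {x y : V} (hxy : y ≠ x) (f g : Fin 3 → ℝ) :
    expect (coordDist φ p role) (fun ω => f (ω y) * g (ω x)) =
      (∑ s, coordDist φ p role y s * f s) * ∑ s, coordDist φ p role x s * g s := by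
  rw [← expect_coord sum_coordDist, ← expect_coord sum_coordDist]
  exact expect_mul (S := {y}) (T := {x}) sum_coordDist (fun ω ω' h => by simp [h y (by simp)])
    (fun ω ω' h => by simp [h x (by simp)]) (by simpa using hxy)

theorem ne_root_of_leaf (hr : ValidRoles role) {x y : V} {b : Bool} (h : role x = .leaf y b) :
    y ≠ x := by
  rintro rfl
  have := hr.root_leaf h
  rw [h] at this
  cases this

/-- A leaf is true if its end is false, true with conditional probability φ if its end alone is
true, and false if both ends are true. This gives (1 - φ)(1 + φ) = 1 - φ² = φ. -/
theorem expect_ind_leaf (hφ : φ ^ 2 + φ = 1) (hr : ValidRoles role) {x y : V} {b : Bool}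
    (h : role x = .leaf y b) : expect (coordDist φ p role) (ind role x true) = φ := by
  have e : ind role x true = fun ω => (if ω y = onlyEnd (!b) then (1 : ℝ) else 0) +
      (if ω y = onlyEnd b then (1 : ℝ) else 0) * (if ω x = 0 then 1 else 0) := by
    ext ω
    cases b <;> simp only [ind, truth, h, onlyEnd] <;>
      by_cases h0 : ω y = 0 <;> by_cases h1 : ω y = 1 <;> by_cases h2 : ω x = 0 <;> simp_all
  rw [e, expect_add, expect_two_coords (ne_root_of_leaf hr h) (fun s => if s = onlyEnd b then 1 else 0)
    (fun s => if s = 0 then 1 else 0),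
    expect_coord sum_coordDist y (fun s => if s = onlyEnd (!b) then 1 else 0)]
  cases b <;> simp [coordDist, hr.root_leaf h, h, onlyEnd] <;> nlinarith

theorem expect_ind (hφ : φ ^ 2 + φ = 1) (hr : ValidRoles role) {x : V}
    (h : role x = .single → p x = φ) : expect (coordDist φ p role) (ind role x true) = φ := by
  cases hx : role x with
  | single => rw [expect_ind_single hx, h hx]
  | pair y b => exact expect_ind_pair hr hx
  | leaf y b => exact expect_ind_leaf hφ hr hx

/-- Both ends of a pair are true. -/
theorem expect_pair_mul (hr : ValidRoles role) {x x' y : V} {b : Bool} (h : role x = .pair y b)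
    (h' : role x' = .pair y (!b)) :
    expect (coordDist φ p role) (fun ω => ind role x true ω * ind role x' true ω) = 2 * φ - 1 := by
  have e : (fun ω => ind role x true ω * ind role x' true ω) =
      fun ω => if ω y = 2 then (1 : ℝ) else 0 := by
    ext ω
    cases b <;> simp only [ind, truth, h, h', onlyEnd] <;>
      rcases (show ω y = 0 ∨ ω y = 1 ∨ ω y = 2 by omega) with h | h | h <;> simp [h]
  rw [e, expect_coord sum_coordDist y (fun s => if s = 2 then 1 else 0)]
  simp [coordDist, hr.root_pair h]

/-- A leaf and its end are true. -/
theorem expect_pair_mul_leaf (hφ : φ ^ 2 + φ = 1) (hr : ValidRoles role) {x w y : V} {b : Bool}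
    (h : role x = .pair y b) (h' : role w = .leaf y b) :
    expect (coordDist φ p role) (fun ω => ind role x true ω * ind role w true ω) = 2 * φ - 1 := by
  have e : (fun ω => ind role x true ω * ind role w true ω) =
      fun ω => (if ω y = onlyEnd b then (1 : ℝ) else 0) * (if ω w = 0 then 1 else 0) := by
    ext ω
    cases b <;> simp only [ind, truth, h, h', onlyEnd] <;>
      by_cases h0 : ω y = 0 <;> by_cases h1 : ω y = 1 <;> by_cases h2 : ω w = 0 <;> simp_all
  rw [e, expect_two_coords (ne_root_of_leaf hr h') (fun s => if s = onlyEnd b then 1 else 0)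
    (fun s => if s = 0 then 1 else 0)]
  cases b <;> simp [coordDist, hr.root_leaf h', h', onlyEnd] <;> nlinarith

/-- A leaf and the other end are true. -/
theorem expect_pair_mul_leaf_not (hr : ValidRoles role) {x w y : V} {b : Bool}
    (h : role x = .pair y (!b)) (h' : role w = .leaf y b) :
    expect (coordDist φ p role) (fun ω => ind role x true ω * ind role w true ω) = 1 - φ := by
  have e : (fun ω => ind role x true ω * ind role w true ω) =
      fun ω => if ω y = onlyEnd (!b) then (1 : ℝ) else 0 := by
    ext ω
    cases b <;> simp only [ind, truth, h, h', onlyEnd] <;>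
      by_cases h0 : ω y = 0 <;> by_cases h1 : ω y = 1 <;> by_cases h2 : ω w = 0 <;> simp_all
  rw [e, expect_coord sum_coordDist y (fun s => if s = onlyEnd (!b) then 1 else 0)]
  cases b <;> simp [coordDist, hr.root_leaf h', onlyEnd]

theorem expect_ind_mul_ind {x x' : V} (h : Disjoint (coords role x) (coords role x'))
    (b b' : Bool) :
    expect (coordDist φ p role) (fun ω => ind role x b ω * ind role x' b' ω) =
      expect (coordDist φ p role) (ind role x b) * expect (coordDist φ p role) (ind role x' b') :=
  expect_mul sum_coordDist (dependsOnCoords_ind role x b) (dependsOnCoords_ind role x' b') h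

/-- Apart from its own coordinate a variable reads only that of the first end of a pair, which is
never single. -/
theorem disjoint_coords_single (hr : ValidRoles role) {x x' : V} (h : role x = .single)
    (hx : x' ≠ x) : Disjoint (coords role x) (coords role x') := by
  simp only [coords, h, Finset.disjoint_singleton_left]
  cases h' : role x' with
  | single => simpa using hx.symm
  | pair y b =>
    simp only [Finset.mem_singleton]
    rintro rfl
    rw [hr.root_pair h'] at h; cases h
  | leaf y b =>
    simp only [Finset.mem_insert, Finset.mem_singleton, not_or]
    refine ⟨?_, hx.symm⟩
    rintro rfl
    rw [hr.root_leaf h'] at h; cases h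

/-- An end of a pair and any other non-single variable are rarely true together. -/
theorem expect_pair_mul_le (hφ : φ ^ 2 + φ = 1) (h3 : φ ≤ 2 / 3)
    (hr : ValidRoles role) {x v y : V} {b : Bool} (h : role x = .pair y b) (hv : v ≠ x)
    (hvs : role v ≠ .single) :
    expect (coordDist φ p role) (fun ω => ind role x true ω * ind role v true ω) ≤ 1 - φ := by
  have indep : Disjoint (coords role x) (coords role v) →
      expect (coordDist φ p role) (fun ω => ind role x true ω * ind role v true ω) ≤ 1 - φ := by
    intro hd
    rw [expect_ind_mul_ind hd, expect_ind hφ hr (by simp [h]), expect_ind hφ hr (by simp [hvs])]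
    -- The product of the marginals is φ² = 1 - φ.
    nlinarith
  cases hv' : role v with
  | single => exact absurd hv' hvs
  | pair y' b' =>
    by_cases hy : y' = y
    · subst hy
      have : b' = !b := by
        by_contra hb
        have : b' = b := by cases b <;> cases b' <;> simp_all
        subst this
        exact hv (hr.pair_inj hv' h)
      subst this
      rw [expect_pair_mul hr h hv']; linarith
    · apply indep
      simpa [coords, h, hv'] using Ne.symm hy
  | leaf y' b' =>
    by_cases hy : y' = y
    · subst hy
      by_cases hb : b = b'
      · subst hb
        rw [expect_pair_mul_leaf hφ hr h hv']; linarith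
      · have : b = !b' := by cases b <;> cases b' <;> simp_all
        subst this
        exact (expect_pair_mul_leaf_not hr h hv').le
    · apply indep
      simp only [coords, h, hv', Finset.disjoint_singleton_left, Finset.mem_insert,
        Finset.mem_singleton, not_or]
      refine ⟨Ne.symm hy, ?_⟩
      rintro rfl
      have := hr.root_pair h
      rw [hv'] at this; cases this

end Truth

/-! ### Greedy pairing of variables and the choice of roles -/

section Pairing

variable {V ι : Type*} [Fintype V] [DecidableEq V] [Fintype ι] [DecidableEq ι]

/-- A greedy choice of disjoint pairs in distinct sets of a family. -/
theorem exists_pairing (N : ι → Finset V) (K : Finset ι) : ∃ T : Finset (ι × V × V),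
    (∀ t ∈ T, t.1 ∈ K ∧ t.2.1 ≠ t.2.2 ∧ t.2.1 ∈ N t.1 ∧ t.2.2 ∈ N t.1) ∧
    (∀ t ∈ T, ∀ t' ∈ T, t.1 = t'.1 ∨ t.2.1 = t'.2.1 ∨ t.2.1 = t'.2.2 ∨ t.2.2 = t'.2.1 ∨
      t.2.2 = t'.2.2 → t = t') ∧
    ∀ i ∈ K, (∀ t ∈ T, t.1 ≠ i) → ∀ u ∈ N i, ∀ v ∈ N i, (∀ t ∈ T, u ≠ t.2.1 ∧ u ≠ t.2.2) →
      (∀ t ∈ T, v ≠ t.2.1 ∧ v ≠ t.2.2) → u = v := by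
  induction K using Finset.induction with
  | empty => exact ⟨∅, by simp⟩
  | insert i K hi ih =>
    obtain ⟨T, h1, h2, h3⟩ := ih
    by_cases hex : ∃ u ∈ N i, ∃ v ∈ N i, (∀ t ∈ T, u ≠ t.2.1 ∧ u ≠ t.2.2) ∧
      (∀ t ∈ T, v ≠ t.2.1 ∧ v ≠ t.2.2) ∧ u ≠ v
    -- Two uncovered elements of the new set become its pair. Covering more elements only weakens
    -- what maximality demands of the earlier sets.
    · obtain ⟨u, hu, v, hv, hut, hvt, huv⟩ := hex
      refine ⟨insert (i, u, v) T, ?_, ?_, ?_⟩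
      · intro t ht
        rcases Finset.mem_insert.mp ht with rfl | ht
        · exact ⟨Finset.mem_insert_self _ _, huv, hu, hv⟩
        · exact ⟨Finset.mem_insert_of_mem (h1 t ht).1, (h1 t ht).2⟩
      · have key : ∀ t ∈ T, ¬(t.1 = i ∨ t.2.1 = u ∨ t.2.1 = v ∨ t.2.2 = u ∨ t.2.2 = v) := by
          intro t ht h
          have := hut t ht
          have := hvt t ht
          have : t.1 ≠ i := fun h => hi (h ▸ (h1 t ht).1)
          grind
        intro t ht t' ht'
        rcases Finset.mem_insert.mp ht with rfl | ht <;>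
          rcases Finset.mem_insert.mp ht' with rfl | ht'
        · simp
        · have := key t' ht'; grind
        · have := key t ht; grind
        · exact h2 t ht t' ht'
      · intro j hj hjT u' hu' v' hv' hu'' hv''
        rcases Finset.mem_insert.mp hj with rfl | hj
        · exact absurd rfl (hjT _ (Finset.mem_insert_self _ _))
        · exact h3 j hj (fun t ht => hjT t (Finset.mem_insert_of_mem ht)) u' hu' v' hv'
            (fun t ht => hu'' t (Finset.mem_insert_of_mem ht))
            (fun t ht => hv'' t (Finset.mem_insert_of_mem ht))
    · refine ⟨T, fun t ht => ⟨Finset.mem_insert_of_mem (h1 t ht).1, (h1 t ht).2⟩, h2, ?_⟩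
      intro j hj hjT u hu v hv hut hvt
      rcases Finset.mem_insert.mp hj with rfl | hj
      · by_contra huv
        exact hex ⟨u, hu, v, hv, hut, hvt, huv⟩
      · exact h3 j hj hjT u hu v hv hut hvt

/-- The variable has a positive unit clause. -/
def HasUnit (c : ι → Finset (V × Bool)) (x : V) : Prop := ∃ i, c i = {(x, true)}

/-- A clause all of whose variables have positive unit clauses. -/
def UnitOnly (c : ι → Finset (V × Bool)) (i : ι) : Prop := ∀ l ∈ c i, HasUnit c l.1

open Classical in
/-- Roles of the variables, with clauses that witness the correlations. -/
structure RoleSystem (c : ι → Finset (V × Bool)) where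
  role : V → Role V
  valid : ValidRoles role
  used : Finset ι
  leaves : Finset ι
  single_of_not_hasUnit : ∀ x, ¬HasUnit c x → role x = .single
  used_spec : ∀ i ∈ used, ∃ y x, role y = .pair y true ∧ role x = .pair y false ∧
    (y, false) ∈ c i ∧ (x, false) ∈ c i
  leaves_spec : ∀ i ∈ leaves, ∃ y b x w, role x = .pair y b ∧ role w = .leaf y b ∧
    c i = {(w, false), (x, false)}
  used_neg : ∀ i ∈ used, UnitOnly c i ∧ ∀ l ∈ c i, l.2 = false
  leaves_unitOnly : ∀ i ∈ leaves, UnitOnly c i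
  disj : Disjoint used leaves
  card_le : (Finset.univ.filter fun x => role x ≠ Role.single).card ≤ 2 * used.card + leaves.card
  eq_of_unused : ∀ i, UnitOnly c i → (∀ l ∈ c i, l.2 = false) → i ∉ used → ∀ u v,
    (u, false) ∈ c i → (v, false) ∈ c i → (∀ y b, role u ≠ .pair y b) →
    (∀ y b, role v ≠ .pair y b) → u = v
  single_isolated : ∀ i u v, c i = {(u, false), (v, false)} → HasUnit c u → role u = .single →
    ∀ y b, role v ≠ .pair y b

-- The ends come from a greedy pairing inside negative clauses over variables with unit clauses; its
-- maximality is `eq_of_unused`. Every remaining variable with a unit clause that shares a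
-- two-literal negative clause with an end becomes a leaf of such an end, which yields
-- `single_isolated`. In `card_le` a used clause accounts for two ends and a leaf clause for one
-- leaf.
open Classical in
theorem exists_roleSystem (c : ι → Finset (V × Bool)) : Nonempty (RoleSystem c) := by
  obtain ⟨T, h1, h2, h3⟩ := exists_pairing (fun i => (c i).image Prod.fst)
    (Finset.univ.filter fun i => UnitOnly c i ∧ ∀ l ∈ c i, l.2 = false)
  simp only [Finset.mem_filter, Finset.mem_univ, true_and] at h1 h3
  let tend : ι × V × V → Bool → V := fun t b => if b then t.2.1 else t.2.2
  -- The triple `q` consists of the witnessing clause, the pair and the flag of the end.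
  let IsLeaf : V → Prop := fun x => HasUnit c x ∧
    ∃ q : ι × (ι × V × V) × Bool, q.2.1 ∈ T ∧ c q.1 = {(x, false), (tend q.2.1 q.2.2, false)}
  have hneg : ∀ t ∈ T, ∀ b, (tend t b, false) ∈ c t.1 := by
    intro t ht b
    obtain ⟨⟨-, hn⟩, -, ha, hb⟩ := h1 t ht
    have : ∀ x, x ∈ (c t.1).image Prod.fst → (x, false) ∈ c t.1 := by
      intro x hx
      obtain ⟨l, hl, rfl⟩ := Finset.mem_image.mp hx
      have := hn l hl
      rwa [← this]
    cases b
    · exact this _ hb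
    · exact this _ ha
  -- Ends take precedence over leaves, so that an end is never a leaf of another pair.
  let role : V → Role V := fun x =>
    if ∃ t ∈ T, t.2.1 = x then .pair x true
    else if h : ∃ t ∈ T, t.2.2 = x then .pair h.choose.2.1 false
    else if h : IsLeaf x then .leaf h.2.choose.2.1.2.1 h.2.choose.2.2
    else .single
  have r1 : ∀ t ∈ T, role t.2.1 = .pair t.2.1 true := fun t ht => by
    have : ∃ t' ∈ T, t'.2.1 = t.2.1 := ⟨t, ht, rfl⟩
    simp only [role, if_pos this]
  have r2 : ∀ t ∈ T, role t.2.2 = .pair t.2.1 false := fun t ht => by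
    have hn : ¬∃ t' ∈ T, t'.2.1 = t.2.2 := by
      rintro ⟨t', ht', h⟩
      have e := h2 t' ht' t ht (by tauto)
      subst e
      exact (h1 t' ht).2.1 h
    have h : ∃ t' ∈ T, t'.2.2 = t.2.2 := ⟨t, ht, rfl⟩
    have e := h2 _ h.choose_spec.1 t ht (by have := h.choose_spec.2; tauto)
    simp only [role, if_neg hn, dif_pos h, e]
  have rt : ∀ t ∈ T, ∀ b, role (tend t b) = .pair t.2.1 b := fun t ht b => by
    cases b
    · exact r2 t ht
    · exact r1 t ht
  have rpair : ∀ x y b, role x = .pair y b → ∃ t ∈ T, y = t.2.1 ∧ x = tend t b := by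
    intro x y b h
    by_cases c1 : ∃ t ∈ T, t.2.1 = x
    · simp only [role, if_pos c1, Role.pair.injEq] at h
      obtain ⟨t, ht, rfl⟩ := c1
      obtain ⟨rfl, rfl⟩ := h
      exact ⟨t, ht, rfl, rfl⟩
    · by_cases c2 : ∃ t ∈ T, t.2.2 = x
      · have hc := c2.choose_spec
        simp only [role, if_neg c1, dif_pos c2, Role.pair.injEq] at h
        obtain ⟨rfl, rfl⟩ := h
        exact ⟨_, hc.1, rfl, hc.2.symm⟩
      · by_cases c3 : IsLeaf x
        · simp only [role, if_neg c1, dif_neg c2, dif_pos c3, reduceCtorEq] at h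
        · simp only [role, if_neg c1, dif_neg c2, dif_neg c3, reduceCtorEq] at h
  have rleaf : ∀ x y b, role x = .leaf y b → HasUnit c x ∧ ∃ i, ∃ t ∈ T, y = t.2.1 ∧
      c i = {(x, false), (tend t b, false)} := by
    intro x y b h
    by_cases c1 : ∃ t ∈ T, t.2.1 = x
    · simp only [role, if_pos c1, reduceCtorEq] at h
    · by_cases c2 : ∃ t ∈ T, t.2.2 = x
      · simp only [role, if_neg c1, dif_pos c2, reduceCtorEq] at h
      · by_cases c3 : IsLeaf x
        · have hc := c3.2.choose_spec
          simp only [role, if_neg c1, dif_neg c2, dif_pos c3, Role.leaf.injEq] at h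
          obtain ⟨rfl, rfl⟩ := h
          exact ⟨c3.1, _, _, hc.1, rfl, hc.2⟩
        · simp only [role, if_neg c1, dif_neg c2, dif_neg c3, reduceCtorEq] at h
  have rsingle : ∀ x, role x = .single → ¬IsLeaf x := by
    intro x h hl
    by_cases c1 : ∃ t ∈ T, t.2.1 = x
    · simp only [role, if_pos c1, reduceCtorEq] at h
    · by_cases c2 : ∃ t ∈ T, t.2.2 = x
      · simp only [role, if_neg c1, dif_pos c2, reduceCtorEq] at h
      · simp only [role, if_neg c1, dif_neg c2, dif_pos hl, reduceCtorEq] at h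
  have punit : ∀ t ∈ T, ∀ b, HasUnit c (tend t b) := fun t ht b => (h1 t ht).1.1 _ (hneg t ht b)
  have hvalid : ValidRoles role := by
    constructor
    · intro x y b h
      obtain ⟨t, ht, rfl, -⟩ := rpair x y b h
      exact r1 t ht
    · intro x y b h
      obtain ⟨-, i, t, ht, rfl, -⟩ := rleaf x y b h
      exact r1 t ht
    · intro x x' y b h h'
      obtain ⟨t, ht, e1, rfl⟩ := rpair x y b h
      obtain ⟨t', ht', e2, rfl⟩ := rpair x' y b h'
      rw [h2 t ht t' ht' (by rw [← e1, ← e2]; tauto)]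
  let W : Finset V := Finset.univ.filter fun x => ∃ y b, role x = .leaf y b
  have hW : ∀ x ∈ W, ∃ i, ∃ y b, role x = .leaf y b ∧ HasUnit c x ∧ ∃ t ∈ T, y = t.2.1 ∧
      c i = {(x, false), (tend t b, false)} := by
    intro x hx
    obtain ⟨y, b, h⟩ := (Finset.mem_filter.mp hx).2
    obtain ⟨hu, i, t, ht, e, hc⟩ := rleaf x y b h
    exact ⟨i, y, b, h, hu, t, ht, e, hc⟩
  choose g hg using hW
  -- The second variable of a witnessing clause is an end and hence not a leaf, so the clause
  -- determines its leaf.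
  have hginj : ∀ x x' : W, g x.1 x.2 = g x'.1 x'.2 → x = x' := by
    rintro ⟨x, hx⟩ ⟨x', hx'⟩ e
    rw [Subtype.mk.injEq]
    obtain ⟨y, b, hr, -, t, ht, -, hc⟩ := hg x hx
    obtain ⟨y', b', hr', -, t', ht', -, hc'⟩ := hg x' hx'
    simp only at e
    rw [e, hc'] at hc
    have : (x, false) ∈ ({(x', false), (tend t' b', false)} : Finset (V × Bool)) := by
      rw [hc]; simp
    simp only [Finset.mem_insert, Finset.mem_singleton, Prod.mk.injEq, and_true] at this
    rcases this with h | h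
    · exact h
    · rw [h, rt t' ht'] at hr; cases hr
  refine ⟨⟨role, hvalid, T.image Prod.fst, W.attach.image (fun x => g x.1 x.2), ?_, ?_, ?_, ?_, ?_, ?_, ?_, ?_, ?_⟩⟩
  · intro x hx
    cases h : role x with
    | single => rfl
    | pair y b =>
      obtain ⟨t, ht, -, rfl⟩ := rpair x y b h
      exact absurd (punit t ht b) hx
    | leaf y b => exact absurd (rleaf x y b h).1 hx
  · intro i hi
    obtain ⟨t, ht, rfl⟩ := Finset.mem_image.mp hi
    exact ⟨t.2.1, t.2.2, r1 t ht, r2 t ht, hneg t ht true, hneg t ht false⟩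
  · intro i hi
    obtain ⟨⟨x, hx⟩, -, rfl⟩ := Finset.mem_image.mp hi
    obtain ⟨y, b, hr, -, t, ht, rfl, hc⟩ := hg x hx
    exact ⟨t.2.1, b, tend t b, x, rt t ht b, hr, hc⟩
  · intro i hi
    obtain ⟨t, ht, rfl⟩ := Finset.mem_image.mp hi
    exact (h1 t ht).1
  · intro i hi
    obtain ⟨⟨x, hx⟩, -, rfl⟩ := Finset.mem_image.mp hi
    obtain ⟨y, b, hr, hu, t, ht, rfl, hc⟩ := hg x hx
    intro l hl
    rw [hc] at hl
    simp only [Finset.mem_insert, Finset.mem_singleton] at hl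
    rcases hl with rfl | rfl
    · exact hu
    · exact punit t ht b
  -- A used clause contains two distinct ends, a leaf clause only one.
  · rw [Finset.disjoint_left]
    intro i hi hi'
    obtain ⟨t, ht, rfl⟩ := Finset.mem_image.mp hi
    obtain ⟨⟨x, hx⟩, -, e⟩ := Finset.mem_image.mp hi'
    obtain ⟨y, b, hr, hu, t', ht', rfl, hc⟩ := hg x hx
    simp only at e
    rw [e] at hc
    have ha := hneg t ht true
    have hb := hneg t ht false
    have hne : tend t true ≠ tend t false := (h1 t ht).2.1
    rw [hc] at ha hb
    simp only [Finset.mem_insert, Finset.mem_singleton, Prod.mk.injEq, and_true] at ha hb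
    have nx : ∀ b, tend t b ≠ x := fun b h => by
      rw [← h, rt t ht] at hr; cases hr
    rcases ha with h | h
    · exact nx _ h
    · rcases hb with h' | h'
      · exact nx _ h'
      · exact hne (h.trans h'.symm)
  · have e1 : (T.image Prod.fst).card = T.card :=
      Finset.card_image_of_injOn fun t ht t' ht' e => h2 t ht t' ht' (Or.inl e)
    have e2 : (W.attach.image fun x => g x.1 x.2).card = W.card := by
      rw [Finset.card_image_of_injective _ fun x x' e => hginj x x' e, Finset.card_attach]
    rw [e1, e2]
    have hsub : (Finset.univ.filter fun x => role x ≠ .single) ⊆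
        (T.image fun t => tend t true) ∪ (T.image fun t => tend t false) ∪ W := by
      intro x hx
      have hx := (Finset.mem_filter.mp hx).2
      simp only [Finset.mem_union, Finset.mem_image]
      cases h : role x with
      | single => exact absurd h hx
      | pair y b =>
        obtain ⟨t, ht, -, rfl⟩ := rpair x y b h
        cases b
        · exact Or.inl (Or.inr ⟨t, ht, rfl⟩)
        · exact Or.inl (Or.inl ⟨t, ht, rfl⟩)
      | leaf y b => exact Or.inr (Finset.mem_filter.mpr ⟨Finset.mem_univ _, y, b, h⟩)
    have := Finset.card_le_card hsub
    have u1 := Finset.card_union_le ((T.image fun t => tend t true) ∪ (T.image fun t => tend t false)) W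
    have u2 := Finset.card_union_le (T.image fun t => tend t true) (T.image fun t => tend t false)
    have u3 := Finset.card_image_le (s := T) (f := fun t => tend t true)
    have u4 := Finset.card_image_le (s := T) (f := fun t => tend t false)
    omega
  · intro i hi hn hu u v hui hvi hru hrv
    refine h3 i ⟨hi, hn⟩ ?_ u (Finset.mem_image_of_mem Prod.fst hui) v
      (Finset.mem_image_of_mem Prod.fst hvi) ?_ ?_
    · intro t ht e
      exact hu (Finset.mem_image.mpr ⟨t, ht, e⟩)
    · intro t ht
      refine ⟨?_, ?_⟩ <;> rintro rfl
      · exact hru _ _ (r1 t ht)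
      · exact hru _ _ (r2 t ht)
    · intro t ht
      refine ⟨?_, ?_⟩ <;> rintro rfl
      · exact hrv _ _ (r1 t ht)
      · exact hrv _ _ (r2 t ht)
  · intro i u v hc hu hs y b h
    obtain ⟨t, ht, -, rfl⟩ := rpair v y b h
    exact rsingle u hs ⟨hu, (i, t, b), ht, hc⟩

end Pairing

/-! ### Failure probabilities of clauses and the lower bound -/

section UnsatProbability

variable {V ι : Type*} [Fintype V] [DecidableEq V] [Fintype ι] [DecidableEq ι]

/-- The indicator of the event that a clause is not satisfied. -/
def unsatInd (role : V → Role V) (s : Finset (V × Bool)) (ω : V → Fin 3) : ℝ :=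
  if ∃ l ∈ s, truth role ω l.1 = l.2 then 0 else 1

/-- The probability that a clause is not satisfied. -/
def unsatProb (φ : ℝ) (p : V → ℝ) (role : V → Role V) (s : Finset (V × Bool)) : ℝ :=
  expect (coordDist φ p role) (unsatInd role s)

theorem ind_eq_one {role : V → Role V} {s : Finset (V × Bool)} {ω : V → Fin 3}
    (h : ¬∃ l ∈ s, truth role ω l.1 = l.2) {l : V × Bool} (hl : l ∈ s) :
    ind role l.1 (!l.2) ω = 1 := by
  have : truth role ω l.1 = !l.2 := by
    by_contra hc
    exact h ⟨l, hl, by simpa using hc⟩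
  simp [ind, this]

theorem unsatInd_le_one {role : V → Role V} {s : Finset (V × Bool)} (ω : V → Fin 3) :
    unsatInd role s ω ≤ 1 := by
  unfold unsatInd; split_ifs <;> norm_num

theorem unsatInd_le {role : V → Role V} {s : Finset (V × Bool)} {l : V × Bool}
    (hl : l ∈ s) (ω : V → Fin 3) : unsatInd role s ω ≤ ind role l.1 (!l.2) ω := by
  unfold unsatInd
  split_ifs with h
  · exact ind_nonneg _ _ _ _
  · rw [ind_eq_one h hl]

theorem unsatInd_le_mul {role : V → Role V} {s : Finset (V × Bool)} {l l' : V × Bool}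
    (hl : l ∈ s) (hl' : l' ∈ s) (ω : V → Fin 3) :
    unsatInd role s ω ≤ ind role l.1 (!l.2) ω * ind role l'.1 (!l'.2) ω := by
  unfold unsatInd
  split_ifs with h
  · exact mul_nonneg (ind_nonneg _ _ _ _) (ind_nonneg _ _ _ _)
  · rw [ind_eq_one h hl, ind_eq_one h hl', one_mul]

/-- The golden-ratio conjugate and admissible probabilities for the single variables. -/
structure Params (φ : ℝ) (p : V → ℝ) : Prop where
  sq : φ ^ 2 + φ = 1
  half_le : 1 / 2 ≤ φ
  le_two_thirds : φ ≤ 2 / 3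
  prob : ∀ x, 0 ≤ p x ∧ p x ≤ 1

variable {φ : ℝ} {p : V → ℝ} {c : ι → Finset (V × Bool)}

theorem Params.dist_nonneg (hp : Params φ p) (role : V → Role V) (x : V) (s : Fin 3) :
    0 ≤ coordDist φ p role x s :=
  coordDist_nonneg hp.half_le (by linarith [hp.le_two_thirds]) hp.prob x s

theorem unsatProb_le_one (hp : Params φ p) (role : V → Role V) (s : Finset (V × Bool)) :
    unsatProb φ p role s ≤ 1 :=
  (expect_mono (hp.dist_nonneg role) unsatInd_le_one).trans (expect_const sum_coordDist 1).le

theorem unsatProb_le (hp : Params φ p) {role : V → Role V} {s : Finset (V × Bool)} {x : V}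
    {b : Bool} (hl : (x, b) ∈ s) :
    unsatProb φ p role s ≤ expect (coordDist φ p role) (ind role x !b) :=
  expect_mono (hp.dist_nonneg role) (unsatInd_le hl)

theorem unsatProb_le_mul (hp : Params φ p) {role : V → Role V} {s : Finset (V × Bool)} {x x' : V}
    {b b' : Bool} (hl : (x, b) ∈ s) (hl' : (x', b') ∈ s) :
    unsatProb φ p role s ≤
      expect (coordDist φ p role) (fun ω => ind role x (!b) ω * ind role x' (!b') ω) :=
  expect_mono (hp.dist_nonneg role) (unsatInd_le_mul hl hl')

/-- A clause with an independent literal and a further literal. -/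
theorem unsatProb_le_of_single (hp : Params φ p) {role : V → Role V} (hr : ValidRoles role)
    {s : Finset (V × Bool)} {x x' : V} {b b' : Bool} (hx : role x = .single)
    (hl : (x, b) ∈ s) (hl' : (x', b') ∈ s) (hne : (x', b') ≠ (x, b)) {r t : ℝ}
    (h1 : expect (coordDist φ p role) (ind role x !b) ≤ r)
    (h2 : expect (coordDist φ p role) (ind role x' !b') ≤ t) (ht : 0 ≤ t) :
    unsatProb φ p role s ≤ r * t := by
  have nn : ∀ y d, 0 ≤ expect (coordDist φ p role) (ind role y d) := fun y d =>
    (expect_const (sum_coordDist (φ := φ) (p := p) (role := role)) 0).symm.le.trans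
      (expect_mono (hp.dist_nonneg role) fun ω => ind_nonneg _ _ _ _)
  refine (unsatProb_le_mul hp hl hl').trans ?_
  -- Two different literals of one variable make the clause a tautology, which never fails.
  by_cases hxx : x' = x
  · subst hxx
    have : ∀ ω, ind role x' (!b) ω * ind role x' (!b') ω ≤ 0 := by
      intro ω
      have : b' ≠ b := by simpa using hne
      unfold ind
      cases truth role ω x' <;> cases b <;> cases b' <;> simp_all
    refine (expect_mono (hp.dist_nonneg role) this).trans ?_
    rw [expect_const sum_coordDist]
    exact mul_nonneg ((nn x' !b).trans h1) ht
  · rw [expect_ind_mul_ind (disjoint_coords_single hr hx hxx)]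
    exact mul_le_mul h1 h2 (nn _ _) ((nn _ _).trans h1)

/-- All variables of the clause are true with probability `φ`. -/
def Balanced (φ : ℝ) (p : V → ℝ) (role : V → Role V) (s : Finset (V × Bool)) : Prop :=
  ∀ l ∈ s, role l.1 = .single → p l.1 = φ

theorem Balanced.expect_true (hp : Params φ p) {role : V → Role V} (hr : ValidRoles role)
    {s : Finset (V × Bool)} (hb : Balanced φ p role s) {x : V} {b : Bool} (hl : (x, b) ∈ s) :
    expect (coordDist φ p role) (ind role x true) = φ := expect_ind hp.sq hr (hb _ hl)

theorem Balanced.expect_false (hp : Params φ p) {role : V → Role V} (hr : ValidRoles role)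
    {s : Finset (V × Bool)} (hb : Balanced φ p role s) {x : V} {b : Bool} (hl : (x, b) ∈ s) :
    expect (coordDist φ p role) (ind role x false) = 1 - φ := by
  have := expect_ind_not (φ := φ) (p := p) (role := role) x true
  rwa [hb.expect_true hp hr hl] at this

theorem Balanced.expect_le (hp : Params φ p) {role : V → Role V} (hr : ValidRoles role)
    {s : Finset (V × Bool)} (hb : Balanced φ p role s) {x : V} {b : Bool} (hl : (x, b) ∈ s) :
    expect (coordDist φ p role) (ind role x !b) ≤ φ := by
  cases b
  · exact (hb.expect_true hp hr hl).le
  · rw [show (!true) = false from rfl, hb.expect_false hp hr hl]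
    linarith [hp.half_le]

theorem exists_ne_of_ne_singleton {s : Finset (V × Bool)} {l : V × Bool} (hl : l ∈ s)
    (hs : ∀ m, s ≠ {m}) : ∃ l' ∈ s, l' ≠ l := by
  by_contra h
  push Not at h
  exact hs l (Finset.eq_singleton_iff_unique_mem.mpr ⟨hl, h⟩)

/-- A single second variable is independent of the end, and φ² = 1 - φ meets the bound exactly; the
other roles are covered by `expect_pair_mul_le`. -/
theorem expect_pair_mul_any_le (hp : Params φ p) {role : V → Role V} (hr : ValidRoles role)
    {x v y : V} {b : Bool} (hx : role x = .pair y b) (hv : v ≠ x)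
    (hvp : role v = .single → p v = φ) :
    expect (coordDist φ p role) (fun ω => ind role x true ω * ind role v true ω) ≤ 1 - φ := by
  by_cases hs : role v = .single
  · have hd := (disjoint_coords_single hr hs hv.symm).symm
    rw [expect_ind_mul_ind hd, expect_ind hp.sq hr (by simp [hx]), expect_ind hp.sq hr hvp]
    linarith [hp.sq]
  · exact expect_pair_mul_le hp.sq hp.le_two_thirds hr hx hv hs

variable (R : RoleSystem c)

/-- This improves on the baseline 1 - φ by 2 - 3φ, the amount that pays for the two ends. It holds
for all probabilities of the single variables. -/
theorem RoleSystem.unsatProb_used (hp : Params φ p) {i : ι} (hi : i ∈ R.used) :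
    unsatProb φ p R.role (c i) ≤ 2 * φ - 1 := by
  obtain ⟨y, x, hy, hx, hyi, hxi⟩ := R.used_spec i hi
  exact (unsatProb_le_mul hp hyi hxi).trans (expect_pair_mul R.valid hy hx).le

theorem RoleSystem.unsatProb_leaves (hp : Params φ p) {i : ι} (hi : i ∈ R.leaves) :
    unsatProb φ p R.role (c i) ≤ 2 * φ - 1 := by
  obtain ⟨y, b, x, w, hx, hw, hc⟩ := R.leaves_spec i hi
  exact (unsatProb_le_mul hp (b := false) (b' := false) (x := x) (x' := w) (by simp [hc])
    (by simp [hc])).trans (expect_pair_mul_leaf hp.sq R.valid hx hw).le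

/-- Clauses over variables with unit clauses are satisfied with probability at least `φ`. -/
theorem RoleSystem.unsatProb_unitOnly (hp : Params φ p) (hneg : ∀ i x, c i ≠ {(x, false)})
    (hne : ∀ i, (c i).Nonempty) {i : ι} (hb : Balanced φ p R.role (c i)) (hi : UnitOnly c i)
    (hu : i ∉ R.used) : unsatProb φ p R.role (c i) ≤ 1 - φ := by
  by_cases hpos : ∃ x, (x, true) ∈ c i
  · obtain ⟨x, hx⟩ := hpos
    exact (unsatProb_le hp hx).trans (hb.expect_false hp R.valid hx).le
  · have hall : ∀ l ∈ c i, l.2 = false := by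
      intro l hl
      by_contra h
      exact hpos ⟨l.1, by rwa [← show l.2 = true by simpa using h]⟩
    have hall' : ∀ l ∈ c i, (l.1, false) ∈ c i := fun l hl => by rwa [← hall l hl]
    obtain ⟨l, hl⟩ := hne i
    obtain ⟨l', hl', hll⟩ := exists_ne_of_ne_singleton hl fun m hm => by
      have h2 := hall m (by simp [hm])
      exact hneg i m.1 (by rw [hm, ← h2])
    have hne1 : l'.1 ≠ l.1 := fun h => hll (Prod.ext h (by rw [hall l hl, hall l' hl']))
    -- By maximality an unused negative clause contains at most one variable that is not an end. In
    -- particular two leaves, which may be positively correlated, never have to be compared.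
    have hpair : (∃ y b, R.role l.1 = .pair y b) ∨ ∃ y b, R.role l'.1 = .pair y b := by
      by_contra h
      push Not at h
      exact hne1.symm (R.eq_of_unused i hi hall hu _ _ (hall' l hl) (hall' l' hl') h.1 h.2)
    rcases hpair with ⟨y, b, h⟩ | ⟨y, b, h⟩
    · exact (unsatProb_le_mul hp (hall' l hl) (hall' l' hl')).trans
        (expect_pair_mul_any_le hp R.valid h hne1 (hb _ hl'))
    · exact (unsatProb_le_mul hp (hall' l' hl') (hall' l hl)).trans
        (expect_pair_mul_any_le hp R.valid h hne1.symm (hb _ hl))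

/-- Non-unit clauses with an independent variable do better if they are not used. -/
theorem RoleSystem.unsatProb_of_single (hp : Params φ p) {i : ι} (hns : ∀ l, c i ≠ {l})
    (hb : Balanced φ p R.role (c i)) (hi : UnitOnly c i) (hu : i ∉ R.used) {l : V × Bool}
    (hl : l ∈ c i) (hs : R.role l.1 = .single) :
    unsatProb φ p R.role (c i) ≤ 2 * φ - 1 := by
  have hsq := hp.sq
  have h1 := hp.half_le
  have h2 := hp.le_two_thirds
  obtain ⟨l', hl', hll⟩ := exists_ne_of_ne_singleton hl hns
  by_cases hpos : ∃ v, (v, true) ∈ c i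
  · obtain ⟨v, hv⟩ := hpos
    obtain ⟨x, b⟩ := l
    -- A negative `l` is combined with the positive literal of `v`, a positive `l` with any other
    -- literal. Either way the product is at most φ(1 - φ) = 2φ - 1.
    cases b
    · refine (unsatProb_le_of_single hp R.valid hs hl hv (by simp) (hb.expect_le hp R.valid hl)
        (hb.expect_false hp R.valid hv).le (by linarith)).trans (by nlinarith)
    · refine (unsatProb_le_of_single hp R.valid hs hl hl' hll (hb.expect_false hp R.valid hl).le
        (hb.expect_le hp R.valid hl') (by linarith)).trans (by nlinarith)
  · have hall : ∀ l ∈ c i, l.2 = false := by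
      intro l hl
      by_contra h
      exact hpos ⟨l.1, by rwa [← show l.2 = true by simpa using h]⟩
    have hall' : ∀ l ∈ c i, (l.1, false) ∈ c i := fun l hl => by rwa [← hall l hl]
    have hne1 : ∀ m ∈ c i, ∀ m' ∈ c i, m' ≠ m → m'.1 ≠ m.1 := fun m hm m' hm' hmm h =>
      hmm (Prod.ext h (by rw [hall m hm, hall m' hm']))
    have hpair : ∀ m ∈ c i, m ≠ l → ∃ y b, R.role m.1 = .pair y b := by
      intro m hm hml
      by_contra h
      push Not at h
      exact hne1 l hl m hm hml (R.eq_of_unused i hi hall hu _ _ (hall' m hm) (hall' l hl) h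
        (by simp [hs]))
    obtain ⟨y, b, hy⟩ := hpair l' hl' hll
    -- If `l` and `l'` were the only literals, the variable of `l` would have been made a leaf. With
    -- a third literal the bound is φ for the single variable times 1 - φ for the other two.
    obtain ⟨m, hm, hml, hml'⟩ : ∃ m ∈ c i, m ≠ l ∧ m ≠ l' := by
      by_contra h
      push Not at h
      refine R.single_isolated i l.1 l'.1 ?_ (hi l hl) hs y b hy
      ext m
      simp only [Finset.mem_insert, Finset.mem_singleton]
      constructor
      · intro hm
        by_cases e : m = l
        · exact Or.inl (Prod.ext (by rw [e]) (hall m hm))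
        · exact Or.inr (Prod.ext (by rw [h m hm e]) (hall m hm))
      · rintro (rfl | rfl)
        · exact hall' l hl
        · exact hall' l' hl'
    have hd1 := disjoint_coords_single R.valid hs (hne1 l hl l' hl' hll)
    have hd2 := disjoint_coords_single R.valid hs (hne1 l hl m hm hml)
    have hle : unsatProb φ p R.role (c i) ≤ expect (coordDist φ p R.role) (fun ω =>
        ind R.role l.1 true ω * (ind R.role l'.1 true ω * ind R.role m.1 true ω)) := by
      refine expect_mono (hp.dist_nonneg R.role) fun ω => ?_
      unfold unsatInd
      split_ifs with h
      · exact mul_nonneg (ind_nonneg _ _ _ _) (mul_nonneg (ind_nonneg _ _ _ _)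
          (ind_nonneg _ _ _ _))
      · have e := fun m hm => ind_eq_one h (hall' m hm)
        simp only [Bool.not_false] at e
        rw [e l hl, e l' hl', e m hm]; norm_num
    refine hle.trans ?_
    rw [expect_mul sum_coordDist (dependsOnCoords_ind R.role l.1 true)
      ((dependsOnCoords_ind R.role l'.1 true).mul (dependsOnCoords_ind R.role m.1 true))
      (Finset.disjoint_union_right.mpr ⟨hd1, hd2⟩), hb.expect_true hp R.valid (hall' l hl)]
    have := expect_pair_mul_any_le hp R.valid hy (hne1 l' hl' m hm hml') (hb _ hm)
    nlinarith

/-- First moment method: some outcome satisfies at least the expected number of clauses. -/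
theorem exists_count_ge (hp : Params φ p) (role : V → Role V) (c : ι → Finset (V × Bool)) :
    ∃ α : V → Bool, ∑ i, (1 - unsatProb φ p role (c i)) ≤
      ((Finset.univ.filter fun i => ∃ l ∈ c i, α l.1 = l.2).card : ℝ) := by
  have h : expect (coordDist φ p role) (fun ω => ∑ i, (1 - unsatInd role (c i) ω)) =
      ∑ i, (1 - unsatProb φ p role (c i)) := by
    rw [expect_sum]
    refine Finset.sum_congr rfl fun i _ => ?_
    rw [expect_sub, expect_const sum_coordDist]; rfl
  obtain ⟨ω, hω⟩ := exists_expect_le (hp.dist_nonneg role) sum_coordDist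
    (fun ω => ∑ i, (1 - unsatInd role (c i) ω))
  refine ⟨truth role ω, ?_⟩
  rw [← h]
  refine hω.trans (le_of_eq ?_)
  rw [Finset.card_filter]
  push_cast
  refine Finset.sum_congr rfl fun i _ => ?_
  unfold unsatInd
  split_ifs <;> norm_num

open Classical in
/-- The bound for formulas in which all unit clauses are positive and the other variables occur
positively in distinct clauses. -/
theorem exists_count_ge_of_positive (hsq : φ ^ 2 + φ = 1) (h1 : 1 / 2 ≤ φ) (h2 : φ ≤ 2 / 3)
    (c : ι → Finset (V × Bool)) (hne : ∀ i, (c i).Nonempty) (hneg : ∀ i x, c i ≠ {(x, false)})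
    (μ : V → ι) (hμ : ∀ x y, ¬HasUnit c x → ¬HasUnit c y → μ x = μ y → x = y)
    (hμc : ∀ x, ¬HasUnit c x → (x, true) ∈ c (μ x)) :
    ∃ α : V → Bool, φ * Fintype.card ι + (2 - 3 * φ) / 2 * Fintype.card V ≤
      ((Finset.univ.filter fun i => ∃ l ∈ c i, α l.1 = l.2).card : ℝ) := by
  obtain ⟨R⟩ := exists_roleSystem c
  -- The three classes are the variables without unit clauses, the single variables with unit
  -- clauses, and the correlated variables.
  let V₀ : Finset V := Finset.univ.filter fun x => ¬HasUnit c x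
  let I : Finset V := Finset.univ.filter fun x => HasUnit c x ∧ R.role x = .single
  let J : Finset V := Finset.univ.filter fun x => R.role x ≠ .single
  have hV0 : ∀ x, ¬HasUnit c x → R.role x = .single := R.single_of_not_hasUnit
  have hcardV : Fintype.card V = V₀.card + I.card + J.card := by
    have e1 : (V₀ ∪ I) ∪ J = Finset.univ := by
      ext x
      simp only [V₀, I, J, Finset.mem_union, Finset.mem_filter, Finset.mem_univ, true_and, iff_true]
      tauto
    have d1 : Disjoint V₀ I := Finset.disjoint_left.mpr fun x hx hx' => by
      simp only [V₀, I, Finset.mem_filter, Finset.mem_univ, true_and] at hx hx'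
      exact hx hx'.1
    have d2 : Disjoint (V₀ ∪ I) J := Finset.disjoint_left.mpr fun x hx hx' => by
      simp only [V₀, I, J, Finset.mem_union, Finset.mem_filter, Finset.mem_univ, true_and]
        at hx hx'
      rcases hx with h | h
      · exact hx' (hV0 x h)
      · exact hx' h.2
    rw [← Finset.card_univ, ← e1, Finset.card_union_of_disjoint d2, Finset.card_union_of_disjoint d1]
  -- `K₀` collects the clauses that meet `V₀`, and `Z` those among them that are matched to `V₀`.
  -- The clauses in `G` have a single variable to exploit when it is balanced, but they are at risk
  -- when it is fixed. `UI` contains the unit clauses on `I`.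
  let K₀ : Finset ι := Finset.univ.filter fun i => ¬UnitOnly c i
  let Z : Finset ι := V₀.image μ
  let G : Finset ι := Finset.univ.filter fun i => UnitOnly c i ∧ (∀ l, c i ≠ {l}) ∧ i ∉ R.used ∧
    ∃ l ∈ c i, R.role l.1 = .single
  let UI : Finset ι := Finset.univ.filter fun i => ∃ x ∈ I, c i = {(x, true)}
  have hZ : Z.card = V₀.card := Finset.card_image_of_injOn fun x hx y hy e =>
    hμ x y (Finset.mem_filter.mp hx).2 (Finset.mem_filter.mp hy).2 e
  have hUI : I.card ≤ UI.card := by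
    have : ∀ x : V, ∃ i : ι, x ∈ I → c i = {(x, true)} := by
      intro x
      by_cases hx : x ∈ I
      · obtain ⟨i, hi⟩ := (Finset.mem_filter.mp hx).2.1
        exact ⟨i, fun _ => hi⟩
      · exact ⟨μ x, fun h => absurd h hx⟩
    choose u hu using this
    refine Finset.card_le_card_of_injOn u (fun x hx => ?_) (fun x hx y hy e => ?_)
    · exact Finset.mem_filter.mpr ⟨Finset.mem_univ _, x, hx, hu x hx⟩
    · have := hu x hx
      rw [e, hu y hy] at this
      simpa using this.symm
  have hnotunit : ∀ i ∈ K₀, ∀ l, c i ≠ {l} := by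
    intro i hi l hl
    apply (Finset.mem_filter.mp hi).2
    intro m hm
    rw [hl, Finset.mem_singleton] at hm
    subst hm
    refine ⟨i, ?_⟩
    rw [hl]
    congr 1
    refine Prod.ext rfl ?_
    by_contra h
    have h : m.2 = false := by simpa using h
    exact hneg i m.1 (by rw [hl, ← h])
  have hunit : ∀ i l, c i = {l} → l.2 = true := by
    intro i l hl
    by_contra h
    have h : l.2 = false := by simpa using h
    exact hneg i l.1 (by rw [hl, ← h])
  have hK₀ : ∀ i ∈ K₀, ∃ l ∈ c i, ¬HasUnit c l.1 := by
    intro i hi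
    have := (Finset.mem_filter.mp hi).2
    unfold UnitOnly at this
    push Not at this
    exact this
  have hJ : (J.card : ℝ) ≤ 2 * R.used.card + R.leaves.card := by
    have := R.card_le
    have : J.card ≤ 2 * R.used.card + R.leaves.card := by convert this
    exact_mod_cast this
  have hK₀used : ∀ i ∈ K₀, i ∉ R.used := fun i hi h =>
    (Finset.mem_filter.mp hi).2 (R.used_neg i h).1
  have hK₀leaves : ∀ i ∈ K₀, i ∉ R.leaves := fun i hi h =>
    (Finset.mem_filter.mp hi).2 (R.leaves_unitOnly i h)
  have hK₀G : ∀ i ∈ K₀, i ∉ G := fun i hi h =>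
    (Finset.mem_filter.mp hi).2 (Finset.mem_filter.mp h).2.1
  have hK₀UI : ∀ i ∈ K₀, i ∉ UI := fun i hi h => by
    obtain ⟨x, -, hx⟩ := (Finset.mem_filter.mp h).2
    exact hnotunit i hi _ hx
  have hZK₀ : ∀ i ∈ Z, i ∈ K₀ := fun i hi => by
    obtain ⟨x, hx, rfl⟩ := Finset.mem_image.mp hi
    have hx := (Finset.mem_filter.mp hx).2
    exact Finset.mem_filter.mpr ⟨Finset.mem_univ _, fun h => hx (h _ (hμc x hx))⟩
  have husedleaves : ∀ i ∈ R.used, i ∉ R.leaves := fun _ h => Finset.disjoint_left.mp R.disj h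
  have husedG : ∀ i ∈ R.used, i ∉ G := fun i hi h => (Finset.mem_filter.mp h).2.2.2.1 hi
  have hleavesG : ∀ i ∈ R.leaves, i ∉ G := fun i hi h => by
    obtain ⟨l, hl, hs⟩ := (Finset.mem_filter.mp h).2.2.2.2
    obtain ⟨y, b, x, w, hx, hw, hc⟩ := R.leaves_spec i hi
    rw [hc] at hl
    simp only [Finset.mem_insert, Finset.mem_singleton] at hl
    rcases hl with rfl | rfl
    · rw [hw] at hs; cases hs
    · rw [hx] at hs; cases hs
  have hUIused : ∀ i ∈ UI, i ∉ R.used := fun i hi h => by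
    obtain ⟨x, -, hx⟩ := (Finset.mem_filter.mp hi).2
    have := (R.used_neg i h).2 (x, true) (by simp [hx])
    simp at this
  have hUIleaves : ∀ i ∈ UI, i ∉ R.leaves := fun i hi h => by
    obtain ⟨x, -, hx⟩ := (Finset.mem_filter.mp hi).2
    obtain ⟨y, b, x', w, -, -, hc⟩ := R.leaves_spec i h
    rw [hx] at hc
    have : (w, false) ∈ ({(x, true)} : Finset (V × Bool)) := by rw [hc]; simp
    simp at this
  have hUIG : ∀ i ∈ UI, i ∉ G := fun i hi h => by
    obtain ⟨x, -, hx⟩ := (Finset.mem_filter.mp hi).2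
    exact (Finset.mem_filter.mp h).2.2.1 _ hx
  have hunitOnly : ∀ i, i ∉ K₀ → UnitOnly c i := fun i hi => by
    by_contra h
    exact hi (Finset.mem_filter.mpr ⟨Finset.mem_univ _, h⟩)
  have half_literal : ∀ p : V → ℝ, Params φ p → ∀ x b, R.role x = .single → p x = 1 / 2 →
      expect (coordDist φ p R.role) (ind R.role x !b) = 1 / 2 := by
    intro p hp x b hs hx
    have e1 := expect_ind_single (φ := φ) (p := p) hs
    have e2 := expect_ind_not (φ := φ) (p := p) (role := R.role) x true
    cases b
    · exact e1.trans hx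
    · rw [e2, e1, hx]; norm_num
  -- Outside `K₀`, if single variables with unit clauses have probability φ, no clause falls below
  -- φ, and those that are used, witness leaves or belong to `G` exceed it by 2 - 3φ.
  have balanced : ∀ p : V → ℝ, Params φ p → (∀ x, HasUnit c x → p x = φ) → ∀ i, i ∉ K₀ →
      (if i ∈ R.used then 2 - 3 * φ else 0) + (if i ∈ R.leaves then 2 - 3 * φ else 0) +
      (if i ∈ G then 2 - 3 * φ else 0) ≤ 1 - φ - unsatProb φ p R.role (c i) := by
    intro p hp hpu i hi
    have hi' := hunitOnly i hi
    have hb : Balanced φ p R.role (c i) := fun l hl _ => hpu _ (hi' l hl)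
    by_cases hu : i ∈ R.used
    · simp only [hu, husedleaves i hu, husedG i hu, if_true, if_false]
      linarith [R.unsatProb_used hp hu]
    · by_cases hl : i ∈ R.leaves
      · simp only [hu, hl, hleavesG i hl, if_true, if_false]
        linarith [R.unsatProb_leaves hp hl]
      · by_cases hg : i ∈ G
        · simp only [hu, hl, hg, if_true, if_false]
          obtain ⟨-, -, hns, -, l, hl, hs⟩ := Finset.mem_filter.mp hg
          linarith [R.unsatProb_of_single hp hns hb hi' hu hl hs]
        · simp only [hu, hl, hg, if_false]
          linarith [R.unsatProb_unitOnly hp hneg hne hb hi' hu]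
  -- All single variables have probability φ. A clause in `Z` has an independent positive literal
  -- and a further literal, so it fails with probability at most (1 - φ)φ = 2φ - 1.
  have boundA : ∃ α : V → Bool, φ * Fintype.card ι + (2 - 3 * φ) *
      ((V₀.card : ℝ) + R.used.card + R.leaves.card + G.card) ≤
      ((Finset.univ.filter fun i => ∃ l ∈ c i, α l.1 = l.2).card : ℝ) := by
    have hp : Params φ (fun _ : V => φ) :=
      ⟨hsq, h1, h2, fun _ => ⟨by linarith, by linarith⟩⟩
    obtain ⟨α, hα⟩ := exists_count_ge hp R.role c
    refine ⟨α, le_trans ?_ hα⟩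
    have key : ∀ i, φ + ((if i ∈ Z then 2 - 3 * φ else 0) +
        ((if i ∈ R.used then 2 - 3 * φ else 0) + (if i ∈ R.leaves then 2 - 3 * φ else 0) +
        (if i ∈ G then 2 - 3 * φ else 0))) ≤ 1 - unsatProb φ (fun _ => φ) R.role (c i) := by
      intro i
      by_cases hi : i ∈ K₀
      · simp only [hK₀used i hi, hK₀leaves i hi, hK₀G i hi, if_false]
        have hb : Balanced φ (fun _ => φ) R.role (c i) := fun _ _ _ => rfl
        by_cases hz : i ∈ Z
        · simp only [hz, if_true]
          obtain ⟨x, hx, rfl⟩ := Finset.mem_image.mp hz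
          have hx := (Finset.mem_filter.mp hx).2
          obtain ⟨l', hl', hne'⟩ := exists_ne_of_ne_singleton (hμc x hx) (hnotunit _ hi)
          have := unsatProb_le_of_single hp R.valid (hV0 x hx) (hμc x hx) hl' hne'
            (hb.expect_false hp R.valid (hμc x hx)).le (hb.expect_le hp R.valid hl') (by linarith)
          nlinarith
        · simp only [hz, if_false]
          obtain ⟨l, hl, hlu⟩ := hK₀ i hi
          obtain ⟨l', hl', hne'⟩ := exists_ne_of_ne_singleton hl (hnotunit _ hi)
          have := unsatProb_le_of_single hp R.valid (hV0 _ hlu) hl hl' hne'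
            (hb.expect_le hp R.valid hl) (hb.expect_le hp R.valid hl') (by linarith)
          nlinarith
      · have hz : i ∉ Z := fun h => hi (hZK₀ i h)
        simp only [hz, if_false]
        have := balanced _ hp (fun _ _ => rfl) i hi
        linarith
    have := Finset.sum_le_sum fun i (_ : i ∈ Finset.univ) => key i
    simp only [Finset.sum_add_distrib, Finset.sum_ite_mem, Finset.univ_inter, Finset.sum_const,
      Finset.card_univ, nsmul_eq_mul, hZ] at this
    linarith
  -- The variables in `V₀` have probability 1/2. Each clause in `K₀` then fails with probability at
  -- most φ/2 and gains (2 - 3φ)/2.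
  have boundC : ∃ α : V → Bool, φ * Fintype.card ι + (2 - 3 * φ) / 2 * K₀.card + (2 - 3 * φ) *
      ((R.used.card : ℝ) + R.leaves.card + G.card) ≤
      ((Finset.univ.filter fun i => ∃ l ∈ c i, α l.1 = l.2).card : ℝ) := by
    let p : V → ℝ := fun x => if HasUnit c x then φ else 1 / 2
    have hp : Params φ p := ⟨hsq, h1, h2, fun x => by
      simp only [p]; split_ifs <;> constructor <;> linarith⟩
    obtain ⟨α, hα⟩ := exists_count_ge hp R.role c
    refine ⟨α, le_trans ?_ hα⟩
    have key : ∀ i, φ + ((if i ∈ K₀ then (2 - 3 * φ) / 2 else 0) +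
        ((if i ∈ R.used then 2 - 3 * φ else 0) + (if i ∈ R.leaves then 2 - 3 * φ else 0) +
        (if i ∈ G then 2 - 3 * φ else 0))) ≤ 1 - unsatProb φ p R.role (c i) := by
      intro i
      by_cases hi : i ∈ K₀
      · simp only [hi, hK₀used i hi, hK₀leaves i hi, hK₀G i hi, if_true, if_false]
        obtain ⟨l, hl, hlu⟩ := hK₀ i hi
        obtain ⟨l', hl', hne'⟩ := exists_ne_of_ne_singleton hl (hnotunit _ hi)
        have hle : ∀ l ∈ c i, expect (coordDist φ p R.role) (ind R.role l.1 !l.2) ≤ φ := by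
          intro l hl
          by_cases hu : HasUnit c l.1
          · have hb : Balanced φ p R.role {l} := fun m hm _ => by
              rw [Finset.mem_singleton] at hm
              simp [p, hm, hu]
            exact hb.expect_le hp R.valid (by simp)
          · exact (half_literal p hp l.1 l.2 (hV0 _ hu) (by simp [p, hu])).le.trans h1
        have := unsatProb_le_of_single hp R.valid (hV0 _ hlu) hl hl' hne'
          (half_literal p hp l.1 l.2 (hV0 _ hlu) (by simp [p, hlu])).le (hle l' hl') (by linarith)
        linarith
      · simp only [hi, if_false]
        have := balanced _ hp (fun x hx => by simp [p, hx]) i hi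
        linarith
    have := Finset.sum_le_sum fun i (_ : i ∈ Finset.univ) => key i
    simp only [Finset.sum_add_distrib, Finset.sum_ite_mem, Finset.univ_inter, Finset.sum_const,
      Finset.card_univ, nsmul_eq_mul] at this
    linarith
  -- The variables in `V₀` have probability 1/2 and those in `I` are fixed to true. The unit clauses
  -- on `I` gain 1 - φ, a clause in `K₀` loses at most φ - 1/2, and a clause in `G` is given up
  -- entirely.
  have boundB : ∃ α : V → Bool, φ * Fintype.card ι + (2 - 3 * φ) *
      ((R.used.card : ℝ) + R.leaves.card) + (1 - φ) * I.card - (φ - 1 / 2) * K₀.card - φ * G.card ≤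
      ((Finset.univ.filter fun i => ∃ l ∈ c i, α l.1 = l.2).card : ℝ) := by
    let p : V → ℝ := fun x => if HasUnit c x then 1 else 1 / 2
    have hp : Params φ p := ⟨hsq, h1, h2, fun x => by
      simp only [p]; split_ifs <;> constructor <;> linarith⟩
    obtain ⟨α, hα⟩ := exists_count_ge hp R.role c
    refine ⟨α, le_trans ?_ hα⟩
    have key : ∀ i, φ + ((if i ∈ R.used then 2 - 3 * φ else 0) +
        (if i ∈ R.leaves then 2 - 3 * φ else 0) + (if i ∈ UI then 1 - φ else 0) -
        (if i ∈ K₀ then φ - 1 / 2 else 0) - (if i ∈ G then φ else 0)) ≤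
        1 - unsatProb φ p R.role (c i) := by
      intro i
      by_cases hi : i ∈ K₀
      · simp only [hi, hK₀used i hi, hK₀leaves i hi, hK₀G i hi, hK₀UI i hi, if_true, if_false]
        obtain ⟨l, hl, hlu⟩ := hK₀ i hi
        have := unsatProb_le hp (role := R.role) hl
        have := half_literal p hp l.1 l.2 (hV0 _ hlu) (by simp [p, hlu])
        linarith
      · have hi' := hunitOnly i hi
        by_cases hui : i ∈ UI
        · simp only [hi, hUIused i hui, hUIleaves i hui, hUIG i hui, hui, if_true, if_false]
          obtain ⟨x, hx, hc⟩ := (Finset.mem_filter.mp hui).2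
          have hx := (Finset.mem_filter.mp hx).2
          have e1 := unsatProb_le hp (role := R.role) (s := c i) (x := x) (b := true) (by simp [hc])
          have e2 := expect_ind_not (φ := φ) (p := p) (role := R.role) x true
          have e3 := expect_ind_single (φ := φ) (p := p) hx.2
          have e4 : p x = 1 := by simp [p, hx.1]
          linarith
        · by_cases hu : i ∈ R.used
          · simp only [hi, hui, hu, husedleaves i hu, husedG i hu, if_true, if_false]
            linarith [R.unsatProb_used hp hu]
          · by_cases hl : i ∈ R.leaves
            · simp only [hi, hui, hu, hl, hleavesG i hl, if_true, if_false]
              linarith [R.unsatProb_leaves hp hl]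
            · by_cases hg : i ∈ G
              · simp only [hi, hui, hu, hl, hg, if_true, if_false]
                linarith [unsatProb_le_one hp R.role (c i)]
              · simp only [hi, hui, hu, hl, hg, if_false]
                -- Balanced because no single variable is left here: a unit clause with one would be
                -- in `UI`, a longer clause with one in `G`.
                have hb : Balanced φ p R.role (c i) := by
                  intro l hl hs
                  exfalso
                  by_cases hn : ∃ m, c i = {m}
                  · obtain ⟨m, hm⟩ := hn
                    rw [hm, Finset.mem_singleton] at hl
                    subst hl
                    refine hui (Finset.mem_filter.mpr ⟨Finset.mem_univ _, l.1, ?_, ?_⟩)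
                    · exact Finset.mem_filter.mpr ⟨Finset.mem_univ _, hi' l (by simp [hm]), hs⟩
                    · rw [hm, ← hunit i l hm]
                  · exact hg (Finset.mem_filter.mpr ⟨Finset.mem_univ _, hi',
                      not_exists.mp hn, hu, l, hl, hs⟩)
                linarith [R.unsatProb_unitOnly hp hneg hne hb hi' hu]
    have := Finset.sum_le_sum fun i (_ : i ∈ Finset.univ) => key i
    simp only [Finset.sum_add_distrib, Finset.sum_sub_distrib, Finset.sum_ite_mem,
      Finset.univ_inter, Finset.sum_const, Finset.card_univ, nsmul_eq_mul] at this ⊢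
    have hUI' : (I.card : ℝ) ≤ UI.card := by exact_mod_cast hUI
    have := mul_le_mul_of_nonneg_left hUI' (show 0 ≤ 1 - φ by linarith)
    linarith
  obtain ⟨αA, hA⟩ := boundA
  obtain ⟨αB, hB⟩ := boundB
  obtain ⟨αC, hC⟩ := boundC
  by_contra hcon
  push Not at hcon
  have cA := hcon αA
  have cB := hcon αB
  have cC := hcon αC
  rw [hcardV] at cA cB cC
  push_cast at cA cB cC
  set n₀ : ℝ := (V₀.card : ℝ)
  set i₀ : ℝ := (I.card : ℝ)
  set j : ℝ := (J.card : ℝ)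
  set g : ℝ := (G.card : ℝ)
  set k : ℝ := (K₀.card : ℝ)
  set r : ℝ := (R.used.card : ℝ)
  set w : ℝ := (R.leaves.card : ℝ)
  have hw : 0 ≤ w := Nat.cast_nonneg _
  have h0 : 0 < 2 - 3 * φ := by nlinarith
  -- The correlated variables are paid for by the used and leaf clauses, so only `V₀` and `I` remain
  -- in the comparison.
  have hj : (2 - 3 * φ) / 2 * j ≤ (2 - 3 * φ) * (r + w) := by nlinarith
  have dA : n₀ + 2 * g < i₀ := by nlinarith
  have dC : k - n₀ + 2 * g < i₀ := by nlinarith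
  have dB : (1 - φ) * i₀ - (φ - 1 / 2) * k - φ * g < (2 - 3 * φ) / 2 * (n₀ + i₀) := by nlinarith
  -- The multipliers of `dA` and `dC` are such that `e1` and `e2` add up to exactly the reverse of
  -- `dB`.
  have e1 : 0 < (1 - φ) / 2 * (i₀ - n₀ - 2 * g) := mul_pos (by linarith) (by linarith)
  have e2 : 0 ≤ (φ - 1 / 2) * (i₀ - k + n₀ - 2 * g) := mul_nonneg (by linarith) (by linarith)
  nlinarith

end UnsatProbability

/-! ### Normalizing the signs of a matched formula -/

section MatchedFormula

variable {V ι : Type*} [Fintype V] [DecidableEq V] [Fintype ι] [DecidableEq ι]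

open Classical in
/-- The bound for unit-conflict free formulas whose variables occur in distinct clauses. -/
theorem exists_count_ge_of_matching {φ : ℝ} (hsq : φ ^ 2 + φ = 1) (h1 : 1 / 2 ≤ φ)
    (h2 : φ ≤ 2 / 3) (c : ι → Finset (V × Bool)) (hne : ∀ i, (c i).Nonempty)
    (hucf : ∀ x, ¬((∃ i, c i = {(x, true)}) ∧ ∃ i, c i = {(x, false)}))
    (μ : V → ι) (hμ : Function.Injective μ) (hμc : ∀ x, ∃ b, (x, b) ∈ c (μ x)) :
    ∃ α : V → Bool, φ * Fintype.card ι + (2 - 3 * φ) / 2 * Fintype.card V ≤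
      ((Finset.univ.filter fun i => ∃ l ∈ c i, α l.1 = l.2).card : ℝ) := by
  choose β hβ using hμc
  -- The sign of the unit clauses on `x` if there are any, which is unambiguous by unit-conflict
  -- freeness, and otherwise the sign of `x` in its matched clause. Flipping by `σ` makes all these
  -- literals positive.
  let σ : V → Bool := fun x =>
    if ∃ i, c i = {(x, true)} then true else if ∃ i, c i = {(x, false)} then false else β x
  let f : V × Bool → V × Bool := fun l => (l.1, l.2 == σ l.1)
  have hff : ∀ l, f (f l) = l := by
    rintro ⟨x, b⟩
    simp only [f]
    cases b <;> cases σ x <;> rfl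
  have hf : Function.Injective f := Function.LeftInverse.injective hff
  have hsingle : ∀ i l, (c i).image f = {l} → c i = {f l} := by
    intro i l h
    apply Finset.image_injective hf
    rw [h, Finset.image_singleton, hff]
  have hσ : ∀ i x b, c i = {(x, b)} → σ x = b := by
    intro i x b h
    cases b
    · have h1 : ¬∃ i, c i = {(x, true)} := fun h' => hucf x ⟨h', i, h⟩
      have h2 : ∃ i, c i = {(x, false)} := ⟨i, h⟩
      simp only [σ, if_neg h1, if_pos h2]
    · have h1 : ∃ i, c i = {(x, true)} := ⟨i, h⟩
      simp only [σ, if_pos h1]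
  obtain ⟨α, hα⟩ := exists_count_ge_of_positive hsq h1 h2 (fun i => (c i).image f)
    (fun i => (hne i).image f) (fun i x h => by
      have := hsingle i _ h
      have h3 := hσ i _ _ this
      simp only at h3
      cases hx : σ x <;> rw [hx] at h3 <;> simp at h3) μ (fun x y _ _ h => hμ h) (fun x hx => by
      refine Finset.mem_image.mpr ⟨(x, β x), hβ x, ?_⟩
      have hn : ∀ b, ¬∃ i, c i = {(x, b)} := by
        rintro b ⟨i, hi⟩
        refine hx ⟨i, ?_⟩
        simp only [hi, Finset.image_singleton]
        simp [f, hσ i x b hi]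
      have : σ x = β x := by simp only [σ, if_neg (hn _)]
      simp [f, this])
  refine ⟨fun x => α x == σ x, hα.trans (le_of_eq ?_)⟩
  congr 2
  ext i
  simp only [Finset.mem_filter, Finset.mem_univ, true_and, Finset.mem_image]
  constructor
  · rintro ⟨_, ⟨⟨x, b⟩, hl, rfl⟩, h⟩
    refine ⟨(x, b), hl, ?_⟩
    simp only [f] at h ⊢
    rw [h]
    cases b <;> cases σ x <;> rfl
  · rintro ⟨⟨x, b⟩, hl, h⟩
    refine ⟨_, ⟨(x, b), hl, rfl⟩, ?_⟩
    simp only [f] at h ⊢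
    rw [← h]
    cases α x <;> cases σ x <;> rfl

end MatchedFormula

/-! ### Formulas as lists -/

/-- The number of clauses satisfied by an assignment of all names. -/
def satCount (A : Name → Bool) (C : List (List Literal)) : ℕ :=
  C.countP fun c => c.any fun l => A l.1 == l.2

theorem card_filter_get_eq_countP {α : Type*} (p : α → Bool) (l : List α) :
    (Finset.univ.filter fun i : Fin l.length => p (l.get i) = true).card = l.countP p := by
  induction l with
  | nil => simp
  | cons a l ih =>
    have := Fin.card_filter_univ_succ (fun i : Fin (l.length + 1) => p ((a :: l).get i) = true)
    simp only [List.length_cons]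
    rw [this, List.countP_cons]
    rw [← ih]
    by_cases h : p a = true
    · simp [h, add_comm]
    · simp [h]

/-- No variable occurs in unit clauses of both signs. -/
def ListUCF (C : List (List Literal)) : Prop :=
  ∀ x : Name, ¬((∃ c ∈ C, c.toFinset = {(x, true)}) ∧ ∃ c ∈ C, c.toFinset = {(x, false)})

/-- Indexing the clauses by their positions keeps repeated clauses apart, so multiplicities are
counted correctly. -/
theorem exists_satCount_ge {φ : ℝ} (hsq : φ ^ 2 + φ = 1) (h1 : 1 / 2 ≤ φ)
    (h2 : φ ≤ 2 / 3) (V : List Name) (C : List (List Literal)) (hnd : V.Nodup)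
    (hne : ∀ c ∈ C, c ≠ []) (hV : ∀ c ∈ C, ∀ l ∈ c, l.1 ∈ V) (hucf : ListUCF C)
    (μ : Name → ℕ) (hμ : ∀ x ∈ V, ∀ y ∈ V, μ x = μ y → x = y)
    (hμc : ∀ x ∈ V, ∃ c, C[μ x]? = some c ∧ ∃ b, (x, b) ∈ c) :
    ∃ A : Name → Bool, φ * C.length + (2 - 3 * φ) / 2 * V.length ≤ satCount A C := by
  classical
  let c : Fin C.length → Finset ({x // x ∈ V.toFinset} × Bool) := fun i =>
    Finset.univ.filter fun l => (l.1.1, l.2) ∈ C.get i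
  have hmem : ∀ i (l : {x // x ∈ V.toFinset} × Bool), l ∈ c i ↔ (l.1.1, l.2) ∈ C.get i :=
    fun i l => by simp [c]
  have hin : ∀ i : Fin C.length, C.get i ∈ C := fun i => List.get_mem C i
  have hback : ∀ i (l : Literal), l ∈ C.get i → ∃ h : l.1 ∈ V.toFinset, (⟨l.1, h⟩, l.2) ∈ c i :=
    fun i l hl => ⟨List.mem_toFinset.mpr (hV _ (hin i) l hl), (hmem i _).mpr hl⟩
  have hunit : ∀ i x b, c i = {(x, b)} → (C.get i).toFinset = {(x.1, b)} := by
    intro i x b h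
    ext l
    rw [List.mem_toFinset, Finset.mem_singleton]
    constructor
    · intro hl
      obtain ⟨h', hc⟩ := hback i l hl
      rw [h, Finset.mem_singleton, Prod.mk.injEq] at hc
      exact Prod.ext (congrArg Subtype.val hc.1) hc.2
    · rintro rfl
      have : (x, b) ∈ c i := by simp [h]
      exact (hmem i _).mp this
  have hlt : ∀ x : {x // x ∈ V.toFinset}, μ x.1 < C.length := fun x => by
    obtain ⟨d, hd, -⟩ := hμc x.1 (List.mem_toFinset.mp x.2)
    exact (List.getElem?_eq_some_iff.mp hd).1
  obtain ⟨α, hα⟩ := exists_count_ge_of_matching hsq h1 h2 c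
    (fun i => by
      obtain ⟨l, hl⟩ := List.exists_mem_of_ne_nil _ (hne _ (hin i))
      obtain ⟨h, hc⟩ := hback i l hl
      exact ⟨_, hc⟩)
    (fun x => by
      rintro ⟨⟨i, hi⟩, j, hj⟩
      exact hucf x.1 ⟨⟨_, hin i, hunit i x _ hi⟩, _, hin j, hunit j x _ hj⟩)
    (fun x => ⟨μ x.1, hlt x⟩)
    (fun x y h => Subtype.ext (hμ _ (List.mem_toFinset.mp x.2) _ (List.mem_toFinset.mp y.2)
      (Fin.mk.inj h)))
    (fun x => by
      obtain ⟨d, hd, b, hb⟩ := hμc x.1 (List.mem_toFinset.mp x.2)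
      refine ⟨b, (hmem _ _).mpr ?_⟩
      have := (List.getElem?_eq_some_iff.mp hd).2
      simpa [this] using hb)
  refine ⟨fun x => if h : x ∈ V.toFinset then α ⟨x, h⟩ else false, ?_⟩
  have e1 : Fintype.card {x // x ∈ V.toFinset} = V.length := by
    rw [Fintype.card_coe, List.toFinset_card_of_nodup hnd]
  rw [e1, Fintype.card_fin] at hα
  refine hα.trans ?_
  rw [satCount, ← card_filter_get_eq_countP]
  norm_cast
  refine Finset.card_le_card fun i hi => ?_
  simp only [Finset.mem_filter, Finset.mem_univ, true_and, List.any_eq_true] at hi ⊢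
  obtain ⟨l, hl, h⟩ := hi
  refine ⟨(l.1.1, l.2), (hmem i l).mp hl, ?_⟩
  have : l.1.1 ∈ V.toFinset := l.1.2
  simpa [this] using h

/-! ### Polynomial-time functions -/

/-- Types whose elements are represented by trees. -/
class Enc (α : Type) where
  enc : α → Data

open Enc

instance : Enc Data := ⟨fun d => d⟩

instance : Enc Bool := ⟨Data.ofBool⟩

instance : Enc ℕ := ⟨Data.ofNat⟩

instance {s : ℕ} : Enc (Fin s) := ⟨fun a => Data.ofNat a⟩

instance {α β : Type} [Enc α] [Enc β] : Enc (α × β) := ⟨fun p => .pair (enc p.1) (enc p.2)⟩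

instance {α : Type} [Enc α] : Enc (List α) := ⟨fun l => Data.ofList (l.map enc)⟩

/-- The size of the tree that represents an element. -/
def sz {α : Type} [Enc α] (a : α) : ℕ := (enc a).size

section PolynomialTimeFunctions

variable {α β γ δ : Type} [Enc α] [Enc β] [Enc γ] [Enc δ]

/-- The function is computed by a program in polynomial time. -/
@[fun_prop]
def PT (f : α → β) : Prop :=
  ∃ (P : Prog) (p : Polynomial ℕ), ∀ a, ∃ t ≤ p.eval (sz a), Eval P (enc a) (enc (f a)) t

theorem polynomial_eval_mono (p : Polynomial ℕ) {m n : ℕ} (h : m ≤ n) : p.eval m ≤ p.eval n := by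
  rw [Polynomial.eval_eq_sum_range, Polynomial.eval_eq_sum_range]
  exact Finset.sum_le_sum fun i _ => Nat.mul_le_mul_left _ (Nat.pow_le_pow_left h i)

theorem Data.one_le_size (d : Data) : 1 ≤ d.size := by cases d <;> simp [Data.size]

theorem sz_pair (a : α) (b : β) : sz (a, b) = sz a + sz b + 1 := rfl

theorem sz_nil : sz ([] : List α) = 1 := rfl

theorem sz_cons (a : α) (l : List α) : sz (a :: l) = sz a + sz l + 1 := rfl

theorem one_le_sz (a : α) : 1 ≤ sz a := Data.one_le_size _

theorem sz_append (l l' : List α) : sz (l ++ l') + 1 = sz l + sz l' := by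
  induction l with
  | nil => simp [sz_nil]; omega
  | cons a l ih => rw [List.cons_append, sz_cons, sz_cons]; omega

theorem length_lt_sz (l : List α) : l.length < sz l := by
  induction l with
  | nil => simp [sz_nil]
  | cons a l ih => rw [sz_cons, List.length_cons]; omega

theorem sz_le_of_mem {l : List α} {a : α} (h : a ∈ l) : sz a ≤ sz l := by
  induction l with
  | nil => simp at h
  | cons b l ih =>
    rw [sz_cons]
    rcases List.mem_cons.mp h with rfl | h
    · omega
    · have := ih h; omega

theorem sz_le_length_mul (l : List α) (n : ℕ) (h : ∀ a ∈ l, sz a ≤ n) :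
    sz l ≤ l.length * (n + 1) + 1 := by
  induction l with
  | nil => simp [sz_nil]
  | cons a l ih =>
    have h1 := ih fun b hb => h b (List.mem_cons_of_mem _ hb)
    have h2 := h a List.mem_cons_self
    rw [sz_cons, List.length_cons]
    linarith

theorem sz_nat (n : ℕ) : sz n = 2 * n + 1 := by
  show (Data.ofList (List.replicate n .nil)).size = _
  induction n with
  | zero => rfl
  | succ n ih =>
    rw [List.replicate_succ]
    show Data.size .nil + (Data.ofList (List.replicate n .nil)).size + 1 = _
    rw [ih]; simp [Data.size]; omega

theorem PT.exists_sz_le {f : α → β} (hf : PT f) :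
    ∃ p : Polynomial ℕ, ∀ a, sz (f a) ≤ p.eval (sz a) := by
  obtain ⟨P, p, h⟩ := hf
  refine ⟨p, fun a => ?_⟩
  obtain ⟨t, ht, he⟩ := h a
  exact he.size_le.2.trans ht

@[fun_prop]
theorem PT.id : PT (fun a : α => a) :=
  ⟨.id, Polynomial.X, fun a => ⟨_, by simp [sz], .id _⟩⟩

@[fun_prop]
theorem PT.comp {g : β → γ} {f : α → β} (hg : PT g) (hf : PT f) : PT (fun a => g (f a)) := by
  obtain ⟨P, p, hP⟩ := hf
  obtain ⟨Q, q, hQ⟩ := hg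
  refine ⟨.seq P Q, p + q.comp p + 1, fun a => ?_⟩
  obtain ⟨s, hs, hes⟩ := hP a
  obtain ⟨t, ht, het⟩ := hQ (f a)
  refine ⟨_, ?_, .seq hes het⟩
  have := polynomial_eval_mono q (hes.size_le.2.trans hs)
  simp only [Polynomial.eval_add, Polynomial.eval_comp, Polynomial.eval_one]
  have : q.eval (sz (f a)) ≤ q.eval (p.eval (sz a)) := this
  omega

@[fun_prop]
theorem PT.prodMk {f : α → β} {g : α → γ} (hf : PT f) (hg : PT g) : PT (fun a => (f a, g a)) := by
  obtain ⟨P, p, hP⟩ := hf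
  obtain ⟨Q, q, hQ⟩ := hg
  refine ⟨.pair P Q, p + q + 1, fun a => ?_⟩
  obtain ⟨s, hs, hes⟩ := hP a
  obtain ⟨t, ht, het⟩ := hQ a
  refine ⟨_, ?_, .pair hes het⟩
  simp only [Polynomial.eval_add, Polynomial.eval_one]
  omega

/-- A function that agrees with a function on trees. -/
theorem PT.of_data {F : Data → Data} (hF : PT F) {f : α → β} (h : ∀ a, F (enc a) = enc (f a)) :
    PT f := by
  obtain ⟨P, p, hP⟩ := hF
  refine ⟨P, p, fun a => ?_⟩
  obtain ⟨t, ht, he⟩ := hP (enc a)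
  exact ⟨t, ht, by rw [← h]; exact he⟩

/-- A function that does not change the representation. -/
theorem PT.of_enc_eq {f : α → β} (h : ∀ a, enc (f a) = enc a) : PT f :=
  PT.of_data (F := fun d => d) PT.id fun a => (h a).symm

/-- The left subtree. -/
def Data.left : Data → Data
  | .nil => .nil
  | .pair a _ => a

/-- The right subtree. -/
def Data.right : Data → Data
  | .nil => .nil
  | .pair _ b => b

@[fun_prop]
theorem PT.left : PT Data.left := ⟨.fst, Polynomial.X, fun d => by
  cases d with
  | nil => exact ⟨_, by simp [sz, enc, Data.size], .fst_nil⟩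
  | pair a b => exact ⟨_, by simp [sz, enc], .fst_pair a b⟩⟩

@[fun_prop]
theorem PT.right : PT Data.right := ⟨.snd, Polynomial.X, fun d => by
  cases d with
  | nil => exact ⟨_, by simp [sz, enc, Data.size], .snd_nil⟩
  | pair a b => exact ⟨_, by simp [sz, enc], .snd_pair a b⟩⟩

@[fun_prop]
theorem PT.fst : PT (Prod.fst : α × β → α) := PT.of_data PT.left fun _ => rfl

@[fun_prop]
theorem PT.snd : PT (Prod.snd : α × β → β) := PT.of_data PT.right fun _ => rfl

theorem PT.nilData : PT (fun _ : α => Data.nil) := ⟨.nil, Polynomial.X, fun a =>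
  ⟨_, by simp [sz], .nil _⟩⟩

theorem PT.pairData {F G : α → Data} (hF : PT F) (hG : PT G) : PT (fun a => Data.pair (F a) (G a)) := by
  obtain ⟨P, p, h⟩ := hF.prodMk hG
  exact ⟨P, p, h⟩

theorem PT.constData (d : Data) : PT (fun _ : α => d) := by
  induction d with
  | nil => exact PT.nilData
  | pair a b iha ihb => exact iha.pairData ihb

@[fun_prop]
theorem PT.const (b : β) : PT (fun _ : α => b) := by
  obtain ⟨P, p, h⟩ := PT.constData (α := α) (enc b)
  exact ⟨P, p, h⟩

/-- Case distinction on whether a tree is empty. -/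
theorem PT.iteData {c : α → Data} {f g : α → β} (hc : PT c) (hf : PT f) (hg : PT g)
    {h : α → β} (h1 : ∀ a, c a ≠ .nil → h a = f a) (h2 : ∀ a, c a = .nil → h a = g a) : PT h := by
  obtain ⟨C, pc, hC⟩ := hc
  obtain ⟨P, p, hP⟩ := hf
  obtain ⟨Q, q, hQ⟩ := hg
  refine ⟨.ite C P Q, pc + p + q + 1, fun a => ?_⟩
  obtain ⟨r, hr, her⟩ := hC a
  obtain ⟨s, hs, hes⟩ := hP a
  obtain ⟨t, ht, het⟩ := hQ a
  simp only [Polynomial.eval_add, Polynomial.eval_one]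
  change Eval C (enc a) (c a) r at her
  cases hca : c a with
  | nil =>
    rw [hca] at her
    rw [h2 a hca]
    exact ⟨_, by omega, .ite_false her het⟩
  | pair x y =>
    rw [hca] at her
    rw [h1 a (by simp [hca])]
    exact ⟨_, by omega, .ite_true her hes⟩

@[fun_prop]
theorem PT.cond {c : α → Bool} {f g : α → β} (hc : PT c) (hf : PT f) (hg : PT g) :
    PT (fun a => bif c a then f a else g a) := by
  obtain ⟨C, pc, hC⟩ := hc
  have hc' : PT (fun a => (Data.ofBool (c a))) := ⟨C, pc, hC⟩
  refine PT.iteData hc' hf hg (fun a h => ?_) (fun a h => ?_)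
  · cases hca : c a <;> simp_all [Data.ofBool]
  · cases hca : c a <;> simp_all [Data.ofBool]

@[fun_prop]
theorem PT.cons {f : α → β} {g : α → List β} (hf : PT f) (hg : PT g) :
    PT (fun a => f a :: g a) := by
  obtain ⟨P, p, h⟩ := hf.prodMk hg
  exact ⟨P, p, h⟩

@[fun_prop]
theorem PT.tail : PT (List.tail : List α → List α) := PT.of_data PT.right fun l => by
  cases l <;> rfl

@[fun_prop]
theorem PT.isEmpty : PT (List.isEmpty : List α → Bool) := by
  have : PT (fun l : List α => (enc l : Data)) := ⟨.id, Polynomial.X, fun a => ⟨_, by simp [sz], .id _⟩⟩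
  refine PT.iteData this (PT.const false) (PT.const true) (fun l h => ?_) (fun l h => ?_)
  · cases l
    · exact absurd rfl h
    · rfl
  · cases l
    · rfl
    · cases h

@[fun_prop]
theorem PT.and {f g : α → Bool} (hf : PT f) (hg : PT g) : PT (fun a => f a && g a) := by
  have : PT (fun a => bif f a then g a else false) := by fun_prop
  convert this using 2 with a
  cases f a <;> rfl

@[fun_prop]
theorem PT.not {f : α → Bool} (hf : PT f) : PT (fun a => !f a) := by
  have : PT (fun a => bif f a then false else true) := by fun_prop
  convert this using 2 with a
  cases f a <;> rfl

@[fun_prop]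
theorem PT.beqBool {f g : α → Bool} (hf : PT f) (hg : PT g) : PT (fun a => f a == g a) := by
  have : PT (fun a => bif f a then g a else !g a) := by fun_prop
  convert this using 2 with a
  cases f a <;> cases g a <;> rfl

/-! ### Folding over a list -/

/-- The body of the loop of a fold: the memory holds a context, a state and the remaining list. -/
def foldBody (S : Prog) : Prog :=
  .pair .fst (.pair (.seq (.pair .fst (.pair (.seq .snd .fst) (.seq .snd (.seq .snd .fst)))) S)
    (.seq .snd (.seq .snd .snd)))

/-- The factor 20 covers the ten projections, each of which costs at most the size of the memory,
and the overhead of combining them. -/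
theorem eval_foldBody {S : Prog} {c s b l s' : Data} {t : ℕ}
    (h : Eval S (.pair c (.pair s b)) s' t) :
    ∃ t' ≤ t + 20 * (Data.pair c (.pair s (.pair b l))).size,
      Eval (foldBody S) (.pair c (.pair s (.pair b l))) (.pair c (.pair s' l)) t' := by
  refine ⟨_, ?_, .pair (.fst_pair _ _) (.pair (.seq (.pair (.fst_pair _ _) (.pair (.seq
    (.snd_pair _ _) (.fst_pair _ _)) (.seq (.snd_pair _ _) (.seq (.snd_pair _ _)
    (.fst_pair _ _))))) h) (.seq (.snd_pair _ _) (.seq (.snd_pair _ _) (.snd_pair _ _))))⟩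
  have := c.one_le_size
  have := s.one_le_size
  have := b.one_le_size
  have := l.one_le_size
  simp only [Data.size]
  omega

/-- The test of the loop of a fold. -/
def foldTest : Prog := .seq .snd .snd

theorem eval_foldTest (c s l : Data) : ∃ t' ≤ 3 * (Data.pair c (.pair s l)).size,
    Eval foldTest (.pair c (.pair s l)) l t' := by
  refine ⟨_, ?_, .seq (.snd_pair _ _) (.snd_pair _ _)⟩
  have := c.one_le_size
  simp only [Data.size]
  omega

/-- Here `B` bounds the memory at every iteration and `T` the time of a step. The 23 is 3 for the
test plus 20 for the rearrangement, and the additional round pays for the last test. -/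
theorem eval_fold_loop {S : Prog} {σ : Type} [Enc σ] {step : α → σ → β → σ} (c : α) (B T : ℕ)
    (l : List β) (s : σ)
    (hB : ∀ l₁ l₂, l = l₁ ++ l₂ → sz (c, l₁.foldl (step c) s, l₂) ≤ B)
    (hS : ∀ l₁ b l₂, l = l₁ ++ b :: l₂ → ∃ t ≤ T,
      Eval S (enc (c, l₁.foldl (step c) s, b)) (enc (step c (l₁.foldl (step c) s) b)) t) :
    ∃ t ≤ (T + 23 * B + 1) * (l.length + 1), Eval (.loop foldTest (foldBody S)) (enc (c, s, l))
      (enc (c, l.foldl (step c) s, ([] : List β))) t := by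
  induction l generalizing s with
  | nil =>
    obtain ⟨t, ht, he⟩ := eval_foldTest (enc c) (enc s) (enc ([] : List β))
    refine ⟨_, ?_, .loop_done he⟩
    have := hB [] [] rfl
    simp only [List.foldl_nil] at this
    change (Data.pair (enc c) (.pair (enc s) (enc ([] : List β)))).size ≤ B at this
    simp only [List.length_nil]
    linarith
  | cons b l ih =>
    obtain ⟨t₀, ht₀, he₀⟩ := eval_foldTest (enc c) (enc s) (enc (b :: l))
    obtain ⟨t₁, ht₁, he₁⟩ := hS [] b l rfl
    obtain ⟨t₂, ht₂, he₂⟩ := eval_foldBody (l := enc l) he₁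
    obtain ⟨t₃, ht₃, he₃⟩ := ih (step c s b) (fun l₁ l₂ h => hB (b :: l₁) l₂ (by rw [h]; rfl))
      (fun l₁ b' l₂ h => hS (b :: l₁) b' l₂ (by rw [h]; rfl))
    refine ⟨_, ?_, .loop_step he₀ he₂ he₃⟩
    have := hB [] (b :: l) rfl
    simp only [List.foldl_nil] at this
    have h1 : (Data.pair (enc c) (.pair (enc s) (enc (b :: l)))).size ≤ B := this
    have h2 : (Data.pair (enc c) (.pair (enc s) (.pair (enc b) (enc l)))).size ≤ B := this
    rw [List.length_cons]
    simp only [List.foldl_nil] at ht₂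
    nlinarith

/-- A fold is computed in polynomial time if the sizes of the intermediate states are polynomially
bounded. -/
theorem PT.foldl_of_bound {σ : Type} [Enc σ] {l : α → List β} {init : α → σ}
    {step : α → σ → β → σ} (hl : PT l) (hi : PT init)
    (hs : PT (fun p : α × σ × β => step p.1 p.2.1 p.2.2))
    (hq : ∃ q : Polynomial ℕ, ∀ a l₁ l₂, l a = l₁ ++ l₂ →
      sz (l₁.foldl (step a) (init a)) ≤ q.eval (sz a)) :
    PT (fun a => (l a).foldl (step a) (init a)) := by
  obtain ⟨q, hq⟩ := hq
  obtain ⟨pl, hpl⟩ := hl.exists_sz_le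
  obtain ⟨S, p, hS⟩ := hs
  obtain ⟨I, r, hI⟩ := PT.id.prodMk (hi.prodMk hl)
  obtain ⟨E, e, hE⟩ := (PT.fst.comp PT.snd : PT (fun p : α × σ × List β => p.2.1))
  -- Input, state and remaining list, with two pairing nodes.
  let B : Polynomial ℕ := Polynomial.X + q + pl + 2
  let time : Polynomial ℕ := (p.comp B + 23 * B + 1) * (pl + 1)
  refine ⟨.seq I (.seq (.loop foldTest (foldBody S)) E), r + time + e.comp B + 2, fun a => ?_⟩
  have hB : ∀ l₁ l₂, l a = l₁ ++ l₂ → sz (a, l₁.foldl (step a) (init a), l₂) ≤ B.eval (sz a) := by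
    intro l₁ l₂ h
    have h1 := hq a l₁ l₂ h
    have h2 := hpl a
    have h3 := sz_append l₁ l₂
    have h4 := one_le_sz l₁
    rw [← h] at h3
    simp only [B, Polynomial.eval_add, Polynomial.eval_X, sz_pair, Polynomial.eval_ofNat]
    omega
  obtain ⟨t₁, ht₁, he₁⟩ := hI a
  obtain ⟨t₂, ht₂, he₂⟩ := eval_fold_loop (S := S) (step := step) a (B.eval (sz a))
    (p.eval (B.eval (sz a))) (l a) (init a) hB (fun l₁ b l₂ h => by
      obtain ⟨t, ht, he⟩ := hS (a, l₁.foldl (step a) (init a), b)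
      refine ⟨t, ht.trans (polynomial_eval_mono p ?_), he⟩
      refine le_trans ?_ (hB l₁ (b :: l₂) h)
      simp only [sz_pair, sz_cons]
      omega)
  obtain ⟨t₃, ht₃, he₃⟩ := hE (a, (l a).foldl (step a) (init a), [])
  refine ⟨_, ?_, .seq he₁ (.seq he₂ he₃)⟩
  have h1 := polynomial_eval_mono e (hB (l a) [] (by simp))
  have h2 : (p.eval (B.eval (sz a)) + 23 * B.eval (sz a) + 1) * ((l a).length + 1) ≤
      time.eval (sz a) := by
    simp only [time, Polynomial.eval_mul, Polynomial.eval_add, Polynomial.eval_comp,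
      Polynomial.eval_one, Polynomial.eval_ofNat]
    refine Nat.mul_le_mul_left _ ?_
    have := length_lt_sz (l a)
    have := hpl a
    omega
  simp only [Polynomial.eval_add, Polynomial.eval_comp, Polynomial.eval_ofNat]
  omega

/-- A fold whose steps increase the size by a bounded amount. -/
theorem PT.foldl_of_step {σ : Type} [Enc σ] {l : α → List β} {init : α → σ}
    {step : α → σ → β → σ} (hl : PT l) (hi : PT init)
    (hs : PT (fun p : α × σ × β => step p.1 p.2.1 p.2.2))
    (hq : ∃ q : Polynomial ℕ, ∀ a s b, b ∈ l a → sz (step a s b) ≤ sz s + q.eval (sz a)) :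
    PT (fun a => (l a).foldl (step a) (init a)) := by
  refine PT.foldl_of_bound hl hi hs ?_
  obtain ⟨q, hq⟩ := hq
  obtain ⟨pl, hpl⟩ := hl.exists_sz_le
  obtain ⟨pi, hpi⟩ := hi.exists_sz_le
  refine ⟨pi + pl * q, fun a l₁ l₂ h => ?_⟩
  have key : ∀ (l' : List β) (s : σ), (∀ b ∈ l', b ∈ l a) →
      sz (l'.foldl (step a) s) ≤ sz s + l'.length * q.eval (sz a) := by
    intro l'
    induction l' with
    | nil => intro s _; simp
    | cons b l' ih =>
      intro s hb
      rw [List.foldl_cons, List.length_cons]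
      have h1 := ih (step a s b) fun b' hb' => hb b' (List.mem_cons_of_mem _ hb')
      have h2 := hq a s b (hb b List.mem_cons_self)
      linarith
  have h1 := key l₁ (init a) fun b hb => by rw [h]; exact List.mem_append_left _ hb
  have h2 := hpi a
  have h3 : l₁.length ≤ pl.eval (sz a) := by
    have := length_lt_sz (l a)
    have := hpl a
    have : l₁.length ≤ (l a).length := by rw [h]; simp
    omega
  have h4 := Nat.mul_le_mul_right (q.eval (sz a)) h3
  simp only [Polynomial.eval_add, Polynomial.eval_mul]
  omega

@[fun_prop]
theorem PT.reverse : PT (List.reverse : List α → List α) := by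
  have : PT (fun l : List α => l.foldl (fun acc b => b :: acc) []) := by
    refine PT.foldl_of_step (step := fun _ acc b => b :: acc) PT.id (PT.const []) (by fun_prop)
      ⟨Polynomial.X + 1, fun l s b hb => ?_⟩
    have := sz_le_of_mem hb
    simp only [sz_cons, Polynomial.eval_add, Polynomial.eval_X, Polynomial.eval_one]
    omega
  convert this using 2 with l
  simp

theorem PT.foldr_of_step {σ : Type} [Enc σ] {l : α → List β} {init : α → σ}
    {step : α → β → σ → σ} (hl : PT l) (hi : PT init)
    (hs : PT (fun p : α × σ × β => step p.1 p.2.2 p.2.1))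
    (hq : ∃ q : Polynomial ℕ, ∀ a s b, b ∈ l a → sz (step a b s) ≤ sz s + q.eval (sz a)) :
    PT (fun a => (l a).foldr (step a) (init a)) := by
  have : PT (fun a => (l a).reverse.foldl (fun s b => step a b s) (init a)) := by
    refine PT.foldl_of_step (l := fun a => (l a).reverse) (step := fun a s b => step a b s)
      (PT.reverse.comp hl) hi hs ?_
    obtain ⟨q, hq⟩ := hq
    exact ⟨q, fun a s b hb => hq a s b (List.mem_reverse.mp hb)⟩
  convert this using 2 with a
  rw [List.foldl_reverse]

@[fun_prop]
theorem PT.append {f g : α → List β} (hf : PT f) (hg : PT g) : PT (fun a => f a ++ g a) := by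
  have : PT (fun a => (f a).foldr (fun b acc => b :: acc) (g a)) := by
    refine PT.foldr_of_step (step := fun _ b acc => b :: acc) hf hg (by fun_prop) ?_
    obtain ⟨p, hp⟩ := hf.exists_sz_le
    refine ⟨p + 1, fun a s b hb => ?_⟩
    have := sz_le_of_mem hb
    have := hp a
    simp only [sz_cons, Polynomial.eval_add, Polynomial.eval_one]
    omega
  convert this using 2 with a
  simp

/-- The results of a polynomial-time function on the members of a list are polynomially bounded. -/
theorem PT.exists_sz_le_of_mem {l : α → List β} {f : α → β → γ} (hl : PT l)
    (hf : PT (fun p : α × β => f p.1 p.2)) :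
    ∃ q : Polynomial ℕ, ∀ a, ∀ b ∈ l a, sz (f a b) ≤ q.eval (sz a) := by
  obtain ⟨p, hp⟩ := hl.exists_sz_le
  obtain ⟨r, hr⟩ := hf.exists_sz_le
  refine ⟨r.comp (Polynomial.X + p + 1), fun a b hb => (hr (a, b)).trans ?_⟩
  rw [Polynomial.eval_comp]
  refine polynomial_eval_mono r ?_
  have := sz_le_of_mem hb
  have := hp a
  simp only [sz_pair, Polynomial.eval_add, Polynomial.eval_one, Polynomial.eval_X]
  omega

@[fun_prop]
theorem PT.flatMap {l : α → List β} {f : α → β → List γ} (hl : PT l)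
    (hf : PT (fun p : α × β => f p.1 p.2)) : PT (fun a => (l a).flatMap (f a)) := by
  have : PT (fun a => (l a).foldr (fun b acc => f a b ++ acc) []) := by
    refine PT.foldr_of_step (step := fun a b acc => f a b ++ acc) hl (PT.const []) ?_ ?_
    · have : PT (fun p : α × List γ × β => f p.1 p.2.2) :=
        hf.comp (f := fun p : α × List γ × β => (p.1, p.2.2)) (by fun_prop)
      fun_prop
    · obtain ⟨q, hq⟩ := hl.exists_sz_le_of_mem hf
      refine ⟨q, fun a s b hb => ?_⟩
      have := hq a b hb
      have := sz_append (f a b) s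
      omega
  convert this using 2 with a
  induction l a with
  | nil => rfl
  | cons b l ih => simp [ih]

@[fun_prop]
theorem PT.map {l : α → List β} {f : α → β → γ} (hl : PT l)
    (hf : PT (fun p : α × β => f p.1 p.2)) : PT (fun a => (l a).map (f a)) := by
  have : PT (fun a => (l a).flatMap (fun b => [f a b])) := by fun_prop
  convert this using 2 with a
  rw [List.map_eq_flatMap]

@[fun_prop]
theorem PT.filter {l : α → List β} {f : α → β → Bool} (hl : PT l)
    (hf : PT (fun p : α × β => f p.1 p.2)) : PT (fun a => (l a).filter (f a)) := by
  have : PT (fun a => (l a).flatMap (fun b => bif f a b then [b] else [])) := by fun_prop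
  convert this using 2 with a
  induction l a with
  | nil => rfl
  | cons b l ih => cases h : f a b <;> simp [h, ih]

@[fun_prop]
theorem PT.all {l : α → List β} {f : α → β → Bool} (hl : PT l)
    (hf : PT (fun p : α × β => f p.1 p.2)) : PT (fun a => (l a).all (f a)) := by
  have : PT (fun a => ((l a).filter (fun b => !f a b)).isEmpty) := by fun_prop
  convert this using 2 with a
  rw [Bool.eq_iff_iff]
  simp

@[fun_prop]
theorem PT.any {l : α → List β} {f : α → β → Bool} (hl : PT l)
    (hf : PT (fun p : α × β => f p.1 p.2)) : PT (fun a => (l a).any (f a)) := by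
  have : PT (fun a => !((l a).filter (fun b => f a b)).isEmpty) := by fun_prop
  convert this using 2 with a
  rw [Bool.eq_iff_iff]
  simp

/-- The first element of a list, as a list. -/
@[fun_prop]
theorem PT.takeOne : PT (List.take 1 : List α → List α) := by
  have h1 : PT (fun d : Data => Data.pair d.left .nil) := by
    exact PT.left.pairData (PT.const Data.nil)
  have : PT (fun d : Data => match d with | .nil => Data.nil | .pair a _ => Data.pair a .nil) := by
    refine PT.iteData (c := fun d : Data => d) PT.id h1 (PT.const Data.nil) (fun d h => ?_)
      (fun d h => ?_)
    · cases d
      · exact absurd rfl h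
      · rfl
    · cases d
      · rfl
      · cases h
  refine PT.of_data this fun l => ?_
  cases l <;> rfl

/-! ### Numbers -/

-- A unary number and the list of that many `false` are the same tree, so arithmetic reduces to
-- operations on lists.
@[fun_prop]
theorem PT.replicate : PT (fun n : ℕ => List.replicate n false) :=
  PT.of_enc_eq fun n => by simp [enc, Data.ofNat, Data.ofBool]

theorem PT.length_replicate : PT (fun l : List Bool => l.length) := by
  have : PT (fun l : List Bool => l.map fun _ => false) := by fun_prop
  obtain ⟨P, p, h⟩ := this
  refine ⟨P, p, fun l => ?_⟩
  convert h l using 4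
  simp [enc, Data.ofNat, Data.ofBool, List.map_const']

@[fun_prop]
theorem PT.length : PT (fun l : List α => l.length) := by
  have : PT (fun l : List α => (l.map fun _ => false).length) :=
    PT.length_replicate.comp (by fun_prop)
  simpa using this

@[fun_prop]
theorem PT.add {f g : α → ℕ} (hf : PT f) (hg : PT g) : PT (fun a => f a + g a) := by
  have : PT (fun a => (List.replicate (f a) false ++ List.replicate (g a) false).length) := by
    fun_prop
  simpa using this

@[fun_prop]
theorem PT.mul {f g : α → ℕ} (hf : PT f) (hg : PT g) : PT (fun a => f a * g a) := by
  have : PT (fun a => ((List.replicate (f a) false).flatMap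
    fun _ => List.replicate (g a) false).length) := by fun_prop
  convert this using 2 with a
  simp [List.length_flatMap]

@[fun_prop]
theorem PT.sub {f g : α → ℕ} (hf : PT f) (hg : PT g) : PT (fun a => f a - g a) := by
  have : PT (fun a => ((List.replicate (g a) false).foldl (fun (l : List Bool) _ => l.tail)
      (List.replicate (f a) false)).length) := by
    refine PT.length.comp (PT.foldl_of_step (step := fun _ (l : List Bool) _ => l.tail)
      (init := fun a => List.replicate (f a) false) (l := fun a => List.replicate (g a) false) (by fun_prop) (by fun_prop) (by fun_prop)
      ⟨0, fun a s b hb => ?_⟩)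
    cases s with
    | nil => simp
    | cons x s => rw [List.tail_cons, sz_cons]; omega
  convert this using 2 with a
  generalize f a = m
  generalize g a = n
  have key : ∀ (n : ℕ) (l : List Bool),
      ((List.replicate n false).foldl (fun l _ => l.tail) l).length = l.length - n := by
    intro n
    induction n with
    | zero => simp
    | succ n ih =>
      intro l
      rw [List.replicate_succ, List.foldl_cons, ih, List.length_tail]
      omega
  rw [key, List.length_replicate]

@[fun_prop]
theorem PT.decideLe {f g : α → ℕ} (hf : PT f) (hg : PT g) : PT (fun a => decide (f a ≤ g a)) := by
  have : PT (fun a => (List.replicate (f a - g a) false).isEmpty) := by fun_prop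
  convert this using 2 with a
  rw [Bool.eq_iff_iff]
  simp [Nat.sub_eq_zero_iff_le]

/-! ### Equality -/

/-- Equality is decided in polynomial time. -/
class EqPT (α : Type) [Enc α] [DecidableEq α] : Prop where
  pt : PT (fun p : α × α => decide (p.1 = p.2))

@[fun_prop]
theorem PT.decideEq [DecidableEq β] [EqPT β] {f g : α → β} (hf : PT f) (hg : PT g) :
    PT (fun a => decide (f a = g a)) :=
  (EqPT.pt (α := β)).comp (hf.prodMk hg)

instance : EqPT Bool := ⟨by
  have : PT (fun p : Bool × Bool => p.1 == p.2) := by fun_prop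
  convert this using 2 with p
  obtain ⟨a, b⟩ := p
  cases a <;> cases b <;> rfl⟩

instance : EqPT ℕ := ⟨by
  have : PT (fun p : ℕ × ℕ => decide (p.1 ≤ p.2) && decide (p.2 ≤ p.1)) := by fun_prop
  convert this using 2 with p
  rw [Bool.eq_iff_iff]
  simp [le_antisymm_iff]⟩

instance {s : ℕ} : EqPT (Fin s) := ⟨by
  have h : PT (fun a : Fin s => (a : ℕ)) := PT.of_enc_eq fun _ => rfl
  have : PT (fun p : Fin s × Fin s => decide ((p.1 : ℕ) = (p.2 : ℕ))) := by fun_prop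
  convert this using 2 with p
  simp [Fin.ext_iff]⟩

instance [DecidableEq α] [DecidableEq β] [EqPT α] [EqPT β] : EqPT (α × β) := ⟨by
  have : PT (fun p : (α × β) × (α × β) => decide (p.1.1 = p.2.1) && decide (p.1.2 = p.2.2)) := by
    fun_prop
  convert this using 2 with p
  rw [Bool.eq_iff_iff]
  simp [Prod.ext_iff]⟩

instance [DecidableEq α] [EqPT α] : EqPT (List α) := ⟨by
  -- The second list is consumed in step with the first, and the flag records agreement so far. An
  -- exhausted second list clears the flag, and a leftover is caught at the end.
  have : PT (fun p : List α × List α =>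
      (fun r : List α × Bool => r.2 && r.1.isEmpty) (p.1.foldl (fun r b =>
        (r.1.tail, r.2 && (r.1.take 1).any fun c => decide (c = b))) (p.2, true))) := by
    refine PT.comp (g := fun r : List α × Bool => r.2 && r.1.isEmpty) (by fun_prop)
      (PT.foldl_of_step (l := fun p : List α × List α => p.1)
      (init := fun p => (p.2, true)) (step := fun _ (r : List α × Bool) b => (r.1.tail, r.2 &&
      (r.1.take 1).any fun c => decide (c = b))) (by fun_prop) (by fun_prop) (by fun_prop)
      ⟨3, fun a s b hb => ?_⟩)
    obtain ⟨s, o⟩ := s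
    have h1 : sz s.tail ≤ sz s := by
      cases s with
      | nil => simp
      | cons x s => rw [List.tail_cons, sz_cons]; omega
    have h2 : ∀ o : Bool, 1 ≤ sz o ∧ sz o ≤ 3 := by
      intro o; cases o <;> simp [sz, enc, Data.ofBool, Data.size]
    have h3 := (h2 (o && (s.take 1).any fun c => decide (c = b))).2
    have h4 := (h2 o).1
    simp only [sz_pair, Polynomial.eval_ofNat]
    omega
  convert this using 2 with p
  obtain ⟨l, l'⟩ := p
  have key : ∀ (l l' : List α) (o : Bool), (fun r : List α × Bool => r.2 && r.1.isEmpty)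
      (l.foldl (fun r b => (r.1.tail, r.2 && (r.1.take 1).any fun c => decide (c = b)))
      (l', o)) = (o && decide (l = l')) := by
    intro l
    induction l with
    | nil => intro l' o; cases l' <;> simp
    | cons b l ih =>
      intro l' o
      rw [List.foldl_cons]
      cases l' with
      | nil => exact (ih [] _).trans (by simp)
      | cons c l' =>
        refine (ih l' (o && (List.take 1 (c :: l')).any fun d => decide (d = b))).trans ?_
        rw [Bool.eq_iff_iff]
        simp only [List.take_succ_cons, List.take_zero, List.any_cons, List.any_nil, Bool.or_false,
          Bool.and_eq_true, decide_eq_true_eq, List.cons.injEq, eq_comm (a := c)]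
        tauto
  have := key l l' true
  simpa using this.symm⟩

end PolynomialTimeFunctions

/-! ### Matching variables to clauses -/

/-- A clause with an identification number. -/
abbrev Slot : Type := ℕ × List Literal

/-- A matching of variables to clauses. -/
abbrev Mat : Type := List (Name × ℕ)

/-- The variable occurs in the clause. -/
def occurs (u : Name) (c : List Literal) : Bool := c.any fun l => decide (l.1 = u)

/-- The variable is one of those reached so far. -/
def visited (L : List (Name × Mat)) (w : Name) : Bool := L.any fun e => decide (e.1 = w)

/-- An entry of `L` consists of a variable and a matching that leaves out just this variable; a
clause in which the variable occurs gives rise to a matching that leaves out another variable. -/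
def newEntries (J : List Slot) (L : List (Name × Mat)) : List (Name × Mat) :=
  L.flatMap fun e => (J.filter fun s => occurs e.1 s.2).flatMap fun s =>
    (e.2.filter fun q => decide (q.2 = s.1) && !visited L q.1).map fun q =>
      (q.1, (e.1, s.1) :: e.2.filter fun r => !decide (r.2 = s.1))

/-- Add one new entry, if there is one. -/
def grow (J : List Slot) (L : List (Name × Mat)) : List (Name × Mat) :=
  (newEntries J L).take 1 ++ L

/-- All variables reachable from `v` by alternating paths. -/
def reach (J : List Slot) (V : List Name) (v : Name) (M : Mat) : List (Name × Mat) :=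
  V.foldl (fun L _ => grow J L) [(v, M)]

/-- The larger matchings that are obtained from an unmatched clause. -/
def augments (J : List Slot) (L : List (Name × Mat)) : List Mat :=
  L.flatMap fun e => (J.filter fun s => occurs e.1 s.2 && !e.2.any fun q => decide (q.2 = s.1)).map
    fun s => (e.1, s.1) :: e.2

/-- Extend the matching to `v`, or remove a set of variables that has too few clauses. The state
consists of the matching, the remaining clauses and the removed variables. -/
def processVar (V : List Name) (S : Mat × List Slot × List Name) (v : Name) :
    Mat × List Slot × List Name :=
  (fun L => bif (augments S.2.1 L).isEmpty then
    (S.1.filter fun q => !visited L q.1, S.2.1.filter fun s => !s.2.any fun l => visited L l.1,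
      L.map (fun e => e.1) ++ S.2.2)
  else (((augments S.2.1 L).take 1).flatMap fun m => m, S.2.1, S.2.2)) (reach S.2.1 V v S.1)

/-- Process all variables. -/
def matchVars (V : List Name) (S₀ : List Slot) : Mat × List Slot × List Name :=
  V.foldl (fun S v => processVar V S v) ([], S₀, [])

/-! ### Correctness of the search for augmenting paths -/

theorem occurs_iff {u : Name} {c : List Literal} : occurs u c = true ↔ ∃ b, (u, b) ∈ c := by
  simp [occurs]

theorem visited_iff {L : List (Name × Mat)} {w : Name} :
    visited L w = true ↔ w ∈ L.map Prod.fst := by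
  simp [visited]

/-- Variables and clauses are matched at most once, and only if the variable occurs. -/
structure IsMat (J : List Slot) (M : Mat) : Prop where
  fst_inj : ∀ q ∈ M, ∀ q' ∈ M, q.1 = q'.1 → q = q'
  snd_inj : ∀ q ∈ M, ∀ q' ∈ M, q.2 = q'.2 → q = q'
  adj : ∀ q ∈ M, ∃ s ∈ J, s.1 = q.2 ∧ occurs q.1 s.2 = true

/-- The invariant of the search for an augmenting path. -/
structure GoodEntry (J : List Slot) (M : Mat) (v : Name) (L : List (Name × Mat))
    (e : Name × Mat) : Prop where
  isMat : IsMat J e.2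
  unmatched : ∀ q ∈ e.2, q.1 ≠ e.1
  vars : ∀ x, (x ∈ e.2.map Prod.fst ∨ x = e.1) ↔ (x ∈ M.map Prod.fst ∨ x = v)
  ids : ∀ j, j ∈ e.2.map Prod.snd ↔ j ∈ M.map Prod.snd
  agree : ∀ q : Name × ℕ, visited L q.1 = false → (q ∈ e.2 ↔ q ∈ M)

/-- Entries are distinguished by the variable they leave out; `nodup` is what limits the number of
rounds of the search. -/
structure GoodSearch (J : List Slot) (M : Mat) (v : Name) (L : List (Name × Mat)) : Prop where
  good : ∀ e ∈ L, GoodEntry J M v L e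
  nodup : (L.map Prod.fst).Nodup
  start : v ∈ L.map Prod.fst

theorem mem_newEntries {J : List Slot} {L : List (Name × Mat)} {n : Name × Mat} :
    n ∈ newEntries J L ↔ ∃ e ∈ L, ∃ s ∈ J, occurs e.1 s.2 = true ∧ ∃ q ∈ e.2, q.2 = s.1 ∧
      visited L q.1 = false ∧ n = (q.1, (e.1, s.1) :: e.2.filter fun r => !decide (r.2 = s.1)) := by
  simp only [newEntries, List.mem_flatMap, List.mem_filter, List.mem_map, Bool.and_eq_true,
    decide_eq_true_eq, Bool.not_eq_true']
  constructor
  · rintro ⟨e, he, s, ⟨hs, ho⟩, q, ⟨hq, hqs, hv⟩, rfl⟩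
    exact ⟨e, he, s, hs, ho, q, hq, hqs, hv, rfl⟩
  · rintro ⟨e, he, s, hs, ho, q, hq, hqs, hv, rfl⟩
    exact ⟨e, he, s, ⟨hs, ho⟩, q, ⟨hq, hqs, hv⟩, rfl⟩

/-- Moving the clause of `s` from `q.1` to `e.1` frees `q.1` in place of `e.1` and keeps the set of
matched clauses. Both variables are now visited, so agreement with `M` at unvisited variables
persists. -/
theorem GoodSearch.cons {J : List Slot} {M : Mat} {v : Name} {L : List (Name × Mat)}
    (h : GoodSearch J M v L) {n : Name × Mat} (hn : n ∈ newEntries J L) :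
    GoodSearch J M v (n :: L) := by
  obtain ⟨e, he, s, hs, ho, q, hq, hqs, hv, rfl⟩ := mem_newEntries.mp hn
  have hnotin : q.1 ∉ L.map Prod.fst := fun h => by
    rw [visited_iff.mpr h] at hv; cases hv
  have g := h.good e he
  have hmono : ∀ x, visited ((q.1, (e.1, s.1) :: e.2.filter fun r => !decide (r.2 = s.1)) :: L) x =
      false → x ≠ q.1 ∧ visited L x = false := by
    intro x hx
    simp only [visited, List.any_cons, Bool.or_eq_false_iff, decide_eq_false_iff_not] at hx ⊢
    exact ⟨fun h => hx.1 h.symm, hx.2⟩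
  have hev : ∀ x, visited L x = false → x ≠ e.1 := by
    rintro x hx rfl
    rw [visited_iff.mpr (List.mem_map_of_mem he)] at hx; cases hx
  have hmem : ∀ r, r ∈ (e.1, s.1) :: e.2.filter (fun r => !decide (r.2 = s.1)) ↔
      r = (e.1, s.1) ∨ (r ∈ e.2 ∧ r.2 ≠ s.1) := by
    intro r; simp
  have huniq : ∀ r ∈ e.2, r.2 = s.1 → r = q := fun r hr hrs =>
    g.isMat.snd_inj r hr q hq (hrs.trans hqs.symm)
  refine ⟨?_, ?_, ?_⟩
  · intro n hn
    rcases List.mem_cons.mp hn with rfl | hn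
    · refine ⟨⟨?_, ?_, ?_⟩, ?_, ?_, ?_, ?_⟩
      · intro r hr r' hr' e1
        rcases (hmem r).mp hr with rfl | ⟨hr, hrs⟩ <;> rcases (hmem r').mp hr' with rfl | ⟨hr', hrs'⟩
        · rfl
        · exact absurd e1.symm (g.unmatched r' hr')
        · exact absurd e1 (g.unmatched r hr)
        · exact g.isMat.fst_inj r hr r' hr' e1
      · intro r hr r' hr' e1
        rcases (hmem r).mp hr with rfl | ⟨hr, hrs⟩ <;> rcases (hmem r').mp hr' with rfl | ⟨hr', hrs'⟩
        · rfl
        · exact absurd e1.symm hrs'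
        · exact absurd e1 hrs
        · exact g.isMat.snd_inj r hr r' hr' e1
      · intro r hr
        rcases (hmem r).mp hr with rfl | ⟨hr, hrs⟩
        · exact ⟨s, hs, rfl, ho⟩
        · exact g.isMat.adj r hr
      · intro r hr
        rcases (hmem r).mp hr with rfl | ⟨hr, hrs⟩
        · exact fun h => g.unmatched q hq h.symm
        · intro h
          rw [g.isMat.fst_inj r hr q hq h] at hrs
          exact hrs hqs
      · intro x
        rw [← g.vars x]
        simp only [List.mem_map]
        constructor
        · rintro (⟨r, hr, rfl⟩ | rfl)
          · rcases (hmem r).mp hr with rfl | ⟨hr, hrs⟩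
            · exact Or.inr rfl
            · exact Or.inl ⟨r, hr, rfl⟩
          · exact Or.inl ⟨q, hq, rfl⟩
        · rintro (⟨r, hr, rfl⟩ | rfl)
          · by_cases hrs : r.2 = s.1
            · exact Or.inr (by rw [huniq r hr hrs])
            · exact Or.inl ⟨r, (hmem r).mpr (Or.inr ⟨hr, hrs⟩), rfl⟩
          · exact Or.inl ⟨_, (hmem _).mpr (Or.inl rfl), rfl⟩
      · intro j
        rw [← g.ids j]
        simp only [List.mem_map]
        constructor
        · rintro ⟨r, hr, rfl⟩
          rcases (hmem r).mp hr with rfl | ⟨hr, hrs⟩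
          · exact ⟨q, hq, hqs⟩
          · exact ⟨r, hr, rfl⟩
        · rintro ⟨r, hr, rfl⟩
          by_cases hrs : r.2 = s.1
          · exact ⟨(e.1, s.1), (hmem _).mpr (Or.inl rfl), hrs.symm⟩
          · exact ⟨r, (hmem r).mpr (Or.inr ⟨hr, hrs⟩), rfl⟩
      · intro r hr
        obtain ⟨h1, h2⟩ := hmono _ hr
        rw [← g.agree r h2, hmem]
        constructor
        · rintro (rfl | ⟨hr, -⟩)
          · exact absurd rfl (hev _ h2)
          · exact hr
        · intro hr
          exact Or.inr ⟨hr, fun hrs => h1 (by rw [huniq r hr hrs])⟩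
    · have g' := h.good n hn
      exact ⟨g'.isMat, g'.unmatched, g'.vars, g'.ids, fun r hr => g'.agree r (hmono _ hr).2⟩
  · exact List.nodup_cons.mpr ⟨hnotin, h.nodup⟩
  · exact List.mem_cons_of_mem _ h.start

theorem grow_cases (J : List Slot) (L : List (Name × Mat)) :
    (newEntries J L = [] ∧ grow J L = L) ∨ ∃ n ∈ newEntries J L, grow J L = n :: L := by
  unfold grow
  cases h : newEntries J L with
  | nil => exact Or.inl ⟨rfl, rfl⟩
  | cons n l => exact Or.inr ⟨n, List.mem_cons_self, rfl⟩

/-- A search that is saturated stays unchanged, and one that is not gains an entry in every round.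
-/
theorem GoodSearch.foldl_grow {J : List Slot} {M : Mat} {v : Name} (F : List Name)
    {L : List (Name × Mat)} (h : GoodSearch J M v L) :
    GoodSearch J M v (F.foldl (fun L _ => grow J L) L) ∧
    (newEntries J (F.foldl (fun L _ => grow J L) L) = [] ∨
      (F.foldl (fun L _ => grow J L) L).length = L.length + F.length) := by
  induction F generalizing L with
  | nil => exact ⟨h, Or.inr rfl⟩
  | cons x F ih =>
    rw [List.foldl_cons]
    rcases grow_cases J L with ⟨h1, h2⟩ | ⟨n, hn, h2⟩
    · have : ∀ F : List Name, F.foldl (fun L _ => grow J L) L = L := by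
        intro F
        induction F with
        | nil => rfl
        | cons x F ih => rw [List.foldl_cons, h2, ih]
      rw [h2, this]
      exact ⟨h, Or.inl h1⟩
    · rw [h2]
      obtain ⟨i1, i2⟩ := ih (h.cons hn)
      refine ⟨i1, i2.imp id fun h => ?_⟩
      rw [h, List.length_cons, List.length_cons]; omega

/-- One round per element of `V` suffices: otherwise the search would have found more distinct
variables of `V` than `V` has entries. -/
theorem reach_spec {J : List Slot} {V : List Name} {v : Name} {M : Mat} (hM : IsMat J M)
    (hv : v ∈ V) (hMV : ∀ q ∈ M, q.1 ∈ V) (hvM : ∀ q ∈ M, q.1 ≠ v) :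
    GoodSearch J M v (reach J V v M) ∧ newEntries J (reach J V v M) = [] := by
  have h0 : GoodSearch J M v [(v, M)] := by
    refine ⟨fun e he => ?_, by simp, by simp⟩
    rw [List.mem_singleton] at he
    subst he
    exact ⟨hM, hvM, fun _ => Iff.rfl, fun _ => Iff.rfl, fun _ _ => Iff.rfl⟩
  obtain ⟨h1, h2⟩ := h0.foldl_grow V
  refine ⟨h1, h2.resolve_right fun h => ?_⟩
  have hsub : (reach J V v M).map Prod.fst ⊆ V := by
    intro x hx
    obtain ⟨e, he, rfl⟩ := List.mem_map.mp hx
    rcases ((h1.good e he).vars e.1).mp (Or.inr rfl) with h | h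
    · obtain ⟨q, hq, hqe⟩ := List.mem_map.mp h
      exact hqe ▸ hMV q hq
    · exact h ▸ hv
  have := (List.subperm_of_subset h1.nodup hsub).length_le
  rw [List.length_map] at this
  change (V.foldl (fun L _ => grow J L) [(v, M)]).length ≤ _ at this
  rw [h, List.length_singleton] at this
  omega

/-- The invariant of the main loop, after processing the variables in `P`. -/
structure GoodState (S₀ : List Slot) (P : List Name) (S : Mat × List Slot × List Name) : Prop where
  isMat : IsMat S.2.1 S.1
  vars : ∀ x, (x ∈ S.1.map Prod.fst ∨ x ∈ S.2.2) ↔ x ∈ P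
  disj : ∀ q ∈ S.1, q.1 ∉ S.2.2
  slots : ∀ s, s ∈ S.2.1 ↔ s ∈ S₀ ∧ ∀ l ∈ s.2, l.1 ∉ S.2.2
  autark : ∃ β : Name → Bool, ∀ s ∈ S₀, (∃ l ∈ s.2, l.1 ∈ S.2.2) →
    ∃ l ∈ s.2, l.1 ∈ S.2.2 ∧ β l.1 = l.2

theorem mem_augments {J : List Slot} {L : List (Name × Mat)} {m : Mat} :
    m ∈ augments J L ↔ ∃ e ∈ L, ∃ s ∈ J, occurs e.1 s.2 = true ∧ (∀ q ∈ e.2, q.2 ≠ s.1) ∧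
      m = (e.1, s.1) :: e.2 := by
  simp only [augments, List.mem_flatMap, List.mem_filter, List.mem_map, Bool.and_eq_true,
    Bool.not_eq_true', List.any_eq_false, decide_eq_true_eq]
  constructor
  · rintro ⟨e, he, s, ⟨hs, ho, hq⟩, rfl⟩
    exact ⟨e, he, s, hs, ho, hq, rfl⟩
  · rintro ⟨e, he, s, hs, ho, hq, rfl⟩
    exact ⟨e, he, s, ⟨hs, ho, hq⟩, rfl⟩

/-- If some reached variable occurs in a clause that its matching does not use, adding it covers
`v`. Otherwise every remaining clause that meets the reached variables is matched by `M` to one of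
them; satisfying each such clause through its partner extends the autark assignment, and no other
matched pair is affected by the removal. -/
theorem GoodState.processVar {S₀ : List Slot} (hids : ∀ s ∈ S₀, ∀ s' ∈ S₀, s.1 = s'.1 → s = s')
    {V P : List Name} {S : Mat × List Slot × List Name} (h : GoodState S₀ P S) {v : Name}
    (hv : v ∈ V) (hPV : ∀ x ∈ P, x ∈ V) (hvP : v ∉ P) :
    GoodState S₀ (P ++ [v]) (processVar V S v) := by
  obtain ⟨M, J, D⟩ := S
  have hMP : ∀ q ∈ M, q.1 ∈ P := fun q hq => (h.vars q.1).mp (Or.inl (List.mem_map_of_mem hq))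
  have hDP : ∀ x ∈ D, x ∈ P := fun x hx => (h.vars x).mp (Or.inr hx)
  obtain ⟨hg, hclosed⟩ := reach_spec (V := V) h.isMat hv (fun q hq => hPV _ (hMP q hq))
    (fun q hq e => hvP (e ▸ hMP q hq))
  simp only [SatKernel.processVar]
  simp only at hg hclosed
  generalize reach J V v M = L at hg hclosed ⊢
  have hJ : ∀ s ∈ J, ∀ s' ∈ J, s.1 = s'.1 → s = s' := fun s hs s' hs' =>
    hids s ((h.slots s).mp hs).1 s' ((h.slots s').mp hs').1
  cases haug : augments J L with
  | cons m l =>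
    simp only [List.isEmpty_cons, cond_false, List.take_succ_cons, List.take_zero,
      List.flatMap_cons, List.flatMap_nil, List.append_nil]
    obtain ⟨e, he, s, hs, ho, hq, rfl⟩ := mem_augments.mp (haug ▸ List.mem_cons_self (a := m))
    have g := hg.good e he
    refine ⟨⟨?_, ?_, ?_⟩, ?_, ?_, h.slots, h.autark⟩
    · intro r hr r' hr' e1
      rcases List.mem_cons.mp hr with rfl | hr <;> rcases List.mem_cons.mp hr' with rfl | hr'
      · rfl
      · exact absurd e1.symm (g.unmatched r' hr')
      · exact absurd e1 (g.unmatched r hr)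
      · exact g.isMat.fst_inj r hr r' hr' e1
    · intro r hr r' hr' e1
      rcases List.mem_cons.mp hr with rfl | hr <;> rcases List.mem_cons.mp hr' with rfl | hr'
      · rfl
      · exact absurd e1.symm (hq r' hr')
      · exact absurd e1 (hq r hr)
      · exact g.isMat.snd_inj r hr r' hr' e1
    · intro r hr
      rcases List.mem_cons.mp hr with rfl | hr
      · exact ⟨s, hs, rfl, ho⟩
      · exact g.isMat.adj r hr
    · intro x
      have hx := g.vars x
      have hP := h.vars x
      simp only [List.map_cons, List.mem_cons, List.mem_append, List.not_mem_nil, or_false]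
        at hx hP ⊢
      rw [← hP]
      tauto
    · intro r hr hrD
      have : r.1 ∈ M.map Prod.fst ∨ r.1 = v := (g.vars r.1).mp (by
        rcases List.mem_cons.mp hr with rfl | hr
        · exact Or.inr rfl
        · exact Or.inl (List.mem_map_of_mem hr))
      rcases this with h1 | h1
      · obtain ⟨q, hq, hqr⟩ := List.mem_map.mp h1
        exact h.disj q hq (hqr ▸ hrD)
      · exact hvP (hDP v (h1 ▸ hrD))
  | nil =>
    simp only [List.isEmpty_nil, cond_true]
    have hR : ∀ x, x ∈ L.map Prod.fst → x ∈ M.map Prod.fst ∨ x = v := by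
      intro x hx
      obtain ⟨e, he, rfl⟩ := List.mem_map.mp hx
      exact ((hg.good e he).vars e.1).mp (Or.inr rfl)
    have hRD : ∀ x ∈ L.map Prod.fst, x ∉ D := by
      intro x hx hxD
      rcases hR x hx with h1 | rfl
      · obtain ⟨q, hq, rfl⟩ := List.mem_map.mp h1
        exact h.disj q hq hxD
      · exact hvP (hDP _ hxD)
    have hvis : ∀ x, visited L x = false ↔ x ∉ L.map Prod.fst := fun x => by
      rw [← visited_iff, Bool.not_eq_true]
    -- Every clause that meets a reached variable is matched to a reached variable
    have key : ∀ s ∈ J, ∀ l ∈ s.2, l.1 ∈ L.map Prod.fst →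
        ∃ q ∈ M, q.2 = s.1 ∧ q.1 ∈ L.map Prod.fst ∧ occurs q.1 s.2 = true := by
      intro s hs l hl hlL
      obtain ⟨e, he, hel⟩ := List.mem_map.mp hlL
      have g := hg.good e he
      have ho : occurs e.1 s.2 = true := occurs_iff.mpr ⟨l.2, by rw [hel]; exact hl⟩
      have h1 : ∃ q ∈ e.2, q.2 = s.1 := by
        by_contra hc
        push Not at hc
        have : (e.1, s.1) :: e.2 ∈ augments J L := mem_augments.mpr ⟨e, he, s, hs, ho, hc, rfl⟩
        rw [haug] at this
        simp at this
      obtain ⟨q, hq, hqs⟩ := h1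
      have h2 : q.1 ∈ L.map Prod.fst := by
        by_contra hc
        have := mem_newEntries.mpr ⟨e, he, s, hs, ho, q, hq, hqs, (hvis _).mpr hc, rfl⟩
        rw [hclosed] at this
        simp at this
      obtain ⟨q', hq', hqs'⟩ := List.mem_map.mp ((g.ids s.1).mp (List.mem_map.mpr ⟨q, hq, hqs⟩))
      refine ⟨q', hq', hqs', ?_, ?_⟩
      -- A pair of `M` with an unreached variable also belongs to the matching of `e`, where the
      -- clause already has the reached partner `q`.
      · by_contra hc
        have h3 := (g.agree q' ((hvis _).mpr hc)).mpr hq'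
        have := g.isMat.snd_inj q' h3 q hq (hqs'.trans hqs.symm)
        exact hc (this ▸ h2)
      · obtain ⟨s', hs', e1, e2⟩ := h.isMat.adj q' hq'
        rwa [hJ s' hs' s hs (e1.trans hqs')] at e2
    refine ⟨⟨?_, ?_, ?_⟩, ?_, ?_, ?_, ?_⟩
    · exact fun q hq q' hq' => h.isMat.fst_inj q (List.mem_filter.mp hq).1 q'
        (List.mem_filter.mp hq').1
    · exact fun q hq q' hq' => h.isMat.snd_inj q (List.mem_filter.mp hq).1 q'
        (List.mem_filter.mp hq').1
    · intro q hq
      obtain ⟨hq, hqv⟩ := List.mem_filter.mp hq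
      obtain ⟨s, hs, e1, e2⟩ := h.isMat.adj q hq
      refine ⟨s, List.mem_filter.mpr ⟨hs, ?_⟩, e1, e2⟩
      rw [Bool.not_eq_true', List.any_eq_false]
      intro l hl hlv
      obtain ⟨q', hq', e3, e4, -⟩ := key s hs l hl (visited_iff.mp hlv)
      have := h.isMat.snd_inj q' hq' q hq (e3.trans e1)
      subst this
      rw [visited_iff.mpr e4] at hqv
      simp at hqv
    · intro x
      have hP := h.vars x
      have hRx := hR x
      have hst := hg.start
      simp only [List.mem_append, List.mem_singleton]
      rw [← hP]
      constructor
      · rintro (h1 | h1 | h1)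
        · obtain ⟨q, hq, rfl⟩ := List.mem_map.mp h1
          exact Or.inl (Or.inl (List.mem_map_of_mem (List.mem_filter.mp hq).1))
        · rcases hRx h1 with h2 | h2
          · exact Or.inl (Or.inl h2)
          · exact Or.inr h2
        · exact Or.inl (Or.inr h1)
      · rintro ((h1 | h1) | rfl)
        · by_cases hx : x ∈ L.map Prod.fst
          · exact Or.inr (Or.inl hx)
          · obtain ⟨q, hq, rfl⟩ := List.mem_map.mp h1
            exact Or.inl (List.mem_map_of_mem (List.mem_filter.mpr ⟨hq, by
              rw [(hvis _).mpr hx]; rfl⟩))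
        · exact Or.inr (Or.inr h1)
        · exact Or.inr (Or.inl hst)
    · intro q hq
      obtain ⟨hq, hqv⟩ := List.mem_filter.mp hq
      rw [List.mem_append, not_or]
      refine ⟨fun hc => ?_, h.disj q hq⟩
      have : visited L q.1 = true := visited_iff.mpr hc
      rw [this] at hqv
      simp at hqv
    · intro s
      have hs := h.slots s
      simp only [List.mem_filter, Bool.not_eq_true', List.any_eq_false, Bool.not_eq_true, hvis,
        List.mem_append, not_or] at hs ⊢
      rw [hs]
      constructor
      · rintro ⟨⟨h1, h2⟩, h3⟩
        exact ⟨h1, fun l hl => ⟨h3 l hl, h2 l hl⟩⟩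
      · rintro ⟨h1, h2⟩
        exact ⟨⟨h1, fun l hl => (h2 l hl).2⟩, fun l hl => (h2 l hl).1⟩
    · obtain ⟨β, hβ⟩ := h.autark
      classical
      -- A matched variable takes the sign with which it occurs in its clause under `M`. The default
      -- matters only for unmatched variables such as `v`, on which no clause relies.
      let β' : Name → Bool := fun x =>
        if hx : ∃ b, ∃ s ∈ J, (x, s.1) ∈ M ∧ (x, b) ∈ s.2 then hx.choose else false
      refine ⟨fun x => if x ∈ L.map Prod.fst then β' x else β x, ?_⟩
      intro s hs hex
      by_cases hD : ∃ l ∈ s.2, l.1 ∈ D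
      · obtain ⟨l, hl, hlD, hlβ⟩ := hβ s hs hD
        refine ⟨l, hl, List.mem_append_right _ hlD, ?_⟩
        show (if l.1 ∈ L.map Prod.fst then β' l.1 else β l.1) = l.2
        rw [if_neg fun hc => hRD _ hc hlD]
        exact hlβ
      · have hsJ : s ∈ J := (h.slots s).mpr ⟨hs, fun l hl hlD => hD ⟨l, hl, hlD⟩⟩
        obtain ⟨l, hl, hlR⟩ := hex
        have hlR : l.1 ∈ L.map Prod.fst := by
          rcases List.mem_append.mp hlR with h1 | h1
          · exact h1
          · exact absurd ⟨l, hl, h1⟩ hD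
        obtain ⟨q, hq, hqs, hqR, ho⟩ := key s hsJ l hl hlR
        obtain ⟨b, hb⟩ := occurs_iff.mp ho
        have hx : ∃ b, ∃ s ∈ J, (q.1, s.1) ∈ M ∧ (q.1, b) ∈ s.2 :=
          ⟨b, s, hsJ, by rw [← hqs]; exact hq, hb⟩
        obtain ⟨s', hs', h1, h2⟩ := hx.choose_spec
        have e1 : s' = s := by
          refine hJ s' hs' s hsJ ?_
          have := h.isMat.fst_inj _ h1 q hq rfl
          rw [← hqs, ← this]
        subst e1
        refine ⟨_, h2, List.mem_append_left _ hqR, ?_⟩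
        simp only [if_pos hqR, β', dif_pos hx]

theorem matchVars_spec {S₀ : List Slot} (hids : ∀ s ∈ S₀, ∀ s' ∈ S₀, s.1 = s'.1 → s = s')
    {V : List Name} (hV : V.Nodup) : GoodState S₀ V (matchVars V S₀) := by
  have key : ∀ (Q P : List Name) (S : Mat × List Slot × List Name), V = P ++ Q →
      GoodState S₀ P S → GoodState S₀ V (Q.foldl (fun S v => processVar V S v) S) := by
    intro Q
    induction Q with
    | nil => intro P S h hS; simpa [h] using hS
    | cons v Q ih =>
      intro P S h hS
      rw [List.foldl_cons]
      refine ih (P ++ [v]) _ (by simp [h]) (hS.processVar hids (by simp [h])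
        (fun x hx => by simp [h, hx]) ?_)
      rw [h, List.nodup_append] at hV
      exact fun hv => hV.2.2 v hv v (by simp) rfl
  refine key V [] _ rfl ⟨⟨?_, ?_, ?_⟩, ?_, ?_, ?_, ⟨fun _ => true, ?_⟩⟩ <;> simp

/-! ### The matching is computed in polynomial time -/

@[fun_prop]
theorem PT.occurs {α : Type} [Enc α] {f : α → Name} {g : α → List Literal} (hf : PT f)
    (hg : PT g) : PT (fun a => occurs (f a) (g a)) := by
  unfold SatKernel.occurs
  fun_prop

@[fun_prop]
theorem PT.visited {α : Type} [Enc α] {f : α → List (Name × Mat)} {g : α → Name} (hf : PT f)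
    (hg : PT g) : PT (fun a => visited (f a) (g a)) := by
  unfold SatKernel.visited
  fun_prop

@[fun_prop]
theorem PT.newEntries {α : Type} [Enc α] {f : α → List Slot} {g : α → List (Name × Mat)}
    (hf : PT f) (hg : PT g) : PT (fun a => newEntries (f a) (g a)) := by
  unfold SatKernel.newEntries
  fun_prop

@[fun_prop]
theorem PT.augments {α : Type} [Enc α] {f : α → List Slot} {g : α → List (Name × Mat)}
    (hf : PT f) (hg : PT g) : PT (fun a => augments (f a) (g a)) := by
  unfold SatKernel.augments
  fun_prop

@[fun_prop]
theorem PT.take_one {α β : Type} [Enc α] [Enc β] {f : α → List β} (hf : PT f) :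
    PT (fun a => (f a).take 1) := PT.takeOne.comp hf

@[fun_prop]
theorem PT.grow {α : Type} [Enc α] {f : α → List Slot} {g : α → List (Name × Mat)}
    (hf : PT f) (hg : PT g) : PT (fun a => grow (f a) (g a)) := by
  unfold SatKernel.grow
  fun_prop

/-- A bound for the length of a matching and for the sizes of its members. -/
def MatBound (B n : ℕ) (M : Mat) : Prop :=
  M.length ≤ n ∧ ∀ q ∈ M, sz q.1 ≤ B ∧ sz q.2 ≤ B

theorem MatBound.sz_le {B n : ℕ} {M : Mat} (h : MatBound B n M) :
    sz M ≤ n * (2 * B + 2) + 1 := by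
  refine (sz_le_length_mul M (2 * B + 1) fun q hq => ?_).trans ?_
  · have := h.2 q hq
    rw [show q = (q.1, q.2) from rfl, sz_pair]
    omega
  · exact Nat.add_le_add_right (Nat.mul_le_mul_right (2 * B + 2) h.1) 1

/-- A new entry exchanges one matched pair for another, so its matching is not longer than the one
it comes from. -/
theorem grow_bound {B n : ℕ} {J : List Slot} (hJ : ∀ s ∈ J, sz s.1 ≤ B)
    {L : List (Name × Mat)} (hL : ∀ e ∈ L, sz e.1 ≤ B ∧ MatBound B n e.2) :
    (∀ e ∈ grow J L, sz e.1 ≤ B ∧ MatBound B n e.2) ∧ (grow J L).length ≤ L.length + 1 := by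
  rcases grow_cases J L with ⟨-, h⟩ | ⟨m, hm, h⟩
  · rw [h]; exact ⟨hL, by omega⟩
  · rw [h]
    refine ⟨fun e he => ?_, le_rfl⟩
    rcases List.mem_cons.mp he with rfl | he
    · obtain ⟨e', he', s, hs, -, q, hq, hqs, -, rfl⟩ := mem_newEntries.mp hm
      obtain ⟨h1, h2, h3⟩ := hL e' he'
      refine ⟨(h3 q hq).1, ?_, ?_⟩
      · have : (e'.2.filter fun r => !decide (r.2 = s.1)).length < e'.2.length :=
          List.length_filter_lt_length_iff_exists.mpr ⟨q, hq, by simp [hqs]⟩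
        simp only [List.length_cons]
        omega
      · intro r hr
        rcases List.mem_cons.mp hr with rfl | hr
        · exact ⟨h1, hJ s hs⟩
        · exact h3 r (List.mem_filter.mp hr).1
    · exact hL e he

theorem foldl_grow_bound {B n : ℕ} {J : List Slot} (hJ : ∀ s ∈ J, sz s.1 ≤ B) (F : List Name)
    {L : List (Name × Mat)} (hL : ∀ e ∈ L, sz e.1 ≤ B ∧ MatBound B n e.2) :
    (∀ e ∈ F.foldl (fun L _ => grow J L) L, sz e.1 ≤ B ∧ MatBound B n e.2) ∧
      (F.foldl (fun L _ => grow J L) L).length ≤ L.length + F.length := by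
  induction F generalizing L with
  | nil => exact ⟨hL, le_rfl⟩
  | cons x F ih =>
    obtain ⟨h1, h2⟩ := grow_bound hJ hL
    obtain ⟨h3, h4⟩ := ih h1
    refine ⟨h3, ?_⟩
    rw [List.foldl_cons, List.length_cons]
    omega

theorem sz_search_le {B n m : ℕ} {L : List (Name × Mat)}
    (hL : ∀ e ∈ L, sz e.1 ≤ B ∧ MatBound B n e.2) (hm : L.length ≤ m) :
    sz L ≤ m * (B + (n * (2 * B + 2) + 1) + 2) + 1 := by
  refine (sz_le_length_mul L (B + (n * (2 * B + 2) + 1) + 1) fun e he => ?_).trans ?_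
  · have h1 := (hL e he).1
    have h2 := (hL e he).2.sz_le
    rw [show e = (e.1, e.2) from rfl, sz_pair]
    omega
  · exact Nat.add_le_add_right (Nat.mul_le_mul_right (B + (n * (2 * B + 2) + 1) + 2) hm) 1

/-- The state of the main loop, together with all variables and with the next variable. -/
abbrev SearchInput : Type := List Name × (Mat × List Slot × List Name) × Name

/-- A new entry copies a matching from the current list, so its size is not bounded in terms of the
input for arbitrary states. Hence the invariant of `foldl_grow_bound` is fed into
`PT.foldl_of_bound`. -/
theorem PT.reach : PT (fun p : SearchInput => reach p.2.1.2.1 p.1 p.2.2 p.2.1.1) := by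
  unfold SatKernel.reach
  refine PT.foldl_of_bound (l := fun p : SearchInput => p.1)
    (init := fun p : SearchInput => [(p.2.2, p.2.1.1)])
    (step := fun p L _ => SatKernel.grow p.2.1.2.1 L) (by fun_prop) (by fun_prop) (by fun_prop)
    ⟨(Polynomial.X + 1) * (Polynomial.X + (Polynomial.X * (2 * Polynomial.X + 2) + 1) + 2) + 1, ?_⟩
  rintro ⟨V, ⟨M, J, D⟩, v⟩ l₁ l₂ h
  simp only at h
  subst h
  set B := sz ((l₁ ++ l₂, (M, J, D), v) : SearchInput) with hB
  have e1 := length_lt_sz (l₁ ++ l₂)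
  rw [List.length_append] at e1
  simp only [sz_pair] at hB
  have e2 := length_lt_sz M
  obtain ⟨h1, h2⟩ := foldl_grow_bound (B := B) (n := B) (J := J) (L := [(v, M)])
    (fun s hs => by
      have := sz_le_of_mem hs
      rw [show s = (s.1, s.2) from rfl, sz_pair] at this
      omega) l₁ (fun e he => by
      rw [List.mem_singleton] at he
      subst he
      refine ⟨by simp only; omega, by simp only; omega, fun q hq => ?_⟩
      have := sz_le_of_mem (l := M) hq
      rw [show q = (q.1, q.2) from rfl, sz_pair] at this
      omega)
  refine (sz_search_le h1 (m := B + 1) (h2.trans ?_)).trans (le_of_eq ?_)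
  · simp only [List.length_singleton]; omega
  · simp

theorem PT.processVar :
    PT (fun p : SearchInput => processVar p.1 p.2.1 p.2.2) := by
  have h1 : PT (fun q : SearchInput × List (Name × Mat) =>
      bif (SatKernel.augments q.1.2.1.2.1 q.2).isEmpty then
        (q.1.2.1.1.filter fun r => !SatKernel.visited q.2 r.1,
          q.1.2.1.2.1.filter fun s => !s.2.any fun l => SatKernel.visited q.2 l.1,
          q.2.map (fun e => e.1) ++ q.1.2.1.2.2)
      else (((SatKernel.augments q.1.2.1.2.1 q.2).take 1).flatMap fun m => m, q.1.2.1.2.1,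
        q.1.2.1.2.2)) := by
    fun_prop
  exact h1.comp (PT.id.prodMk PT.reach)

/-- A bound for the state of the main loop. -/
structure StateBound (B n m k : ℕ) (J₀ : List Slot) (S : Mat × List Slot × List Name) : Prop where
  mat : MatBound B n S.1
  slots : S.2.1.Sublist J₀
  length_le : S.2.2.length ≤ k * m
  vars : ∀ x ∈ S.2.2, sz x ≤ B

/-- For each variable the matching gains at most one pair, the removed list at most `V.length + 1`
names, and clauses only disappear. -/
theorem StateBound.processVar {B n k : ℕ} {V : List Name} {J₀ : List Slot}
    {S : Mat × List Slot × List Name} {v : Name} (hJ : ∀ s ∈ J₀, sz s.1 ≤ B) (hv : sz v ≤ B)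
    (h : StateBound B n (V.length + 1) k J₀ S) :
    StateBound B (n + 1) (V.length + 1) (k + 1) J₀ (processVar V S v) := by
  obtain ⟨M, J, D⟩ := S
  have hJ' : ∀ s ∈ J, sz s.1 ≤ B := fun s hs => hJ s (h.slots.subset hs)
  obtain ⟨h1, h2⟩ := foldl_grow_bound hJ' V (L := [(v, M)]) (n := n) (fun e he => by
    rw [List.mem_singleton] at he
    subst he
    exact ⟨hv, h.mat⟩)
  simp only [SatKernel.processVar]
  change ∀ e ∈ reach J V v M, _ at h1
  change (reach J V v M).length ≤ _ at h2
  generalize reach J V v M = L at h1 h2 ⊢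
  rw [List.length_singleton] at h2
  cases haug : augments J L with
  | cons m l =>
    simp only [List.isEmpty_cons, cond_false, List.take_succ_cons, List.take_zero,
      List.flatMap_cons, List.flatMap_nil, List.append_nil]
    obtain ⟨e, he, s, hs, ho, hq, rfl⟩ := mem_augments.mp (haug ▸ List.mem_cons_self (a := m))
    refine ⟨⟨?_, ?_⟩, h.slots, h.length_le.trans (Nat.mul_le_mul_right _ (by omega)), h.vars⟩
    · have := (h1 e he).2.1
      simp only [List.length_cons]
      omega
    · intro r hr
      rcases List.mem_cons.mp hr with rfl | hr
      · exact ⟨(h1 e he).1, hJ' s hs⟩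
      · exact (h1 e he).2.2 r hr
  | nil =>
    simp only [List.isEmpty_nil, cond_true]
    refine ⟨⟨?_, fun q hq => h.mat.2 q (List.mem_filter.mp hq).1⟩,
      List.filter_sublist.trans h.slots, ?_, ?_⟩
    · have := List.length_filter_le (fun q : Name × ℕ => !visited L q.1) M
      have := h.mat.1
      simp only at this ⊢
      omega
    · have := h.length_le
      simp only [List.length_append, List.length_map] at this ⊢
      nlinarith
    · intro x hx
      rcases List.mem_append.mp hx with hx | hx
      · obtain ⟨e, he, rfl⟩ := List.mem_map.mp hx
        exact (h1 e he).1
      · exact h.vars x hx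

theorem sz_le_of_sublist {α : Type} [Enc α] {l l' : List α} (h : l.Sublist l') : sz l ≤ sz l' := by
  induction h with
  | slnil => exact le_rfl
  | cons a _ ih => rw [sz_cons]; omega
  | cons_cons a _ ih => rw [sz_cons, sz_cons]; omega

theorem PT.matchVars : PT (fun p : List Name × List Slot => matchVars p.1 p.2) := by
  unfold SatKernel.matchVars
  have hp : PT (fun q : (List Name × List Slot) × (Mat × List Slot × List Name) × Name =>
      SatKernel.processVar q.1.1 q.2.1 q.2.2) :=
    PT.processVar.comp (f := fun q : (List Name × List Slot) × (Mat × List Slot × List Name) ×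
      Name => (q.1.1, q.2.1, q.2.2)) (by fun_prop)
  refine PT.foldl_of_bound (l := fun p : List Name × List Slot => p.1)
    (init := fun p : List Name × List Slot => (([], p.2, []) : Mat × List Slot × List Name))
    (step := fun p S v => SatKernel.processVar p.1 S v) (by fun_prop) (by fun_prop) hp
    ⟨Polynomial.X * (2 * Polynomial.X + 2) + Polynomial.X +
      Polynomial.X * Polynomial.X * (Polynomial.X + 1) + 4, ?_⟩
  rintro ⟨V, J₀⟩ l₁ l₂ h
  simp only at h
  set B := sz ((V, J₀) : List Name × List Slot) with hB
  rw [sz_pair] at hB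
  have key : ∀ (l : List Name) (S : Mat × List Slot × List Name) (k : ℕ),
      (∀ x ∈ l, sz x ≤ B) → StateBound B k (V.length + 1) k J₀ S →
      StateBound B (k + l.length) (V.length + 1) (k + l.length) J₀
        (l.foldl (fun S v => SatKernel.processVar V S v) S) := by
    intro l
    induction l with
    | nil => intro S k _ h; exact h
    | cons x l ih =>
      intro S k hl hS
      have := ih _ (k + 1) (fun y hy => hl y (List.mem_cons_of_mem _ hy))
        (hS.processVar (v := x) (fun s hs => by
          have := sz_le_of_mem hs
          rw [show s = (s.1, s.2) from rfl, sz_pair] at this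
          omega) (hl x List.mem_cons_self))
      rwa [List.length_cons, Nat.add_comm l.length 1, ← Nat.add_assoc]
  have hs := key l₁ ([], J₀, []) 0 (fun x hx => by
    have := sz_le_of_mem (l := V) (a := x) (by rw [h]; exact List.mem_append_left _ hx)
    omega) ⟨⟨by simp, by simp⟩, List.Sublist.refl _, by simp, by simp⟩
  rw [Nat.zero_add] at hs
  generalize l₁.foldl (fun S v => SatKernel.processVar V S v) ([], J₀, []) = S at hs ⊢
  obtain ⟨M, J, D⟩ := S
  have h1 := hs.mat.sz_le
  have h2 := sz_le_of_sublist hs.slots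
  have h3 := sz_le_length_mul D B hs.vars
  have h4 : l₁.length ≤ B ∧ V.length + 1 ≤ B := by
    have := length_lt_sz V
    have h' := congrArg List.length h
    rw [List.length_append] at h'
    omega
  have h5 := hs.length_le.trans (Nat.mul_le_mul h4.1 h4.2)
  have h6 := Nat.mul_le_mul_right (2 * B + 2) h4.1
  have h7 := Nat.mul_le_mul_right (B + 1) h5
  simp only [Polynomial.eval_add, Polynomial.eval_mul, Polynomial.eval_X, Polynomial.eval_ofNat,
    Polynomial.eval_one, sz_pair]
  simp only at h1 h2 h3 h7
  omega

/-! ### Reduced formulas -/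

/-- The clauses, numbered by their positions. -/
def label (C : List (List Literal)) : List Slot :=
  C.foldl (fun acc c => acc ++ [(acc.length, c)]) []

theorem label_append (C : List (List Literal)) (c : List Literal) :
    label (C ++ [c]) = label C ++ [((label C).length, c)] := by
  simp [label]

theorem length_label (C : List (List Literal)) : (label C).length = C.length := by
  induction C using List.reverseRecOn with
  | nil => rfl
  | append_singleton C c ih => rw [label_append, List.length_append, List.length_append, ih]; rfl

theorem mem_label {C : List (List Literal)} {s : Slot} : s ∈ label C ↔ C[s.1]? = some s.2 := by
  induction C using List.reverseRecOn with
  | nil => simp [label]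
  | append_singleton C c ih =>
    obtain ⟨i, d⟩ := s
    rw [label_append, List.mem_append, ih, List.mem_singleton, length_label, List.getElem?_append]
    simp only [Prod.mk.injEq]
    rcases lt_trichotomy i C.length with h | rfl | h
    · rw [if_pos h]
      exact or_iff_left fun hc => h.ne hc.1
    · simp [eq_comm]
    · rw [if_neg h.not_gt, List.getElem?_eq_none h.le, List.getElem?_eq_none (by simp; omega)]
      simp [h.ne']

/-- The name is in the list. -/
def memb (D : List Name) (x : Name) : Bool := D.any fun y => decide (y = x)

theorem memb_iff {D : List Name} {x : Name} : memb D x = true ↔ x ∈ D := by simp [memb]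

/-- The clause contains a variable from the list. -/
def touches (D : List Name) (c : List Literal) : Bool := c.any fun l => memb D l.1

theorem touches_iff {D : List Name} {c : List Literal} :
    touches D c = true ↔ ∃ l ∈ c, l.1 ∈ D := by simp [touches, memb_iff]

/-- Replace each clause that contains a variable from `D` by a fixed unit clause. -/
def reduceClauses (D : List Name) (C : List (List Literal)) : List (List Literal) :=
  C.map fun c => bif touches D c then (D.take 1).map fun y => (y, true) else c

/-- The variables of the reduced formula. -/
def reduceVars (D V : List Name) (C : List (List Literal)) : List Name :=
  (bif C.any fun c => touches D c then D.take 1 else []) ++ V.filter fun x => !memb D x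

/-- The variables that are removed by the matching algorithm. -/
def removed (V : List Name) (C : List (List Literal)) : List Name :=
  (matchVars V (label C)).2.2

section Reduced

variable {V : List Name} {C : List (List Literal)}

theorem label_inj : ∀ s ∈ label C, ∀ s' ∈ label C, s.1 = s'.1 → s = s' := by
  intro s hs s' hs' h
  rw [mem_label] at hs hs'
  rw [h, hs'] at hs
  exact Prod.ext h (Option.some.inj hs).symm

theorem exists_head_of_touches {D : List Name} {c : List Literal} (h : touches D c = true) :
    ∃ y ∈ D, D.take 1 = [y] := by
  obtain ⟨l, -, hl⟩ := touches_iff.mp h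
  cases D with
  | nil => simp at hl
  | cons y D => exact ⟨y, List.mem_cons_self, rfl⟩

theorem mem_reduceVars {D : List Name} {x : Name} :
    x ∈ reduceVars D V C ↔
      ((∃ c ∈ C, touches D c = true) ∧ x ∈ D.take 1) ∨ (x ∈ V ∧ x ∉ D) := by
  have h : (memb D x = false) ↔ x ∉ D := by rw [← memb_iff, Bool.not_eq_true]
  simp only [reduceVars, List.mem_append, List.mem_filter, Bool.not_eq_true', h]
  cases hC : C.any fun c => touches D c with
  | true =>
    have : ∃ c ∈ C, touches D c = true := List.any_eq_true.mp hC
    simp [this]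
  | false =>
    have : ¬ ∃ c ∈ C, touches D c = true := fun h => by
      rw [← List.any_eq_true, hC] at h; cases h
    simp [this]

theorem nodup_reduceVars (D : List Name) (hV : V.Nodup) : (reduceVars D V C).Nodup := by
  refine List.nodup_append.mpr ⟨?_, hV.filter _, ?_⟩
  · cases C.any fun c => touches D c <;> cases D <;> simp
  · rintro x hx y hy rfl
    have h : (memb D x = false) ↔ x ∉ D := by rw [← memb_iff, Bool.not_eq_true]
    simp only [List.mem_filter, Bool.not_eq_true', h] at hy
    cases hC : C.any fun c => touches D c <;> rw [hC] at hx
    · simp at hx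
    · exact hy.2 (List.mem_of_mem_take hx)

theorem mem_reduceClauses {D : List Name} {c : List Literal} :
    c ∈ reduceClauses D C ↔ (c ∈ C ∧ touches D c = false) ∨
      ∃ c' ∈ C, touches D c' = true ∧ ∃ y ∈ D, D.take 1 = [y] ∧ c = [(y, true)] := by
  simp only [reduceClauses, List.mem_map]
  constructor
  · rintro ⟨c', hc', rfl⟩
    cases h : touches D c' with
    | false => exact Or.inl ⟨hc', by simpa using h⟩
    | true =>
      obtain ⟨y, hy, hD⟩ := exists_head_of_touches h
      exact Or.inr ⟨c', hc', h, y, hy, hD, by simp [hD]⟩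
  · rintro (⟨hc, h⟩ | ⟨c', hc', h, y, -, hD, rfl⟩)
    · exact ⟨c, hc, by rw [h]; rfl⟩
    · exact ⟨c', hc', by rw [h, hD]; rfl⟩

theorem ne_nil_of_mem_reduceClauses {D : List Name} (hne : ∀ c ∈ C, c ≠ []) :
    ∀ c ∈ reduceClauses D C, c ≠ [] := by
  intro c hc
  rcases mem_reduceClauses.mp hc with ⟨h, -⟩ | ⟨-, -, -, y, -, -, rfl⟩
  · exact hne c h
  · simp

theorem mem_reduceVars_of_mem {D : List Name} (hV : ∀ c ∈ C, ∀ l ∈ c, l.1 ∈ V) :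
    ∀ c ∈ reduceClauses D C, ∀ l ∈ c, l.1 ∈ reduceVars D V C := by
  intro c hc l hl
  rw [mem_reduceVars]
  rcases mem_reduceClauses.mp hc with ⟨h, ht⟩ | ⟨c', hc', ht, y, -, hD, rfl⟩
  · refine Or.inr ⟨hV c h l hl, fun hx => ?_⟩
    rw [touches_iff.mpr ⟨l, hl, hx⟩] at ht
    cases ht
  · rw [List.mem_singleton] at hl
    subst hl
    exact Or.inl ⟨⟨c', hc', ht⟩, by simp [hD]⟩

/-- A negative unit clause on the representative would contain a variable from `D` and would itself
have been replaced. -/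
theorem listUCF_reduceClauses {D : List Name} (hC : ListUCF C) : ListUCF (reduceClauses D C) := by
  rintro x ⟨⟨c, hc, h⟩, c', hc', h'⟩
  rcases mem_reduceClauses.mp hc' with ⟨hc', ht'⟩ | ⟨-, -, -, y, -, -, rfl⟩
  · rcases mem_reduceClauses.mp hc with ⟨hc, -⟩ | ⟨-, -, -, y, hy, -, rfl⟩
    · exact hC x ⟨⟨c, hc, h⟩, c', hc', h'⟩
    · have : y = x := by simpa using h
      have hx : (x, false) ∈ c' := by rw [← List.mem_toFinset, h']; simp
      rw [touches_iff.mpr ⟨_, hx, this ▸ hy⟩] at ht'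
      cases ht'
  · simp at h'

/-- Making the representative true satisfies all replaced clauses, and the clauses that are kept do
not contain it. -/
theorem satCount_le_satCount_reduceClauses {D : List Name} (A : Name → Bool) :
    satCount A C ≤ satCount (fun x => memb (D.take 1) x || A x) (reduceClauses D C) := by
  unfold satCount reduceClauses
  rw [List.countP_map]
  refine List.countP_mono_left fun c _ h => ?_
  rw [Function.comp_apply]
  cases ht : touches D c with
  | true =>
    obtain ⟨y, -, hD⟩ := exists_head_of_touches ht
    simp [hD, memb]
  | false =>
    obtain ⟨l, hl, hA⟩ := List.any_eq_true.mp h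
    refine List.any_eq_true.mpr ⟨l, hl, ?_⟩
    have : memb (D.take 1) l.1 = false := by
      rw [← Bool.not_eq_true, memb_iff]
      intro hx
      rw [touches_iff.mpr ⟨l, hl, List.mem_of_mem_take hx⟩] at ht
      cases ht
    simpa [this] using hA

/-- For the way back to the original formula, the autark assignment on the removed variables
satisfies every replaced clause, and the clauses that are kept do not see it. -/
theorem exists_satCount_reduceClauses_iff (hV : V.Nodup) (s : ℕ) :
    (∃ A, s ≤ satCount A (reduceClauses (removed V C) C)) ↔ ∃ A, s ≤ satCount A C := by
  constructor
  · rintro ⟨A, hA⟩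
    obtain ⟨β, hβ⟩ := (matchVars_spec (S₀ := label C) label_inj hV).autark
    change ∀ s ∈ label C, (∃ l ∈ s.2, l.1 ∈ removed V C) →
      ∃ l ∈ s.2, l.1 ∈ removed V C ∧ β l.1 = l.2 at hβ
    refine ⟨fun x => bif memb (removed V C) x then β x else A x, hA.trans ?_⟩
    unfold satCount reduceClauses
    rw [List.countP_map]
    refine List.countP_mono_left fun c hc h => ?_
    rw [Function.comp_apply] at h
    refine List.any_eq_true.mpr ?_
    cases ht : touches (removed V C) c with
    | true =>
      obtain ⟨i, hi⟩ := List.mem_iff_getElem?.mp hc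
      obtain ⟨l, hl, hD, hb⟩ := hβ (i, c) (mem_label.mpr hi) (touches_iff.mp ht)
      exact ⟨l, hl, by simp [memb_iff.mpr hD, hb]⟩
    | false =>
      rw [ht, cond_false] at h
      obtain ⟨l, hl, hA⟩ := List.any_eq_true.mp h
      refine ⟨l, hl, ?_⟩
      have : memb (removed V C) l.1 = false := by
        rw [← Bool.not_eq_true, memb_iff]
        intro hx
        rw [touches_iff.mpr ⟨l, hl, hx⟩] at ht
        cases ht
      simpa [this] using hA
  · rintro ⟨A, hA⟩
    exact ⟨_, hA.trans (satCount_le_satCount_reduceClauses A)⟩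

/-- The reduced formula is matched: a kept variable has its partner from the matching, which is an
untouched clause, and the representative gets one of the replaced clauses. It counts as a variable
only if such a clause exists. -/
theorem exists_satCount_reduceClauses_ge {φ : ℝ} (hsq : φ ^ 2 + φ = 1) (h1 : 1 / 2 ≤ φ)
    (h2 : φ ≤ 2 / 3) (hnd : V.Nodup) (hne : ∀ c ∈ C, c ≠ [])
    (hV : ∀ c ∈ C, ∀ l ∈ c, l.1 ∈ V) (hucf : ListUCF C) :
    ∃ A, φ * C.length + (2 - 3 * φ) / 2 * (reduceVars (removed V C) V C).length ≤
      satCount A (reduceClauses (removed V C) C) := by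
  have g := matchVars_spec (S₀ := label C) label_inj hnd
  change GoodState (label C) V ((matchVars V (label C)).1, (matchVars V (label C)).2.1,
    removed V C) at g
  have hb := nodup_reduceVars (V := V) (C := C) (removed V C) hnd
  have hd := ne_nil_of_mem_reduceClauses (D := removed V C) hne
  have he := mem_reduceVars_of_mem (D := removed V C) hV
  have hf := listUCF_reduceClauses (D := removed V C) hucf
  generalize hD : removed V C = D at *
  generalize (matchVars V (label C)).1 = M at g
  generalize (matchVars V (label C)).2.1 = J at g
  have hex : ∀ x ∈ reduceVars D V C, ∃ i c, C[i]? = some c ∧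
      ((x ∈ D.take 1 ∧ touches D c = true) ∨
        (x ∉ D ∧ (x, i) ∈ M ∧ touches D c = false ∧ occurs x c = true)) := by
    intro x hx
    rcases mem_reduceVars.mp hx with ⟨⟨c, hc, ht⟩, hx⟩ | ⟨hx, hxD⟩
    · obtain ⟨i, hi⟩ := List.mem_iff_getElem?.mp hc
      exact ⟨i, c, hi, Or.inl ⟨hx, ht⟩⟩
    · obtain ⟨q, hq, rfl⟩ := List.mem_map.mp (((g.vars x).mpr hx).resolve_right hxD)
      obtain ⟨s, hs, e1, e2⟩ := g.isMat.adj q hq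
      obtain ⟨h3, h4⟩ := (g.slots s).mp hs
      refine ⟨q.2, s.2, e1 ▸ mem_label.mp h3, Or.inr ⟨hxD, hq, ?_, e2⟩⟩
      rw [← Bool.not_eq_true, touches_iff]
      rintro ⟨l, hl, hlD⟩
      exact h4 l hl hlD
  classical
  let μ : Name → ℕ := fun x => if hx : x ∈ reduceVars D V C then (hex x hx).choose else 0
  have hμ : ∀ x ∈ reduceVars D V C, ∃ c, C[μ x]? = some c ∧
      ((x ∈ D.take 1 ∧ touches D c = true) ∨
        (x ∉ D ∧ (x, μ x) ∈ M ∧ touches D c = false ∧ occurs x c = true)) := by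
    intro x hx
    have := (hex x hx).choose_spec
    simpa only [μ, dif_pos hx] using this
  have := exists_satCount_ge hsq h1 h2 (reduceVars D V C) (reduceClauses D C) hb hd he hf μ
    (fun x hx y hy hxy => by
      obtain ⟨c, hc, h⟩ := hμ x hx
      obtain ⟨c', hc', h'⟩ := hμ y hy
      rw [← hxy, hc] at hc'
      cases hc'
      rcases h with ⟨h, ht⟩ | ⟨-, h, ht, -⟩ <;> rcases h' with ⟨h', ht'⟩ | ⟨-, h', ht', -⟩
      · obtain ⟨z, -, hz⟩ := exists_head_of_touches ht
        rw [hz, List.mem_singleton] at h h'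
        rw [h, h']
      · rw [ht] at ht'; cases ht'
      · rw [ht] at ht'; cases ht'
      · exact congrArg Prod.fst (g.isMat.snd_inj _ h _ h' hxy))
    (fun x hx => by
      obtain ⟨c, hc, h⟩ := hμ x hx
      have hc' : (reduceClauses D C)[μ x]? =
          some (bif touches D c then (D.take 1).map fun y => (y, true) else c) := by
        rw [reduceClauses, List.getElem?_map, hc]; rfl
      refine ⟨_, hc', ?_⟩
      rcases h with ⟨h, ht⟩ | ⟨-, -, ht, ho⟩
      · rw [ht]
        exact ⟨true, List.mem_map.mpr ⟨x, h, rfl⟩⟩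
      · rw [ht]
        exact occurs_iff.mp ho)
  rwa [show (reduceClauses D C).length = C.length from List.length_map _] at this

end Reduced

/-! ### The reduced formula is computed in polynomial time -/

theorem PT.label : PT (fun C : List (List Literal) => label C) := by
  unfold SatKernel.label
  refine PT.foldl_of_bound (l := fun C : List (List Literal) => C) (init := fun _ => [])
    (step := fun _ acc c => acc ++ [(acc.length, c)]) (by fun_prop) (by fun_prop) ?_ ?_
  · have : PT (fun p : List (List Literal) × List Slot × List Literal =>
        [(p.2.1.length, p.2.2)]) :=
      PT.cons (PT.prodMk (PT.length.comp (f := fun p : List (List Literal) × List Slot ×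
        List Literal => p.2.1) (by fun_prop)) (by fun_prop)) (by fun_prop)
    fun_prop
  · refine ⟨Polynomial.X * (3 * Polynomial.X + 3) + 1, fun C l₁ l₂ h => ?_⟩
    change sz (SatKernel.label l₁) ≤ _
    have h1 : l₁.length ≤ sz C ∧ sz l₁ ≤ sz C := by
      have := length_lt_sz l₁
      have := sz_append l₁ l₂
      have := one_le_sz l₂
      rw [h]
      omega
    refine (sz_le_length_mul _ (3 * sz C + 2) fun s hs => ?_).trans ?_
    · rw [mem_label] at hs
      have h2 := (List.getElem?_eq_some_iff.mp hs).1
      have h3 := sz_le_of_mem (List.mem_of_getElem? hs)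
      rw [show s = (s.1, s.2) from rfl, sz_pair, sz_nat]
      omega
    · rw [length_label]
      simp only [Polynomial.eval_add, Polynomial.eval_mul, Polynomial.eval_X,
        Polynomial.eval_ofNat, Polynomial.eval_one]
      exact Nat.add_le_add_right (Nat.mul_le_mul_right _ h1.1) 1

@[fun_prop]
theorem PT.memb {α : Type} [Enc α] {f : α → List Name} {g : α → Name} (hf : PT f) (hg : PT g) :
    PT (fun a => memb (f a) (g a)) := by
  unfold SatKernel.memb
  fun_prop

@[fun_prop]
theorem PT.touches {α : Type} [Enc α] {f : α → List Name} {g : α → List Literal} (hf : PT f)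
    (hg : PT g) : PT (fun a => touches (f a) (g a)) := by
  unfold SatKernel.touches
  fun_prop

@[fun_prop]
theorem PT.removed {α : Type} [Enc α] {f : α → List Name} {g : α → List (List Literal)}
    (hf : PT f) (hg : PT g) : PT (fun a => removed (f a) (g a)) := by
  have : PT (fun a => (f a, SatKernel.label (g a))) := hf.prodMk (PT.label.comp hg)
  exact (PT.snd.comp PT.snd).comp (PT.matchVars.comp this)

@[fun_prop]
theorem PT.reduceClauses {α : Type} [Enc α] {f : α → List Name} {g : α → List (List Literal)}
    (hf : PT f) (hg : PT g) : PT (fun a => reduceClauses (f a) (g a)) := by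
  unfold SatKernel.reduceClauses
  fun_prop

@[fun_prop]
theorem PT.reduceVars {α : Type} [Enc α] {e f : α → List Name} {g : α → List (List Literal)}
    (he : PT e) (hf : PT f) (hg : PT g) : PT (fun a => reduceVars (e a) (f a) (g a)) := by
  unfold SatKernel.reduceVars
  fun_prop

/-! ### Reading formulas -/

/-- The state of the parser: the current name, the literals of the current clause, the clauses and
the variables. The string is read from right to left. -/
def parseStep (a : Fin 6) (s : Name × List Literal × List (List Literal) × List Name) :
    Name × List Literal × List (List Literal) × List Name :=
  bif decide (a = 0) then (false :: s.1, s.2)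
  else bif decide (a = 1) then (true :: s.1, s.2)
  else bif decide (a = 2) then ([], s.2.1, s.2.2.1, s.1 :: s.2.2.2)
  else bif decide (a = 3) then ([], [], s.2.1 :: s.2.2.1, s.2.2.2)
  else ([], (s.1, decide (a = 4)) :: s.2.1, s.2.2)

/-- Variables and clauses of the formula that is written in the string. -/
def parse (w : List (Fin 6)) : List Name × List (List Literal) :=
  (fun s => (s.2.2.2, s.2.2.1)) (w.foldr parseStep ([], [], [], []))

theorem foldr_parseStep_writeName (x : Name)
    (s : Name × List Literal × List (List Literal) × List Name) :
    (writeName x).foldr parseStep s = (x ++ s.1, s.2) := by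
  induction x with
  | nil => rfl
  | cons b x ih =>
    rw [writeName, List.map_cons, List.foldr_cons]
    change parseStep _ ((writeName x).foldr parseStep s) = _
    rw [ih]
    cases b <;> rfl

theorem foldr_parseStep_writeLiterals (c : List Literal)
    (t : List (List Literal) × List Name) :
    (c.flatMap writeLiteral).foldr parseStep ([], [], t) = ([], c, t) := by
  induction c with
  | nil => rfl
  | cons l c ih =>
    obtain ⟨x, b⟩ := l
    rw [List.flatMap_cons, List.foldr_append, ih, writeLiteral, List.foldr_cons,
      foldr_parseStep_writeName, List.append_nil]
    cases b <;> rfl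

theorem foldr_parseStep_writeClauses (C : List (List Literal)) (V : List Name) :
    (C.flatMap writeClause).foldr parseStep ([], [], [], V) = ([], [], C, V) := by
  induction C with
  | nil => rfl
  | cons c C ih =>
    rw [List.flatMap_cons, List.foldr_append, ih, writeClause, List.foldr_cons,
      foldr_parseStep_writeLiterals]
    rfl

/-- Read from the right, a marker is met exactly when the block that it introduces is complete.
Hence a string determines its lists. -/
theorem parse_writeFormula (V : List Name) (C : List (List Literal)) :
    parse (writeFormula V C) = (V, C) := by
  have : ∀ V : List Name, (V.flatMap fun x => 2 :: writeName x).foldr parseStep ([], [], C, []) =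
      ([], [], C, V) := by
    intro V
    induction V with
    | nil => rfl
    | cons x V ih =>
      rw [List.flatMap_cons, List.foldr_append, ih, List.foldr_cons, foldr_parseStep_writeName,
        List.append_nil]
      rfl
  rw [parse, writeFormula, List.foldr_append, foldr_parseStep_writeClauses, this]

/-- The clause is the unit clause of the literal. -/
def isUnit (c : List Literal) (l : Literal) : Bool :=
  !c.isEmpty && c.all fun l' => decide (l' = l)

theorem isUnit_iff {c : List Literal} {l : Literal} : isUnit c l = true ↔ c.toFinset = {l} := by
  simp only [isUnit, Bool.and_eq_true, Bool.not_eq_true', List.isEmpty_eq_false_iff,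
    List.all_eq_true, decide_eq_true_eq]
  constructor
  · rintro ⟨h1, h2⟩
    obtain ⟨l', hl'⟩ := List.exists_mem_of_ne_nil c h1
    ext m
    rw [List.mem_toFinset, Finset.mem_singleton]
    exact ⟨h2 m, fun h => h ▸ h2 l' hl' ▸ hl'⟩
  · intro h
    refine ⟨?_, fun m hm => ?_⟩
    · rintro rfl
      simp at h
    · rw [← List.mem_toFinset, h] at hm
      exact Finset.mem_singleton.mp hm

/-- The lists make up a unit-conflict free formula. -/
def validLists (V : List Name) (C : List (List Literal)) : Bool :=
  (C.all fun c => !c.isEmpty && c.all fun l => memb V l.1) &&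
    V.all fun x => !((C.any fun c => isUnit c (x, true)) && C.any fun c => isUnit c (x, false))

theorem validLists_iff {V : List Name} {C : List (List Literal)} : validLists V C = true ↔
    (∀ c ∈ C, c ≠ []) ∧ (∀ c ∈ C, ∀ l ∈ c, l.1 ∈ V) ∧ ListUCF C := by
  have h1 : validLists V C = true ↔ (∀ c ∈ C, c ≠ [] ∧ ∀ l ∈ c, l.1 ∈ V) ∧
      ∀ x ∈ V, ¬((∃ c ∈ C, c.toFinset = {(x, true)}) ∧ ∃ c ∈ C, c.toFinset = {(x, false)}) := by
    rw [validLists, Bool.and_eq_true, List.all_eq_true, List.all_eq_true]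
    refine and_congr ?_ ?_
    · simp [memb_iff]
    · refine forall₂_congr fun x _ => ?_
      rw [Bool.not_eq_true', ← Bool.not_eq_true, Bool.and_eq_true, List.any_eq_true,
        List.any_eq_true]
      simp only [isUnit_iff]
  rw [h1]
  constructor
  · rintro ⟨h2, h3⟩
    refine ⟨fun c hc => (h2 c hc).1, fun c hc => (h2 c hc).2, fun x hx => ?_⟩
    obtain ⟨⟨c, hc, h⟩, -⟩ := id hx
    refine h3 x ((h2 c hc).2 (x, true) ?_) hx
    rw [← List.mem_toFinset, h]
    exact Finset.mem_singleton_self _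
  · rintro ⟨h2, h3, h4⟩
    exact ⟨fun c hc => ⟨h2 c hc, h3 c hc⟩, fun x _ => h4 x⟩

/-- The string encodes a unit-conflict free formula. -/
def valid (w : List (Fin 6)) : Bool :=
  decide (writeFormula (parse w).1 (parse w).2 = w) && validLists (parse w).1 (parse w).2

/-- As `parse` accepts every string, `valid` writes the result back to detect malformed ones; on
written formulas this test always succeeds. -/
theorem valid_writeFormula {V : List Name} {C : List (List Literal)} :
    valid (writeFormula V C) = validLists V C := by
  rw [valid, parse_writeFormula]
  simp

theorem writeFormula_parse {w : List (Fin 6)} (h : valid w = true) :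
    writeFormula (parse w).1 (parse w).2 = w := by
  rw [valid, Bool.and_eq_true, decide_eq_true_eq] at h
  exact h.1

/-! ### Lists and formulas -/

/-- The lists represent the formula. -/
def Represents (V : List Name) (C : List (List Literal)) (F : CNF) : Prop :=
  V.toFinset = F.vars ∧ (C.map List.toFinset : Multiset (Finset Literal)) = F.clauses

theorem encodes_writeFormula_iff {V : List Name} {C : List (List Literal)} {F : CNF} :
    Encodes (writeFormula V C) F ↔ Represents V C F := by
  constructor
  · rintro ⟨V', C', h, h'⟩
    have := congrArg parse h
    rw [parse_writeFormula, parse_writeFormula, Prod.mk.injEq] at this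
    obtain ⟨rfl, rfl⟩ := this
    exact h'
  · exact fun h => ⟨V, C, rfl, h⟩

theorem exists_represents {V : List Name} {C : List (List Literal)} (h : ∀ c ∈ C, c ≠ [])
    (h' : ∀ c ∈ C, ∀ l ∈ c, l.1 ∈ V) : ∃ F, Represents V C F := by
  refine ⟨⟨V.toFinset, (C.map List.toFinset : Multiset (Finset Literal)), ?_, ?_⟩, rfl, rfl⟩
  · intro c hc
    obtain ⟨d, hd, rfl⟩ := List.mem_map.mp (Multiset.mem_coe.mp hc)
    rw [List.toFinset_nonempty_iff]
    exact h d hd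
  · intro c hc l hl
    obtain ⟨d, hd, rfl⟩ := List.mem_map.mp (Multiset.mem_coe.mp hc)
    rw [List.mem_toFinset] at hl ⊢
    exact h' d hd l hl

namespace Represents

variable {V : List Name} {C : List (List Literal)} {F : CNF}

theorem mem_clauses (h : Represents V C F) {c : Finset Literal} :
    c ∈ F.clauses ↔ ∃ d ∈ C, d.toFinset = c := by
  rw [← h.2, Multiset.mem_coe, List.mem_map]

theorem card_clauses (h : Represents V C F) : F.clauses.card = C.length := by
  rw [← h.2, Multiset.coe_card, List.length_map]

theorem ucf_iff (h : Represents V C F) : F.UCF ↔ ListUCF C := by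
  simp only [CNF.UCF, ListUCF, h.mem_clauses]

theorem validLists_iff (h : Represents V C F) : validLists V C = true ↔ F.UCF := by
  rw [SatKernel.validLists_iff, h.ucf_iff]
  refine ⟨fun h => h.2.2, fun hu => ⟨fun c hc => ?_, fun c hc l hl => ?_, hu⟩⟩
  · rw [← List.toFinset_nonempty_iff]
    exact F.clauses_nonempty _ (h.mem_clauses.mpr ⟨c, hc, rfl⟩)
  · rw [← List.mem_toFinset, h.1]
    exact F.mem_vars _ (h.mem_clauses.mpr ⟨c, hc, rfl⟩) l (List.mem_toFinset.mpr hl)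

theorem weight_eq (h : Represents V C F) (A : Name → Bool) :
    F.weight (fun x => A x.1) = satCount A C := by
  rw [CNF.weight, satCount, Multiset.countP_congr h.2.symm fun _ _ => rfl, Multiset.coe_countP,
    List.countP_map]
  refine List.countP_congr fun c hc => ?_
  rw [Function.comp_apply, decide_eq_true_eq, List.any_eq_true]
  constructor
  · rintro ⟨x, hx⟩
    exact ⟨_, List.mem_toFinset.mp hx, by simp⟩
  · rintro ⟨l, hl, hA⟩
    have hl' := List.mem_toFinset.mpr hl
    refine ⟨⟨l.1, F.mem_vars _ (h.mem_clauses.mpr ⟨c, hc, rfl⟩) l hl'⟩, ?_⟩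
    show (l.1, A l.1) ∈ c.toFinset
    rw [eq_of_beq hA]
    exact hl'

theorem le_sat_iff (h : Represents V C F) (s : ℝ) :
    s ≤ F.sat ↔ ∃ A, s ≤ satCount A C := by
  constructor
  · intro hs
    obtain ⟨α, -, hα⟩ := Finset.exists_mem_eq_sup (Finset.univ : Finset (F.vars → Bool))
      Finset.univ_nonempty F.weight
    refine ⟨fun x => if hx : x ∈ F.vars then α ⟨x, hx⟩ else false, ?_⟩
    rw [← h.weight_eq]
    simpa [CNF.sat, hα] using hs
  · rintro ⟨A, hA⟩
    refine hA.trans ?_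
    rw [← h.weight_eq]
    exact_mod_cast Finset.le_sup (f := F.weight) (Finset.mem_univ _)

end Represents

theorem mem_satAbovePhi_writeFormula {V : List Name} {C : List (List Literal)} {k : ℕ} :
    (writeFormula V C, k) ∈ SatAbovePhi ↔ validLists V C = true ∧
      ∃ A, (Real.sqrt 5 - 1) / 2 * (C.length : ℝ) + k ≤ satCount A C := by
  constructor
  · rintro ⟨F, hF, hu, hs⟩
    rw [encodes_writeFormula_iff] at hF
    rw [hF.card_clauses] at hs
    exact ⟨hF.validLists_iff.mpr hu, (hF.le_sat_iff _).mp hs⟩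
  · rintro ⟨hv, hA⟩
    obtain ⟨h1, h2, h3⟩ := SatKernel.validLists_iff.mp hv
    obtain ⟨F, hF⟩ := exists_represents h1 h2
    refine ⟨F, encodes_writeFormula_iff.mpr hF, hF.ucf_iff.mpr h3, ?_⟩
    rw [hF.card_clauses]
    exact (hF.le_sat_iff _).mpr hA

theorem valid_of_mem_satAbovePhi {w : List (Fin 6)} {k : ℕ} (h : (w, k) ∈ SatAbovePhi) :
    valid w = true := by
  obtain ⟨F, ⟨V, C, rfl, hF⟩, hu, -⟩ := h
  rw [valid_writeFormula]
  exact (show Represents V C F from hF).validLists_iff.mpr hu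

theorem valid_of_encodes {w : List (Fin 6)} {F : CNF} (h : Encodes w F) (hu : F.UCF) :
    valid w = true := by
  obtain ⟨V, C, rfl, hF⟩ := h
  rw [valid_writeFormula]
  exact (show Represents V C F from hF).validLists_iff.mpr hu

/-! ### Reading and writing in polynomial time -/

section PolynomialTime

variable {α : Type} [Enc α]

theorem sz_bool_le (b : Bool) : sz b ≤ 3 := by cases b <;> decide

theorem PT.parse : PT parse := by
  have : PT (fun w : List (Fin 6) => w.foldr parseStep ([], [], [], [])) := by
    refine PT.foldr_of_step (l := fun w : List (Fin 6) => w) (init := fun _ => ([], [], [], []))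
      (step := fun _ a s => parseStep a s) (by fun_prop) (by fun_prop) ?_
      ⟨8, fun _ s a _ => ?_⟩
    · unfold parseStep
      fun_prop
    · obtain ⟨cur, lits, C, V⟩ := s
      have h0 := sz_bool_le false
      have h1 := sz_bool_le true
      have h2 := sz_bool_le (decide (a = 4))
      have h3 := one_le_sz cur
      have h4 := one_le_sz lits
      unfold parseStep
      cases decide (a = 0) <;> cases decide (a = 1) <;> cases decide (a = 2) <;>
        cases decide (a = 3) <;>
        simp only [cond_true, cond_false, sz_pair, sz_cons, sz_nil, Polynomial.eval_ofNat] <;>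
        omega
  exact PT.comp (g := fun s : Name × List Literal × List (List Literal) × List Name =>
    (s.2.2.2, s.2.2.1)) (by fun_prop) this

@[fun_prop]
theorem PT.writeName {f : α → Name} (hf : PT f) : PT (fun a => writeName (f a)) := by
  have : PT (fun a => (f a).map fun b => bif b then (1 : Fin 6) else 0) := by fun_prop
  simpa only [SatKernel.writeName, Bool.cond_eq_ite] using this

@[fun_prop]
theorem PT.writeLiteral {f : α → Literal} (hf : PT f) : PT (fun a => writeLiteral (f a)) := by
  have : PT (fun a => (bif (f a).2 then (4 : Fin 6) else 5) :: SatKernel.writeName (f a).1) := by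
    fun_prop
  simpa only [SatKernel.writeLiteral, Bool.cond_eq_ite] using this

@[fun_prop]
theorem PT.writeFormula {f : α → List Name} {g : α → List (List Literal)} (hf : PT f)
    (hg : PT g) : PT (fun a => writeFormula (f a) (g a)) := by
  have : PT (fun a => (f a).flatMap (fun x => 2 :: SatKernel.writeName x) ++
      (g a).flatMap fun c => 3 :: c.flatMap fun l => SatKernel.writeLiteral l) := by
    fun_prop
  exact this

@[fun_prop]
theorem PT.isUnit {f : α → List Literal} {g : α → Literal} (hf : PT f) (hg : PT g) :
    PT (fun a => isUnit (f a) (g a)) := by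
  unfold SatKernel.isUnit
  fun_prop

@[fun_prop]
theorem PT.validLists {f : α → List Name} {g : α → List (List Literal)} (hf : PT f)
    (hg : PT g) : PT (fun a => validLists (f a) (g a)) := by
  unfold SatKernel.validLists
  fun_prop

theorem PT.valid : PT valid := by
  have h1 : PT (fun w : List (Fin 6) => (SatKernel.parse w).1) := PT.fst.comp PT.parse
  have h2 : PT (fun w : List (Fin 6) => (SatKernel.parse w).2) := PT.snd.comp PT.parse
  unfold SatKernel.valid
  fun_prop

end PolynomialTime

/-! ### Exhaustive search -/

/-- Decides whether `√5 b + c ≤ d`. -/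
def sqrtFiveLe (b c d : ℕ) : Bool :=
  decide (c ≤ d) && decide (5 * (b * b) ≤ (d - c) * (d - c))

/-- The inequality √5 b ≤ d - c between non-negative numbers can be squared. The separate test of c
≤ d is needed because subtraction of natural numbers truncates. -/
theorem sqrtFiveLe_iff {b c d : ℕ} :
    sqrtFiveLe b c d = true ↔ Real.sqrt 5 * (b : ℝ) + (c : ℝ) ≤ (d : ℝ) := by
  have h : Real.sqrt 5 * (b : ℝ) = Real.sqrt (5 * ((b : ℝ) * b)) := by
    rw [Real.sqrt_mul (by norm_num), Real.sqrt_mul_self (by positivity)]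
  rw [sqrtFiveLe, Bool.and_eq_true, decide_eq_true_eq, decide_eq_true_eq, ← le_sub_iff_add_le, h,
    Real.sqrt_le_iff, sub_nonneg, Nat.cast_le]
  refine and_congr_right fun hcd => ?_
  rw [← Nat.cast_sub hcd, sq]
  norm_cast

theorem threshold_iff {m k s : ℕ} : sqrtFiveLe m (2 * k) (2 * s + m) = true ↔
    (Real.sqrt 5 - 1) / 2 * (m : ℝ) + (k : ℝ) ≤ (s : ℝ) := by
  rw [sqrtFiveLe_iff]
  push_cast
  constructor <;> intro h <;> linarith

theorem manyVars_iff {n k : ℕ} : sqrtFiveLe (3 * k) (7 * k) n = true ↔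
    (7 + 3 * Real.sqrt 5) * (k : ℝ) ≤ (n : ℝ) := by
  rw [sqrtFiveLe_iff]
  push_cast
  constructor <;> intro h <;> linarith

/-- All subsets of a set of names, if there are at most `b`. -/
def subsets (b : ℕ) (V : List Name) : List (List Name) :=
  V.foldl (fun acc x => bif decide (acc.length ≤ b) then acc ++ acc.map (fun T => x :: T) else acc)
    [[]]

theorem subsets_append (b : ℕ) (V : List Name) (x : Name) : subsets b (V ++ [x]) =
    bif decide ((subsets b V).length ≤ b) then
      subsets b V ++ (subsets b V).map (fun T => x :: T) else subsets b V := by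
  rw [subsets, List.foldl_append]
  rfl

/-- Once the list is longer than `b` it stays so. A final length of at most `b` thus certifies that
no doubling was skipped. -/
theorem length_subsets {b : ℕ} {V : List Name} (h : (subsets b V).length ≤ b) :
    (subsets b V).length = 2 ^ V.length := by
  induction V using List.reverseRecOn with
  | nil => rfl
  | append_singleton V x ih =>
    rw [subsets_append] at h ⊢
    by_cases hb : (subsets b V).length ≤ b
    · rw [decide_eq_true hb, cond_true, List.length_append, List.length_map, ih hb,
        List.length_append, List.length_singleton, pow_succ]
      ring
    · rw [decide_eq_false hb, cond_false] at h
      exact absurd h hb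

theorem length_subsets_le {b : ℕ} {V : List Name} (h : 2 ^ V.length ≤ b) :
    (subsets b V).length ≤ b := by
  induction V using List.reverseRecOn with
  | nil => exact h
  | append_singleton V x ih =>
    rw [List.length_append, List.length_singleton, pow_succ] at h
    have h1 := ih (by omega)
    have h2 := length_subsets h1
    rw [subsets_append, decide_eq_true h1, cond_true, List.length_append, List.length_map]
    omega

theorem exists_mem_subsets {b : ℕ} {V : List Name} (h : (subsets b V).length ≤ b)
    (A : Name → Bool) : ∃ T ∈ subsets b V, ∀ y, y ∈ T ↔ A y = true ∧ y ∈ V := by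
  induction V using List.reverseRecOn with
  | nil => exact ⟨[], by simp [subsets], by simp⟩
  | append_singleton V x ih =>
    rw [subsets_append] at h ⊢
    by_cases hb : (subsets b V).length ≤ b
    · rw [decide_eq_true hb, cond_true]
      obtain ⟨T, hT, hA⟩ := ih hb
      by_cases hx : A x = true
      · refine ⟨x :: T, List.mem_append_right _ (List.mem_map_of_mem hT), fun y => ?_⟩
        rw [List.mem_cons, List.mem_append, List.mem_singleton, hA]
        constructor
        · rintro (rfl | ⟨h1, h2⟩)
          · exact ⟨hx, Or.inr rfl⟩
          · exact ⟨h1, Or.inl h2⟩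
        · rintro ⟨h1, h2 | rfl⟩
          · exact Or.inr ⟨h1, h2⟩
          · exact Or.inl rfl
      · refine ⟨T, List.mem_append_left _ hT, fun y => ?_⟩
        rw [List.mem_append, List.mem_singleton, hA]
        refine and_congr_right fun hy => (or_iff_left ?_).symm
        rintro rfl
        exact hx hy
    · rw [decide_eq_false hb, cond_false] at h
      exact absurd h hb

/-- Some assignment satisfies at least `φ m + k` clauses, by exhaustive search. -/
def bruteForce (b : ℕ) (V : List Name) (C : List (List Literal)) (k : ℕ) : Bool :=
  (subsets b V).any fun T => sqrtFiveLe C.length (2 * k)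
    (2 * (C.filter fun c => c.any fun l => memb T l.1 == l.2).length + C.length)

theorem bruteForce_iff {b k : ℕ} {V : List Name} {C : List (List Literal)}
    (hV : ∀ c ∈ C, ∀ l ∈ c, l.1 ∈ V) (hb : (subsets b V).length ≤ b) :
    bruteForce b V C k = true ↔
      ∃ A, (Real.sqrt 5 - 1) / 2 * (C.length : ℝ) + k ≤ satCount A C := by
  have h : ∀ T, (C.filter fun c => c.any fun l => memb T l.1 == l.2).length =
      satCount (memb T) C := fun T => List.countP_eq_length_filter.symm
  simp only [bruteForce, List.any_eq_true, h, threshold_iff]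
  constructor
  · rintro ⟨T, -, hT⟩
    exact ⟨_, hT⟩
  · rintro ⟨A, hA⟩
    obtain ⟨T, hT, hTA⟩ := exists_mem_subsets hb A
    refine ⟨T, hT, hA.trans (le_of_eq ?_)⟩
    congr 1
    refine List.countP_congr fun c hc => ?_
    rw [List.any_eq_true, List.any_eq_true]
    refine exists_congr fun l => and_congr_right fun hl => ?_
    have : memb T l.1 = A l.1 := by
      rw [Bool.eq_iff_iff, memb_iff, hTA]
      exact and_iff_left (hV c hc l hl)
    rw [this]

section PolynomialTime

variable {α : Type} [Enc α]

@[fun_prop]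
theorem PT.length_comp {β : Type} [Enc β] {f : α → List β} (hf : PT f) :
    PT (fun a => (f a).length) := PT.length.comp hf

@[fun_prop]
theorem PT.sqrtFiveLe {f g h : α → ℕ} (hf : PT f) (hg : PT g) (hh : PT h) :
    PT (fun a => sqrtFiveLe (f a) (g a) (h a)) := by
  unfold SatKernel.sqrtFiveLe
  fun_prop

/-- A doubling only ever starts from at most `b` subsets; the summand 1 serves the initial list. -/
theorem length_subsets_le_two_mul (b : ℕ) (V : List Name) :
    (subsets b V).length ≤ 2 * b + 1 := by
  induction V using List.reverseRecOn with
  | nil => simp [subsets]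
  | append_singleton V x ih =>
    rw [subsets_append]
    by_cases hb : (subsets b V).length ≤ b
    · rw [decide_eq_true hb, cond_true, List.length_append, List.length_map]
      omega
    · rwa [decide_eq_false hb, cond_false]

theorem sz_le_of_mem_subsets {b : ℕ} {V : List Name} : ∀ T ∈ subsets b V, sz T ≤ sz V := by
  induction V using List.reverseRecOn with
  | nil => simp [subsets]
  | append_singleton V x ih =>
    intro T hT
    have h := sz_append V [x]
    rw [sz_cons, sz_nil] at h
    rw [subsets_append] at hT
    cases hb : decide ((subsets b V).length ≤ b) with
    | true =>
      rw [hb, cond_true] at hT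
      rcases List.mem_append.mp hT with hT | hT
      · have := ih T hT
        omega
      · obtain ⟨T', hT', rfl⟩ := List.mem_map.mp hT
        have := ih T' hT'
        rw [sz_cons]
        omega
    | false =>
      rw [hb, cond_false] at hT
      have := ih T hT
      omega

@[fun_prop]
theorem PT.subsets {f : α → ℕ} {g : α → List Name} (hf : PT f) (hg : PT g) :
    PT (fun a => subsets (f a) (g a)) := by
  have : PT (fun p : ℕ × List Name => SatKernel.subsets p.1 p.2) := by
    unfold SatKernel.subsets
    refine PT.foldl_of_bound (l := fun p : ℕ × List Name => p.2) (init := fun _ => [[]])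
      (step := fun p acc x => bif decide (acc.length ≤ p.1) then acc ++ acc.map (fun T => x :: T)
        else acc) (by fun_prop) (by fun_prop) (by fun_prop) ?_
    refine ⟨(2 * Polynomial.X + 1) * (Polynomial.X + 1) + 1, ?_⟩
    rintro ⟨b, V⟩ l₁ l₂ h
    change V = l₁ ++ l₂ at h
    change sz (SatKernel.subsets b l₁) ≤ _
    have h1 := sz_append l₁ l₂
    have h2 := one_le_sz l₂
    have h3 : sz (b, V) = sz b + sz V + 1 := rfl
    rw [sz_nat] at h3
    rw [← h] at h1
    refine (sz_le_length_mul _ (sz l₁) sz_le_of_mem_subsets).trans ?_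
    simp only [Polynomial.eval_add, Polynomial.eval_mul, Polynomial.eval_X,
      Polynomial.eval_ofNat, Polynomial.eval_one]
    refine Nat.add_le_add_right (Nat.mul_le_mul ?_ (by omega)) 1
    have := length_subsets_le_two_mul b l₁
    omega
  exact this.comp (hf.prodMk hg)

@[fun_prop]
theorem PT.bruteForce {e h : α → ℕ} {f : α → List Name} {g : α → List (List Literal)} (he : PT e)
    (hf : PT f) (hg : PT g) (hh : PT h) : PT (fun a => bruteForce (e a) (f a) (g a) (h a)) := by
  unfold SatKernel.bruteForce
  fun_prop

end PolynomialTime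

/-! ### The kernel -/

/-- Remove repeated names. -/
def unrepeated (V : List Name) : List Name :=
  V.foldr (fun x acc => bif memb acc x then acc else x :: acc) []

theorem mem_unrepeated {V : List Name} {x : Name} : x ∈ unrepeated V ↔ x ∈ V := by
  induction V with
  | nil => rfl
  | cons y V ih =>
    change x ∈ (bif memb (unrepeated V) y then unrepeated V else y :: unrepeated V) ↔ _
    cases h : memb (unrepeated V) y with
    | true =>
      rw [cond_true, ih, List.mem_cons, or_iff_right_of_imp]
      rintro rfl
      exact ih.mp (memb_iff.mp h)
    | false => rw [cond_false, List.mem_cons, List.mem_cons, ih]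

theorem nodup_unrepeated (V : List Name) : (unrepeated V).Nodup := by
  induction V with
  | nil => exact List.nodup_nil
  | cons y V ih =>
    change (bif memb (unrepeated V) y then unrepeated V else y :: unrepeated V).Nodup
    cases h : memb (unrepeated V) y with
    | true => exact ih
    | false =>
      refine List.nodup_cons.mpr ⟨fun hy => ?_, ih⟩
      rw [memb_iff.mpr hy] at h
      cases h

/-- The reduced formula. -/
def reduced (p : List Name × List (List Literal)) : List Name × List (List Literal) :=
  (fun q : List Name × List Name => (reduceVars q.2 q.1 p.2, reduceClauses q.2 p.2))
    (unrepeated p.1, removed (unrepeated p.1) p.2)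

/-- Solve a reduced instance if there are many variables or very few. -/
def solveOrKeep (p : List Name × List (List Literal)) (k : ℕ) : List (Fin 6) × ℕ :=
  bif sqrtFiveLe (3 * k) (7 * k) p.1.length then ([], 0)
  else bif decide ((subsets (writeFormula p.1 p.2).length p.1).length ≤
      (writeFormula p.1 p.2).length) then
    bif bruteForce (writeFormula p.1 p.2).length p.1 p.2 k then ([], 0) else ([], k)
  else (writeFormula p.1 p.2, k)

/-- The kernelization. -/
def kernelize (i : List (Fin 6) × ℕ) : List (Fin 6) × ℕ :=
  bif valid i.1 then solveOrKeep (reduced (parse i.1)) i.2 else ([3], 0)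

theorem PT.unrepeated : PT unrepeated := by
  unfold SatKernel.unrepeated
  refine PT.foldr_of_step (l := fun V : List Name => V) (init := fun _ => [])
    (step := fun _ x acc => bif SatKernel.memb acc x then acc else x :: acc)
    (by fun_prop) (by fun_prop) (by fun_prop) ⟨Polynomial.X + 1, fun V acc x hx => ?_⟩
  have := sz_le_of_mem hx
  simp only [Polynomial.eval_add, Polynomial.eval_X, Polynomial.eval_one]
  cases SatKernel.memb acc x
  · rw [cond_false, sz_cons]
    omega
  · rw [cond_true]
    omega

theorem PT.reduced : PT reduced := by
  have h1 : PT (fun p : List Name × List (List Literal) =>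
      (SatKernel.unrepeated p.1)) := PT.unrepeated.comp PT.fst
  unfold SatKernel.reduced
  fun_prop

theorem PT.solveOrKeep :
    PT (fun p : (List Name × List (List Literal)) × ℕ => solveOrKeep p.1 p.2) := by
  unfold SatKernel.solveOrKeep
  fun_prop

theorem PT.kernelize : PT kernelize := by
  have h1 : PT (fun i : List (Fin 6) × ℕ => SatKernel.valid i.1) := PT.valid.comp PT.fst
  have h2 : PT (fun i : List (Fin 6) × ℕ => SatKernel.reduced (SatKernel.parse i.1)) :=
    PT.reduced.comp (PT.parse.comp PT.fst)
  have h3 : PT (fun i : List (Fin 6) × ℕ =>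
      SatKernel.solveOrKeep (SatKernel.reduced (SatKernel.parse i.1)) i.2) :=
    PT.solveOrKeep.comp (h2.prodMk PT.snd)
  unfold SatKernel.kernelize
  fun_prop

theorem nil_zero_mem_satAbovePhi : (([], 0) : List (Fin 6) × ℕ) ∈ SatAbovePhi := by
  rw [show ([] : List (Fin 6)) = writeFormula [] [] from rfl, mem_satAbovePhi_writeFormula]
  exact ⟨rfl, fun _ => true, by simp⟩

theorem nil_notMem_satAbovePhi {k : ℕ} (hk : k ≠ 0) :
    (([], k) : List (Fin 6) × ℕ) ∉ SatAbovePhi := by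
  rw [show ([] : List (Fin 6)) = writeFormula [] [] from rfl, mem_satAbovePhi_writeFormula]
  rintro ⟨-, A, hA⟩
  simp only [List.length_nil, Nat.cast_zero, mul_zero, zero_add, satCount, List.countP_nil]
    at hA
  exact hk (Nat.le_zero.mp (by exact_mod_cast hA))

/-- The string writes an empty clause, which is not allowed, so it serves as the no-instance for
invalid inputs. -/
theorem three_notMem_satAbovePhi {k : ℕ} : (([3], k) : List (Fin 6) × ℕ) ∉ SatAbovePhi := by
  intro h
  have := valid_of_mem_satAbovePhi h
  rw [show ([3] : List (Fin 6)) = writeFormula [] [[]] from rfl, valid_writeFormula,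
    validLists_iff] at this
  exact this.1 [] (by simp) rfl

/-! ### Correctness of the kernelization -/

section Correctness

variable {V : List Name} {C : List (List Literal)}

theorem validLists_reduced (h : validLists V C = true) :
    validLists (reduced (V, C)).1 (reduced (V, C)).2 = true := by
  obtain ⟨h1, h2, h3⟩ := validLists_iff.mp h
  exact validLists_iff.mpr ⟨ne_nil_of_mem_reduceClauses h1,
    mem_reduceVars_of_mem fun c hc l hl => mem_unrepeated.mpr (h2 c hc l hl),
    listUCF_reduceClauses h3⟩

theorem length_reduced : (reduced (V, C)).2.length = C.length := List.length_map _

theorem mem_satAbovePhi_reduced_iff (h : validLists V C = true) {k : ℕ} :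
    (writeFormula (reduced (V, C)).1 (reduced (V, C)).2, k) ∈ SatAbovePhi ↔
      (writeFormula V C, k) ∈ SatAbovePhi := by
  rw [mem_satAbovePhi_writeFormula, mem_satAbovePhi_writeFormula,
    and_iff_right h, and_iff_right (validLists_reduced h), length_reduced]
  have := fun s => exists_satCount_reduceClauses_iff (C := C) (nodup_unrepeated V) s
  -- Counts are natural numbers, so the real threshold may be rounded up.
  have key : ∀ (r : ℝ) (C' : List (List Literal)), (∃ A, r ≤ satCount A C') ↔
      ∃ A, ⌈r⌉₊ ≤ satCount A C' := fun r C' => by simp only [Nat.ceil_le]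
  rw [key, key]
  exact this _

/-- The surplus per variable, (2 - 3φ)/2 = (7 - 3√5)/4, is the reciprocal of 7 + 3√5, so it adds up
to at least `k`. -/
theorem mem_satAbovePhi_of_many_vars (h : validLists V C = true) {k : ℕ}
    (hk : (7 + 3 * Real.sqrt 5) * (k : ℝ) ≤ ((reduced (V, C)).1.length : ℝ)) :
    (writeFormula V C, k) ∈ SatAbovePhi := by
  rw [← mem_satAbovePhi_reduced_iff h, mem_satAbovePhi_writeFormula]
  refine ⟨validLists_reduced h, ?_⟩
  obtain ⟨h1, h2, h3⟩ := validLists_iff.mp h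
  have h5 : Real.sqrt 5 ^ 2 = 5 := Real.sq_sqrt (by norm_num)
  have h6 : 2 ≤ Real.sqrt 5 := Real.le_sqrt_of_sq_le (by norm_num)
  have h7 : Real.sqrt 5 ≤ 7 / 3 := Real.sqrt_le_iff.mpr ⟨by norm_num, by norm_num⟩
  obtain ⟨A, hA⟩ := exists_satCount_reduceClauses_ge (φ := (Real.sqrt 5 - 1) / 2) (by linarith)
    (by linarith) (by linarith) (nodup_unrepeated V) h1
    (fun c hc l hl => mem_unrepeated.mpr (h2 c hc l hl)) h3
  refine ⟨A, le_trans ?_ hA⟩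
  rw [length_reduced]
  refine add_le_add_right ?_ _
  have h8 := mul_le_mul_of_nonneg_left hk
    (show (0 : ℝ) ≤ (2 - 3 * ((Real.sqrt 5 - 1) / 2)) / 2 by linarith)
  refine le_trans (le_of_eq ?_) h8
  linear_combination (9 / 4 * (k : ℝ)) * h5

/-- With many variables the instance is a yes-instance. Otherwise, if the enumeration of subsets
stays within the length of the string, the instance has been solved; if not, the string is shorter
than 2 to the number of variables, which is bounded in terms of `k`. -/
theorem solveOrKeep_spec (h : validLists V C = true) (k : ℕ) :
    ((writeFormula V C, k) ∈ SatAbovePhi ↔ solveOrKeep (reduced (V, C)) k ∈ SatAbovePhi) ∧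
    (solveOrKeep (reduced (V, C)) k).2 ≤ k ∧
    (solveOrKeep (reduced (V, C)) k).1.length ≤ 2 ^ (14 * k) ∧
    ∃ V' C', (solveOrKeep (reduced (V, C)) k).1 = writeFormula V' C' ∧
      validLists V' C' = true ∧ (V'.length : ℝ) ≤ (7 + 3 * Real.sqrt 5) * (k : ℝ) := by
  have hm := mem_satAbovePhi_reduced_iff h (k := k)
  have hbig := mem_satAbovePhi_of_many_vars h (k := k)
  have hv := validLists_reduced h
  have hn : (0 : ℝ) ≤ (7 + 3 * Real.sqrt 5) * (k : ℝ) := by positivity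
  generalize reduced (V, C) = p at hm hbig hv
  have hnil : ∃ V' C', ([] : List (Fin 6)) = writeFormula V' C' ∧ validLists V' C' = true ∧
      (V'.length : ℝ) ≤ (7 + 3 * Real.sqrt 5) * (k : ℝ) := ⟨[], [], rfl, rfl, by simpa using hn⟩
  unfold solveOrKeep
  cases h1 : sqrtFiveLe (3 * k) (7 * k) p.1.length with
  | true =>
    exact ⟨iff_of_true (hbig (manyVars_iff.mp h1)) nil_zero_mem_satAbovePhi, Nat.zero_le _,
      Nat.zero_le _, hnil⟩
  | false =>
    have h1' : ¬ (7 + 3 * Real.sqrt 5) * (k : ℝ) ≤ (p.1.length : ℝ) := by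
      rw [← manyVars_iff, h1]; exact Bool.false_ne_true
    -- For `k = 0` the first test always succeeds, so the empty formula with parameter `k` is a
    -- genuine no-instance here.
    have hk : k ≠ 0 := by
      rintro rfl
      simp at h1'
    have hlt := not_le.mp h1'
    rw [cond_false]
    by_cases h2 : (subsets (writeFormula p.1 p.2).length p.1).length ≤
        (writeFormula p.1 p.2).length
    · rw [decide_eq_true h2, cond_true]
      have h3 := bruteForce_iff (k := k) (validLists_iff.mp hv).2.1 h2
      rw [← and_iff_right hv (b := ∃ A, _), ← mem_satAbovePhi_writeFormula, hm] at h3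
      cases h4 : bruteForce (writeFormula p.1 p.2).length p.1 p.2 k with
      | true =>
        exact ⟨iff_of_true (h3.mp h4) nil_zero_mem_satAbovePhi, Nat.zero_le _, Nat.zero_le _, hnil⟩
      | false =>
        refine ⟨iff_of_false (fun hc => ?_) (nil_notMem_satAbovePhi hk), le_rfl, Nat.zero_le _,
          hnil⟩
        rw [← h3, h4] at hc
        cases hc
    · rw [decide_eq_false h2, cond_false]
      refine ⟨hm.symm, le_rfl, ?_, p.1, p.2, rfl, hv, hlt.le⟩
      have h3 : (writeFormula p.1 p.2).length < 2 ^ p.1.length := by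
        by_contra hc
        exact h2 (length_subsets_le (not_lt.mp hc))
      refine h3.le.trans (Nat.pow_le_pow_right (by norm_num) ?_)
      have h7 : Real.sqrt 5 ≤ 7 / 3 := Real.sqrt_le_iff.mpr ⟨by norm_num, by norm_num⟩
      -- By √5 ≤ 7/3, 7 + 3√5 is at most 14.
      have : (p.1.length : ℝ) ≤ 14 * (k : ℝ) := by
        have : (0 : ℝ) ≤ k := Nat.cast_nonneg k
        nlinarith
      exact_mod_cast this

end Correctness

theorem kernelize_spec (i : List (Fin 6) × ℕ) :
    (i ∈ SatAbovePhi ↔ kernelize i ∈ SatAbovePhi) ∧ (kernelize i).2 ≤ i.2 ∧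
      (kernelize i).1.length ≤ 2 ^ (14 * i.2) := by
  obtain ⟨w, k⟩ := i
  unfold kernelize
  cases hw : valid w with
  | true =>
    have h := hw
    rw [← writeFormula_parse hw, valid_writeFormula] at h
    obtain ⟨h1, h2, h3, -⟩ := solveOrKeep_spec h k
    rw [writeFormula_parse hw] at h1
    exact ⟨h1, h2, h3⟩
  | false =>
    refine ⟨iff_of_false (fun hc => ?_) three_notMem_satAbovePhi, Nat.zero_le _,
      Nat.one_le_two_pow⟩
    rw [valid_of_mem_satAbovePhi hc] at hw
    cases hw

theorem exists_encodes_kernelize {w : List (Fin 6)} {k : ℕ} {F : CNF} (hF : Encodes w F)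
    (hu : F.UCF) : ∃ F', Encodes (kernelize (w, k)).1 F' ∧ F'.UCF ∧
      F'.vars.card ≤ ⌊(7 + 3 * Real.sqrt 5) * (k : ℝ)⌋₊ := by
  have hw := valid_of_encodes hF hu
  have h := hw
  rw [← writeFormula_parse hw, valid_writeFormula] at h
  obtain ⟨-, -, -, V', C', h1, h2, h3⟩ := solveOrKeep_spec h k
  obtain ⟨h4, h5, h6⟩ := validLists_iff.mp h2
  obtain ⟨F', hF'⟩ := exists_represents h4 h5
  refine ⟨F', ?_, hF'.ucf_iff.mpr h6, ?_⟩
  · rw [kernelize, hw, cond_true]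
    rw [show parse w = ((parse w).1, (parse w).2) from rfl, h1]
    exact encodes_writeFormula_iff.mpr hF'
  · rw [← hF'.1]
    exact (List.toFinset_card_le V').trans (Nat.le_floor h3)

/-! ### Fixed-parameter tractability -/

/-- The loop of a fold without a time bound, as needed for a state that grows exponentially: the
cutoff of the exhaustive search, in unary, is built by one doubling per symbol. -/
theorem exists_eval_fold_loop {α β σ : Type} [Enc α] [Enc β] [Enc σ] {S : Prog}
    {step : α → σ → β → σ} (c : α)
    (hS : ∀ s b, ∃ t, Eval S (enc (c, s, b)) (enc (step c s b)) t) (l : List β) (s : σ) :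
    ∃ t, Eval (.loop foldTest (foldBody S)) (enc (c, s, l))
      (enc (c, l.foldl (step c) s, ([] : List β))) t := by
  induction l generalizing s with
  | nil =>
    obtain ⟨t, -, he⟩ := eval_foldTest (enc c) (enc s) (enc ([] : List β))
    exact ⟨_, .loop_done he⟩
  | cons b l ih =>
    obtain ⟨t₀, -, he₀⟩ := eval_foldTest (enc c) (enc s) (enc (b :: l))
    obtain ⟨t₁, he₁⟩ := hS s b
    obtain ⟨t₂, -, he₂⟩ := eval_foldBody (l := enc l) he₁
    obtain ⟨t₃, he₃⟩ := ih (step c s b)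
    exact ⟨_, .loop_step he₀ he₂ he₃⟩

/-- Decides an instance by exhaustive search over at most `b` assignments. -/
def decideWith (i : List (Fin 6) × ℕ) (b : ℕ) : Bool :=
  valid i.1 && bruteForce b (parse i.1).1 (parse i.1).2 i.2

theorem length_fst_parse_le {w : List (Fin 6)} (h : valid w = true) :
    (parse w).1.length ≤ w.length := by
  have key : ∀ V : List Name, V.length ≤ (V.flatMap fun x => (2 : Fin 6) :: writeName x).length := by
    intro V
    induction V with
    | nil => exact le_rfl
    | cons x V ih =>
      simp only [List.flatMap_cons, List.length_append, List.length_cons] at ih ⊢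
      omega
  conv_rhs => rw [← writeFormula_parse h]
  rw [writeFormula, List.length_append]
  exact (key _).trans (Nat.le_add_right _ _)

theorem decideWith_iff (i : List (Fin 6) × ℕ) :
    decideWith i (2 ^ i.1.length) = true ↔ i ∈ SatAbovePhi := by
  obtain ⟨w, k⟩ := i
  rw [decideWith, Bool.and_eq_true]
  by_cases h : valid w = true
  · rw [and_iff_right h]
    have hv := h
    rw [← writeFormula_parse h, valid_writeFormula] at hv
    rw [bruteForce_iff (validLists_iff.mp hv).2.1 (length_subsets_le
      (Nat.pow_le_pow_right (by norm_num) (length_fst_parse_le h))),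
      ← and_iff_right hv (b := ∃ A, _), ← mem_satAbovePhi_writeFormula, writeFormula_parse h]
  · exact iff_of_false (fun hc => h hc.1) fun hc => h (valid_of_mem_satAbovePhi hc)

theorem exists_decider : ∃ P : Prog, ∀ i : List (Fin 6) × ℕ,
    ∃ t, Eval P (enc i) (enc (decideWith i (2 ^ i.1.length))) t := by
  obtain ⟨I, _, hI⟩ : PT (fun i : List (Fin 6) × ℕ => (i, (1 : ℕ), i.1)) := by fun_prop
  obtain ⟨S, _, hS⟩ : PT (fun p : (List (Fin 6) × ℕ) × ℕ × Fin 6 => p.2.1 + p.2.1) := by fun_prop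
  obtain ⟨E, _, hE⟩ : PT (fun p : (List (Fin 6) × ℕ) × ℕ × List (Fin 6) =>
      decideWith p.1 p.2.1) := by
    have h1 : PT (fun p : (List (Fin 6) × ℕ) × ℕ × List (Fin 6) => valid p.1.1) :=
      PT.valid.comp (f := fun p : (List (Fin 6) × ℕ) × ℕ × List (Fin 6) => p.1.1) (by fun_prop)
    have h2 : PT (fun p : (List (Fin 6) × ℕ) × ℕ × List (Fin 6) => parse p.1.1) :=
      PT.parse.comp (f := fun p : (List (Fin 6) × ℕ) × ℕ × List (Fin 6) => p.1.1) (by fun_prop)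
    exact h1.and (PT.bruteForce (by fun_prop) (PT.fst.comp h2) (PT.snd.comp h2) (by fun_prop))
  refine ⟨.seq I (.seq (.loop foldTest (foldBody S)) E), fun i => ?_⟩
  obtain ⟨t₁, -, h₁⟩ := hI i
  obtain ⟨t₂, h₂⟩ := exists_eval_fold_loop (step := fun _ n _ => n + n) i
    (fun n b => (hS (i, n, b)).imp fun _ h => h.2) i.1 1
  obtain ⟨t₃, -, h₃⟩ := hE (i, i.1.foldl (fun n _ => n + n) 1, [])
  have key : ∀ (l : List (Fin 6)) (n : ℕ), l.foldl (fun n _ => n + n) n = n * 2 ^ l.length := by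
    intro l
    induction l with
    | nil => intro n; simp
    | cons a l ih => intro n; rw [List.foldl_cons, ih, List.length_cons, pow_succ]; ring
  simp only [key, one_mul] at h₂ h₃
  exact ⟨_, .seq h₁ (.seq h₂ h₃)⟩

/-- Symbols are at most 5 and so have size at most 11, with one list node each. -/
theorem sz_instance_le (x : List (Fin 6)) (k : ℕ) : sz (x, k) ≤ 12 * (x.length + k) + 3 := by
  have h := sz_le_length_mul x 11 fun a _ => by
    have := sz_nat a
    have := a.isLt
    change sz (a : ℕ) ≤ 11
    omega
  rw [sz_pair, sz_nat]
  omega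

theorem enc_instance {s : ℕ} (i : List (Fin s) × ℕ) : enc i = Data.ofInstance i := by
  -- In `Data.ofInstance` the coercion of the symbols to numbers acts on the whole list and unfolds
  -- to this `flatMap`.
  have h : ∀ x : List (Fin s), ((x.flatMap fun a : Fin s => [a.val]).map fun a => Data.ofNat a) =
      x.map enc := by
    intro x
    induction x with
    | nil => rfl
    | cons a x ih => rw [List.flatMap_cons, List.map_append, ih]; rfl
  obtain ⟨x, k⟩ := i
  exact congrArg (fun l => Data.pair (Data.ofList l) (Data.ofNat k)) (h x).symm

theorem polyTimeComputable_kernelize : PolyTimeComputable kernelize := by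
  obtain ⟨P, p, h⟩ := PT.kernelize
  refine ⟨P, p.comp (12 * Polynomial.X + 3), fun x k => ?_⟩
  obtain ⟨t, ht, he⟩ := h (x, k)
  rw [enc_instance, enc_instance] at he
  refine ⟨t, ht.trans ?_, he⟩
  rw [Polynomial.eval_comp]
  refine polynomial_eval_mono p ((sz_instance_le x k).trans (le_of_eq ?_))
  simp

theorem polynomial_eval_mul_le (p : Polynomial ℕ) (a : ℕ) {b : ℕ} (hb : 1 ≤ b) :
    p.eval (a * b) ≤ p.eval a * b ^ p.natDegree := by
  rw [Polynomial.eval_eq_sum_range, Polynomial.eval_eq_sum_range, Finset.sum_mul]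
  refine Finset.sum_le_sum fun i hi => ?_
  rw [mul_pow, ← mul_assoc]
  exact Nat.mul_le_mul_left _ (Nat.pow_le_pow_right hb (Finset.mem_range_succ_iff.mp hi))

/-- A problem with a proper kernelization that is decided by some program is fixed-parameter
tractable. -/
theorem IsProperKernelization.isFPT {L : ParamProblem 6}
    {K : List (Fin 6) × ℕ → List (Fin 6) × ℕ} (hK : IsProperKernelization L K)
    {dec : List (Fin 6) × ℕ → Bool} (hdec : ∀ i, dec i = true ↔ i ∈ L)
    (hP : ∃ P : Prog, ∀ i, ∃ t, Eval P (enc i) (enc (dec i)) t) : IsFPT L := by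
  obtain ⟨Q, hQ⟩ := hP
  choose T hT using hQ
  obtain ⟨P, p, hp⟩ := hK.polyTime
  obtain ⟨g, hg⟩ := hK.size_le
  -- For fixed `k` only finitely many kernels are possible, so any decider has bounded running time
  -- on them.
  have hfin : ∀ k, ∃ B, ∀ i : List (Fin 6) × ℕ, i.1.length ≤ g k → i.2 ≤ k → T i ≤ B := by
    intro k
    have h1 : ({x : List (Fin 6) | x.length ≤ g k} ×ˢ Set.Iic k).Finite :=
      (List.finite_length_le _ _).prod (Set.finite_Iic k)
    obtain ⟨B, hB⟩ := (h1.image T).bddAbove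
    exact ⟨B, fun i hi hk => hB ⟨i, ⟨hi, hk⟩, rfl⟩⟩
  choose B hB using hfin
  refine ⟨.seq P Q, fun k => p.eval (k + 1) + B k + 1, p.natDegree, fun x k => ?_⟩
  obtain ⟨t, ht, he⟩ := hp x k
  have h1 := hT (K (x, k))
  have h2 := hB k (K (x, k)) (hg _) (hK.parameter_le _)
  refine ⟨t + T (K (x, k)) + 1, ?_, ?_⟩
  -- The estimate |x| + k ≤ (k + 1)(|x| + 1) separates the parameter from the length of the string.
  · have h3 : p.eval (x.length + k) ≤ p.eval (k + 1) * (x.length + 1) ^ p.natDegree :=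
      (polynomial_eval_mono p (by nlinarith)).trans
        (polynomial_eval_mul_le p (k + 1) (Nat.succ_le_succ (Nat.zero_le x.length)))
    have h4 : 1 ≤ (x.length + 1) ^ p.natDegree := Nat.one_le_pow _ _ (Nat.succ_pos _)
    nlinarith
  · have h3 : ∀ _ : Decidable ((x, k) ∈ L), dec (K (x, k)) = decide ((x, k) ∈ L) := by
      intro _
      rw [Bool.eq_iff_iff, hdec, ← hK.equivalent, decide_eq_true_iff]
    rw [enc_instance, h3 (Classical.propDecidable _)] at h1
    exact .seq he h1

theorem isProperKernelization_kernelize : IsProperKernelization SatAbovePhi kernelize where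
  polyTime := polyTimeComputable_kernelize
  equivalent i := (kernelize_spec i).1
  parameter_le i := (kernelize_spec i).2.1
  size_le := ⟨fun k => 2 ^ (14 * k), fun i => (kernelize_spec i).2.2⟩

end SatKernel

theorem mainTheorem4 :
    (∃ K : List (Fin 6) × ℕ → List (Fin 6) × ℕ,
      SatKernel.IsProperKernelization SatKernel.SatAbovePhi K ∧
      ∀ (x : List (Fin 6)) (k : ℕ) (F : SatKernel.CNF), SatKernel.Encodes x F → F.UCF →
        ∃ F' : SatKernel.CNF, SatKernel.Encodes (K (x, k)).1 F' ∧ F'.UCF ∧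
          F'.vars.card ≤ ⌊(7 + 3 * Real.sqrt 5) * (k : ℝ)⌋₊) ∧
    SatKernel.IsFPT SatKernel.SatAbovePhi :=
  ⟨⟨SatKernel.kernelize, SatKernel.isProperKernelization_kernelize, fun _ _ _ hF hu =>
      SatKernel.exists_encodes_kernelize hF hu⟩,
    SatKernel.isProperKernelization_kernelize.isFPT SatKernel.decideWith_iff
      SatKernel.exists_decider⟩
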